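/- **Setting.** Let $p$ be an odd prime and $n,s\ge 1$ integers. Let $K\subset\mathbb C_p$ be the metric completion of the maximum unramified extension of $\mathbb Q_p$, $R$ its valuation ring, and $K^{\rm alg}$ the algebraic closure of $K$ in $\mathbb C_p$. Let $\Pi$ be the set of all $\pi\in\mathbb Q_p^{\rm alg}$ that are prime elements of some finite Galois extension of $\mathbb Q_p$; for $\pi\in\Pi$ let $K_\pi=K(\pi)$ and let $R_\pi$ be its valuation ring (which is $R[\pi]$). Fix continuous automorphisms $\phi_1,\dots,\phi_n$ of $K^{\rm alg}/\mathbb Q_p$ inducing the $p^s$-power map on the residue field of the valuation ring of $K^{\rm alg}$; for each $\pi\in\Pi$ they induce the higher $\pi$-derivations $\delta_{\pi,i}a=(\phi_i(a)-a^{p^s})/\pi$ on $R_\pi$. A superscript $\widehat{\ }$ denotes $p$-adic completion, $x$ is an $n\times n$ matrix of indeterminates, and for a matrix $M=(M_{ij})$ we write $M^{(p^s)}=(M_{ij}^{p^s})$. *Jet algebras.* Let $Q$ be a symmetric $n\times n$ matrix of indeterminates, $S=R[Q,\det(Q)^{-1}]$, and let $J^1_\pi(S)=R_\pi[Q,\delta_{\pi,1}Q,\dots,\delta_{\pi,n}Q,\det(Q)^{-1}]^{\widehat{\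 }}$ and $J^1_p(S)=R[Q,\delta_{p,1}Q,\dots,\delta_{p,n}Q,\det(Q)^{-1}]^{\widehat{\ }}$ be the partial jet algebras of order $1$ and degree $s$ (the $\delta_{\pi,i}Q$ are symmetric matrices of new indeterminates). There is a natural homomorphism $$\iota_\pi:J^1_\pi(S)[x,\det(x)^{-1}]^{\widehat{\ }}\to (J^1_p(S)\otimes_RR_\pi)[x,\det(x)^{-1}]^{\widehat{\ }},\quad Q\mapsto Q,\ \ \delta_{\pi,i}Q\mapsto \tfrac p\pi\,\delta_{p,i}Q,\ \ x\mapsto x .$$ A matrix $\Theta_p$ with entries in $J^1_p(S)[x,\det(x)^{-1}]^{\widehat{\ }}$ is *strictly $\delta$-overconvergent* if, for every $\pi\in\Pi$, the images of its entries in $(J^1_p(S)\otimes_RR_\pi)[x,\det(x)^{-1}]^{\widehat{\ }}$ lie in the image of $\iota_\pi$. In that case, for a symmetric matrix $q\in{\rm GL}_n(R_\pi)$, $(\Theta_p)^{\rm alg}(q)$ denotes the matrix over $R_\pi[x,\det(x)^{-1}]^{\widehat{\ }}$ obtained by taking a matrix $\Theta_\pi$ over $J^1_\pi(S)[x,\det(x)^{-1}]^{\widehat{\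 }}$ with the same image as $\Theta_p$ and substituting $Q\mapsto q$, $\delta_{\pi,i}Q\mapsto\delta_{\pi,i}q$ (the result does not depend on the choice of $\Theta_\pi$). *Levi-Civita connections.* A torsion symbol (of the second kind) with coefficients in a ring $B$ is a tuple $L=(L^1,\dots,L^n)$ of antisymmetric $n\times n$ matrices over $B[y]^{\widehat{\ }}$, where $y=(y_1,\dots,y_n)$ is a tuple of $n\times n$ matrices of indeterminates. Let $\mathcal A=R_\pi[x,\det(x)^{-1}]^{\widehat{\ }}$. A $\pi$-connection of degree $s$ is a tuple $(\delta_1^G,\dots,\delta_n^G)$ of higher $\pi$-derivations of degree $s$ on $\mathcal A$ extending $\delta_{\pi,1},\dots,\delta_{\pi,n}$; its Frobenius lifts are $\phi_i^G(a)=a^{p^s}+\pi\,\delta^G_ia$. Put $\Gamma_{ij}^k=\big((x^{(p^s)})^{-1}\delta_i^G x\big)_{kj}$ and $\Lambda_i=(x^{(p^s)})^{-1}\phi_i^G(x)$. The connection is symmetric with respect to a torsion symbol $L$ over $R_\pi$ if $\Gamma_{ij}^k-\Gamma_{ji}^k=L_{ij}^k(\Lambda_1,\dots,\Lambda_n)$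 for all $i,j,k$, and metric with respect to a symmetric $q\in{\rm GL}_n(R_\pi)$ if $\phi_i^G\circ\mathcal H_q=\mathcal H_q\circ\phi^G_{i,0}$ for all $i$, where $\mathcal H_q$ is the $R_\pi$-algebra endomorphism of $\mathcal A$ with $\mathcal H_q(x)=x^tqx$ and $\phi^G_{i,0}$ are the Frobenius lifts of the $\pi$-connection with $\delta^G_{i,0}x=0$. The Levi-Civita connection of degree $s$ attached to $q$ and $L$ is the unique $\pi$-connection of degree $s$ that is metric with respect to $q$ and symmetric with respect to $L$. **Theorem ($\delta$-overconvergence of Levi-Civita).** Fix a torsion symbol $L_p$ of the second kind with coefficients in $R$. There exist strictly $\delta$-overconvergent $n\times n$ matrices $\Lambda^{\bf LC}_{p,1},\dots,\Lambda^{\bf LC}_{p,n}$ over $J^1_p(S)[x,\det(x)^{-1}]^{\widehat{\ }}$ with the following property. For all $\pi\in\Pi$ and all symmetric $q\in{\rm GL}_n(R_\pi)$, the Levi-Civita connection of degree $s$ attached to $q$ and to the torsion symbol $L_\pi=\frac p\pi L_p$ exists and is unique, and its Frobenius lifts $\phi^{\rm LC}_{\pi,1},\dots,\phi^{\rm LC}_{\pi,n}$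 satisfy $$\phi^{\rm LC}_{\pi,i}(x)=x^{(p^s)}\cdot(\Lambda^{\bf LC}_{p,i})^{\rm alg}(q)\qquad\text{for all } i\in\{1,\dots,n\}.$$ -/

import Mathlib

noncomputable section

open scoped TensorProduct

namespace ArithLC

/-! ## The `p`-adic fields and rings

Everything lives inside the field `ℂ_[p]` of `p`-adic complex numbers. -/

section Fields

variable (p : ℕ) [Fact p.Prime]

/-- The maximum unramified extension of `ℚ_p` inside the algebraic closure of `ℚ_p`: the
compositum of all finite extensions of `ℚ_p` with ramification index one (the same value group
as `ℚ_p`; their residue fields are finite, so the residue extension is separable). -/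
def Qur : IntermediateField ℚ_[p] (PadicAlgCl p) :=
  sSup {F | FiniteDimensional ℚ_[p] F ∧ ∀ x ∈ F, ∃ y : ℚ_[p], ‖x‖ = ‖y‖}

/-- `K`: the metric completion of the maximum unramified extension of `ℚ_p`, that is, its closure
in `ℂ_[p]`. -/
def K : IntermediateField ℚ_[p] ℂ_[p] where
  __ := ((Qur p).map
    (IsScalarTower.toAlgHom ℚ_[p] (PadicAlgCl p) ℂ_[p])).toSubfield.topologicalClosure
  algebraMap_mem' r := Subfield.le_topologicalClosure _
    (((Qur p).map (IsScalarTower.toAlgHom ℚ_[p] (PadicAlgCl p) ℂ_[p])).algebraMap_mem r)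

/-- `K^alg`: the algebraic closure of `K` in `ℂ_[p]`. -/
def Kalg : IntermediateField ℚ_[p] ℂ_[p] :=
  (algebraicClosure (K p) ℂ_[p]).restrictScalars ℚ_[p]

/-- The valuation ring of a field between `ℚ_p` and `ℂ_[p]`. -/
def intRing (F : IntermediateField ℚ_[p] ℂ_[p]) : Subring ℂ_[p] where
  carrier := {x | x ∈ F ∧ ‖x‖ ≤ 1}
  mul_mem' {a b} ha hb := ⟨F.mul_mem ha.1 hb.1, by
    rw [norm_mul]; exact mul_le_one₀ ha.2 (norm_nonneg b) hb.2⟩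
  one_mem' := ⟨F.one_mem, by simp⟩
  add_mem' {a b} ha hb := ⟨F.add_mem ha.1 hb.1,
    (PadicComplex.isNonarchimedean p a b).trans (max_le ha.2 hb.2)⟩
  zero_mem' := ⟨F.zero_mem, by simp⟩
  neg_mem' {a} ha := ⟨F.neg_mem ha.1, by rw [norm_neg]; exact ha.2⟩

/-- `Π`: the elements of the algebraic closure of `ℚ_p` that are prime elements (generators of
the maximal ideal of the valuation ring) of some finite Galois extension `E` of `ℚ_p`. -/
def PiSet : Set (PadicAlgCl p) :=
  {π | ∃ E : IntermediateField ℚ_[p] (PadicAlgCl p),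
    FiniteDimensional ℚ_[p] E ∧ IsGalois ℚ_[p] E ∧
      π ∈ E ∧ ‖π‖ < 1 ∧ ∀ x ∈ E, ‖x‖ < 1 → ‖x‖ ≤ ‖π‖}

/-- `R`: the valuation ring of `K`. -/
abbrev R : Subring ℂ_[p] := intRing p (K p)

variable {p}

/-- `K_π = K(π)`. -/
def Kpi (π : PiSet p) : IntermediateField ℚ_[p] ℂ_[p] :=
  IntermediateField.adjoin ℚ_[p] ((K p : Set ℂ_[p]) ∪ {((π : PadicAlgCl p) : ℂ_[p])})

/-- `R_π`: the valuation ring of `K_π`. -/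
abbrev Rpi (π : PiSet p) : Subring ℂ_[p] := intRing p (Kpi π)

theorem K_le_Kpi (π : PiSet p) : K p ≤ Kpi π := fun _ hx =>
  IntermediateField.subset_adjoin _ _ (Or.inl hx)

theorem pi_mem_Kpi (π : PiSet p) : ((π : PadicAlgCl p) : ℂ_[p]) ∈ Kpi π :=
  IntermediateField.subset_adjoin _ _ (Or.inr rfl)

theorem Kpi_le_Kalg (π : PiSet p) : Kpi π ≤ Kalg p := by
  refine IntermediateField.adjoin_le_iff.2 (Set.union_subset ?_ ?_)
  · intro x hx
    exact (algebraicClosure (K p) ℂ_[p]).algebraMap_mem ⟨x, hx⟩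
  · rintro _ rfl
    have h : IsAlgebraic ℚ_[p] ((π : PadicAlgCl p) : ℂ_[p]) :=
      (Algebra.IsAlgebraic.isAlgebraic (R := ℚ_[p]) (π : PadicAlgCl p)).algebraMap
    exact (mem_algebraicClosure_iff (F := K p) (E := ℂ_[p])).2 (h.tower_top (K p))

theorem R_le_Rpi (π : PiSet p) : R p ≤ Rpi π := fun _ hx => ⟨K_le_Kpi π hx.1, hx.2⟩

instance algebraRpi (π : PiSet p) : Algebra (R p) (Rpi π) :=
  (Subring.inclusion (R_le_Rpi π)).toAlgebra

/-- `π` as an element of `R_π`. -/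
def piElt (π : PiSet p) : Rpi π := ⟨((π : PadicAlgCl p) : ℂ_[p]), pi_mem_Kpi π, by
  obtain ⟨E, -, -, -, h, -⟩ := π.2
  rw [PadicComplex.norm_extends]; exact h.le⟩

theorem norm_p_le (π : PiSet p) : ‖(p : ℂ_[p])‖ ≤ ‖((π : PadicAlgCl p) : ℂ_[p])‖ := by
  obtain ⟨E, -, -, -, -, h⟩ := π.2
  have hp : ‖(p : PadicAlgCl p)‖ < 1 := by
    have := PadicAlgCl.norm_extends p (p : ℚ_[p])
    rw [map_natCast] at this
    rw [this]; exact Padic.norm_p_lt_one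
  rw [← PadicComplex.coe_natCast, PadicComplex.norm_extends, PadicComplex.norm_extends]
  exact h _ (natCast_mem E p) hp

/-- `p / π` as an element of `R_π`. -/
def pOverPi (π : PiSet p) : Rpi π := ⟨(p : ℂ_[p]) / ((π : PadicAlgCl p) : ℂ_[p]),
  (Kpi π).div_mem (natCast_mem _ p) (pi_mem_Kpi π), by
    rw [norm_div]; exact div_le_one_of_le₀ (norm_p_le π) (norm_nonneg _)⟩

/-- `φ` is a higher Frobenius automorphism of degree `s` of `K^alg`: a continuous automorphism
inducing the `p ^ s`-power map on the residue field of the valuation ring of `K^alg`. -/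
structure IsHigherFrobenius (s : ℕ) (φ : Kalg p ≃ₐ[ℚ_[p]] Kalg p) : Prop where
  continuous : Continuous φ
  residue : ∀ a : Kalg p, ‖(a : ℂ_[p])‖ ≤ 1 → ‖((φ a - a ^ p ^ s : Kalg p) : ℂ_[p])‖ < 1

/-- The element `(φ a - a ^ (p ^ s)) / π` of `ℂ_[p]`, for `a ∈ R_π`. -/
def frobQuot (s : ℕ) (φ : Kalg p ≃ₐ[ℚ_[p]] Kalg p) (π : PiSet p) (a : Rpi π) : ℂ_[p] :=
  ((φ ⟨a, Kpi_le_Kalg π a.2.1⟩ : ℂ_[p]) - (a : ℂ_[p]) ^ p ^ s) / ((π : PadicAlgCl p) : ℂ_[p])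

open Classical in
/-- The higher `π`-derivation `δ_π` of degree `s` on `R_π` attached to a higher Frobenius
automorphism `φ` of `K^alg`, `δ_π a = (φ a - a ^ (p ^ s)) / π`. (For a higher Frobenius
automorphism `φ` of degree `s` the quotient always lies in `R_π`.) -/
def deltaPi (s : ℕ) (φ : Kalg p ≃ₐ[ℚ_[p]] Kalg p) (π : PiSet p) (a : Rpi π) : Rpi π :=
  if h : frobQuot s φ π a ∈ Rpi π then ⟨_, h⟩ else 0

end Fields

/-! ## `p`-adic completions -/

section Completion

/-- The `p`-adic completion of a ring. -/
abbrev PCompl (p : ℕ) (A : Type) [CommRing A] : Type :=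
  AdicCompletion (Ideal.span {(p : A)}) A

variable {p : ℕ} {A D : Type} [CommRing A] [CommRing D]

/-- The canonical homomorphism to the `p`-adic completion. -/
abbrev PCompl.of (p : ℕ) (A : Type) [CommRing A] : A →+* PCompl p A :=
  algebraMap A (PCompl p A)

/-- The homomorphism `A / p ^ m → D / p ^ m` induced by a homomorphism from `A` to the `p`-adic
completion of `D`. -/
def PCompl.level (f : A →+* PCompl p D) (m : ℕ) :
    A ⧸ Ideal.span {(p : A)} ^ m →+* D ⧸ Ideal.span {(p : D)} ^ m :=
  Ideal.Quotient.lift (Ideal.span {(p : A)} ^ m)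
    ((AdicCompletion.evalₐ (Ideal.span {(p : D)}) m).toRingHom.comp f) (by
      intro a ha
      rw [Ideal.span_singleton_pow, Ideal.mem_span_singleton] at ha
      obtain ⟨b, rfl⟩ := ha
      have h : (p : D ⧸ Ideal.span {(p : D)} ^ m) ^ m = 0 := by
        have h2 : (Ideal.Quotient.mk (Ideal.span {(p : D)} ^ m)) ((p : D) ^ m) = 0 :=
          Ideal.Quotient.eq_zero_iff_mem.2
            (Ideal.pow_mem_pow (Ideal.mem_span_singleton_self (p : D)) m)
        simpa using h2
      rw [map_mul, map_pow, map_natCast, h, zero_mul])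

theorem PCompl.level_compat (f : A →+* PCompl p D) {m n : ℕ} (hle : m ≤ n) :
    (Ideal.Quotient.factorPow (Ideal.span {(p : D)}) hle).comp ((PCompl.level f n).comp
      (AdicCompletion.evalₐ (Ideal.span {(p : A)}) n).toRingHom) =
    (PCompl.level f m).comp (AdicCompletion.evalₐ (Ideal.span {(p : A)}) m).toRingHom := by
  ext x
  induction x using AdicCompletion.induction_on with
  | _ x =>
    simp only [RingHom.comp_apply, AlgHom.toRingHom_eq_coe, RingHom.coe_coe,
      AdicCompletion.evalₐ_mk]
    rw [← AdicCompletion.Ideal.mk_eq_mk _ hle]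
    simp only [PCompl.level, Ideal.Quotient.lift_mk, RingHom.comp_apply,
      AlgHom.toRingHom_eq_coe, RingHom.coe_coe]
    generalize f (x.val n) = y
    induction y using AdicCompletion.induction_on with
    | _ y =>
      rw [AdicCompletion.evalₐ_mk, AdicCompletion.evalₐ_mk,
        ← AdicCompletion.Ideal.mk_eq_mk _ hle]
      rfl

/-- The unique extension to the `p`-adic completion of `A` of a homomorphism from `A` to a
`p`-adic completion. -/
def PCompl.lift (f : A →+* PCompl p D) : PCompl p A →+* PCompl p D :=
  AdicCompletion.liftRingHom (Ideal.span {(p : D)})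
    (fun m => (PCompl.level f m).comp (AdicCompletion.evalₐ (Ideal.span {(p : A)}) m).toRingHom)
    (PCompl.level_compat f)

theorem PCompl.lift_of (f : A →+* PCompl p D) (a : A) :
    PCompl.lift f (PCompl.of p A a) = f a := by
  refine AdicCompletion.ext_evalₐ fun m => ?_
  rw [PCompl.lift, AdicCompletion.evalₐ_liftRingHom _ _ (PCompl.level_compat f)]
  rfl

end Completion

/-! ## Coordinate rings of `GL_n` and jet algebras -/

section Rings

variable (p n : ℕ) (B : Type) [CommRing B] {D : Type} [CommRing D]

/-- `B[x, det(x)⁻¹]^`, with `x` an `n × n` matrix of indeterminates and `^` the `p`-adic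
completion. -/
abbrev GLRing : Type :=
  PCompl p (Localization.Away (Matrix.mvPolynomialX (Fin n) (Fin n) B).det)

/-- The canonical homomorphism `MvPolynomial _ B → B[x, det(x)⁻¹]^`. -/
abbrev GLRing.ofPoly : MvPolynomial (Fin n × Fin n) B →+* GLRing p n B :=
  (PCompl.of p _).comp
    (algebraMap _ (Localization.Away (Matrix.mvPolynomialX (Fin n) (Fin n) B).det))

/-- The structure homomorphism `B → B[x, det(x)⁻¹]^`. -/
abbrev GLRing.C : B →+* GLRing p n B := (GLRing.ofPoly p n B).comp MvPolynomial.C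

/-- The matrix `x` over `B[x, det(x)⁻¹]^`. -/
def GLRing.x : Matrix (Fin n) (Fin n) (GLRing p n B) :=
  (Matrix.mvPolynomialX (Fin n) (Fin n) B).map (GLRing.ofPoly p n B)

theorem GLRing.isUnit_det_x : IsUnit (GLRing.x p n B).det := by
  have h := (IsLocalization.Away.algebraMap_isUnit
    (S := Localization.Away (Matrix.mvPolynomialX (Fin n) (Fin n) B).det)
    (Matrix.mvPolynomialX (Fin n) (Fin n) B).det).map (PCompl.of p _)
  have e : (GLRing.x p n B).det =
      GLRing.ofPoly p n B (Matrix.mvPolynomialX (Fin n) (Fin n) B).det :=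
    (RingHom.map_det (GLRing.ofPoly p n B) _).symm
  rw [e]; exact h

/-- The `n × n` symmetric matrix `Q` of indeterminates (its entries `Q_ij = Q_ji` are indexed by
unordered pairs). -/
def symX : Matrix (Fin n) (Fin n) (MvPolynomial (Sym2 (Fin n)) B) :=
  Matrix.of fun i j => MvPolynomial.X s(i, j)

/-- `B[Q, det(Q)⁻¹]`, with `Q` the symmetric matrix of indeterminates. For `B = R` this is `S`,
for `B = R_π` it is the base change of `S` to `R_π`. -/
abbrev SRing : Type := Localization.Away (symX n B).det

/-- The jet algebra `B[Q, δ_1 Q, …, δ_n Q, det(Q)⁻¹]^` of order `1` of `B[Q, det(Q)⁻¹]`. For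
`B = R_π` this is `J^1_π(S)`, and for `B = R` this is `J^1_p(S)`. The indeterminate
`(k, s(i, j))` is `δ_k Q_ij`. -/
def Jet : Type := PCompl p (MvPolynomial (Fin n × Sym2 (Fin n)) (SRing n B))

instance : CommRing (Jet p n B) :=
  inferInstanceAs (CommRing (PCompl p (MvPolynomial (Fin n × Sym2 (Fin n)) (SRing n B))))

/-- The canonical homomorphism from the polynomial ring in the `δ_k Q` to the jet algebra. -/
def Jet.of : MvPolynomial (Fin n × Sym2 (Fin n)) (SRing n B) →+* Jet p n B := PCompl.of p _

/-- The canonical homomorphism `B[Q] → B[Q, δ_1 Q, …, δ_n Q, det(Q)⁻¹]^`. -/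
abbrev Jet.ofPoly : MvPolynomial (Sym2 (Fin n)) B →+* Jet p n B :=
  (Jet.of p n B).comp (MvPolynomial.C.comp (algebraMap _ (SRing n B)))

/-- The structure homomorphism `B → B[Q, δ_1 Q, …, δ_n Q, det(Q)⁻¹]^`. -/
abbrev Jet.C : B →+* Jet p n B := (Jet.ofPoly p n B).comp MvPolynomial.C

instance : Algebra B (Jet p n B) := (Jet.C p n B).toAlgebra

/-- The matrix `Q` over the jet algebra. -/
def Jet.Q : Matrix (Fin n) (Fin n) (Jet p n B) := (symX n B).map (Jet.ofPoly p n B)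

/-- The matrix `δ_k Q` over the jet algebra. -/
def Jet.dQ (k : Fin n) : Matrix (Fin n) (Fin n) (Jet p n B) :=
  Matrix.of fun i j => Jet.of p n B (MvPolynomial.X (k, s(i, j)))

theorem Jet.isSymm_Q : (Jet.Q p n B).IsSymm := by
  ext i j
  simp [Jet.Q, symX, Sym2.eq_swap]

theorem Jet.isSymm_dQ (k : Fin n) : (Jet.dQ p n B k).IsSymm := by
  ext i j
  simp [Jet.dQ, Sym2.eq_swap]

theorem Jet.isUnit_det_Q : IsUnit (Jet.Q p n B).det := by
  have h := (IsLocalization.Away.algebraMap_isUnit (S := SRing n B) (symX n B).det).map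
    ((Jet.of p n B).comp MvPolynomial.C)
  have e : (Jet.Q p n B).det = Jet.ofPoly p n B (symX n B).det :=
    (RingHom.map_det (Jet.ofPoly p n B) _).symm
  rw [e]; exact h

variable {p n B}

theorem isUnit_det_map {A A' : Type} [CommRing A] [CommRing A'] (f : A →+* A')
    {M : Matrix (Fin n) (Fin n) A} (h : IsUnit M.det) : IsUnit (M.map f).det := by
  have h2 := h.map f
  rwa [RingHom.map_det] at h2

/-- The entries of a symmetric matrix as a function on unordered pairs of indices. -/
def symEntry {A : Type} (M : Matrix (Fin n) (Fin n) A) (h : M.IsSymm) : Sym2 (Fin n) → A :=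
  Sym2.lift ⟨fun i j => M i j, fun i j => h.apply j i⟩

/-- The homomorphism from `B[x, det(x)⁻¹]^` to a `p`-adic completion given by `f` on `B` and by
the substitution `x ↦ M`. -/
def GLRing.lift (f : B →+* PCompl p D) (M : Matrix (Fin n) (Fin n) (PCompl p D))
    (hM : IsUnit M.det) : GLRing p n B →+* PCompl p D :=
  PCompl.lift (IsLocalization.Away.lift (Matrix.mvPolynomialX (Fin n) (Fin n) B).det
    (g := MvPolynomial.eval₂Hom f fun ij => M ij.1 ij.2) (by
      rw [RingHom.map_det]
      have e : (MvPolynomial.eval₂Hom f fun ij => M ij.1 ij.2).mapMatrix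
          (Matrix.mvPolynomialX (Fin n) (Fin n) B) = M := by
        ext i j
        simp
      rwa [e]))

/-- The homomorphism from the jet algebra to a `p`-adic completion given by `f` on `B` and by the
substitutions `Q ↦ M`, `δ_k Q ↦ N k`. -/
def Jet.lift (f : B →+* PCompl p D) (M : Matrix (Fin n) (Fin n) (PCompl p D))
    (hs : M.IsSymm) (hM : IsUnit M.det) (N : Fin n → Matrix (Fin n) (Fin n) (PCompl p D))
    (hN : ∀ k, (N k).IsSymm) : Jet p n B →+* PCompl p D :=
  PCompl.lift (MvPolynomial.eval₂Hom
    (IsLocalization.Away.lift (S := SRing n B) (symX n B).det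
      (g := MvPolynomial.eval₂Hom f (symEntry M hs)) (by
        rw [RingHom.map_det]
        have e : (MvPolynomial.eval₂Hom f (symEntry M hs)).mapMatrix (symX n B) = M := by
          ext i j
          simp [symX, symEntry]
        rwa [e]))
    (fun ks => symEntry (N ks.1) (hN ks.1) ks.2))

end Rings

/-! ## Torsion symbols, connections, the Levi-Civita condition -/

section Connections

/-- The matrix with entries the `q`-th powers of the entries of `M`. -/
def entryPow {n : ℕ} {A : Type} [Monoid A] (M : Matrix (Fin n) (Fin n) A) (q : ℕ) :
    Matrix (Fin n) (Fin n) A := M.map (· ^ q)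

/-- Tuples `(L^1, …, L^n)` of `n × n` matrices over the `p`-adic completion of `B[y]`, with
`y = (y_1, …, y_n)` an `n`-tuple of `n × n` matrices of indeterminates; the indeterminate
`(i, j, k)` is the `jk` entry of `y_i`, and `L k i j` is `L^k_{ij}`. -/
abbrev SymbolTuple (p n : ℕ) (B : Type) [CommRing B] : Type :=
  Fin n → Matrix (Fin n) (Fin n) (PCompl p (MvPolynomial (Fin n × Fin n × Fin n) B))

variable {p n : ℕ}

/-- A torsion symbol of the second kind with coefficients in `B`: a tuple of antisymmetric
matrices. -/
def IsTorsionSymbol {B : Type} [CommRing B] (L : SymbolTuple p n B) : Prop :=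
  ∀ i j k, L k i j + L k j i = 0

/-- The substitution `y_i ↦ Ξ_i`, with `f` on the coefficients. -/
def substY {B D : Type} [CommRing B] [CommRing D] (f : B →+* PCompl p D)
    (Ξ : Fin n → Matrix (Fin n) (Fin n) (PCompl p D)) :
    PCompl p (MvPolynomial (Fin n × Fin n × Fin n) B) →+* PCompl p D :=
  PCompl.lift (MvPolynomial.eval₂Hom f fun ijk => Ξ ijk.1 ijk.2.1 ijk.2.2)

/-- The polynomial `C_p^{(s)}(X, Y) = (X ^ (p ^ s) + Y ^ (p ^ s) - (X + Y) ^ (p ^ s)) / p`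
evaluated at `(a, b)`. -/
def cPoly {A : Type} [CommRing A] (p s : ℕ) (a b : A) : A :=
  -∑ m ∈ Finset.Ioo 0 (p ^ s), (((p ^ s).choose m / p : ℕ) : A) * a ^ m * b ^ (p ^ s - m)

/-- `δ` is a higher `π`-derivation of degree `s` on the ring `A`, where `ϖ` and `ϖ'` are the
images of `π` and `p / π` in `A`. -/
structure IsHigherDerivation {A : Type} [CommRing A] (p s : ℕ) (ϖ ϖ' : A) (δ : A → A) :
    Prop where
  map_one : δ 1 = 0
  map_add : ∀ a b, δ (a + b) = δ a + δ b + ϖ' * cPoly p s a b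
  map_mul : ∀ a b, δ (a * b) = a ^ p ^ s * δ b + b ^ p ^ s * δ a + ϖ * δ a * δ b

variable [Fact p.Prime]

/-- The ring `𝒜 = R_π[x, det(x)⁻¹]^`. -/
abbrev ARing (n : ℕ) (π : PiSet p) : Type := GLRing p n (Rpi π)

/-- The image of `π` in `𝒜`. -/
abbrev piA (n : ℕ) (π : PiSet p) : ARing n π := GLRing.C p n (Rpi π) (piElt π)

/-- A `π`-connection of degree `s` on `GL_n`: an `n`-tuple of higher `π`-derivations of degree
`s` on `𝒜` extending the higher `π`-derivations `δ_{π,i}` of degree `s` on `R_π` attached to the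
higher Frobenius automorphisms `φ_i`. -/
structure IsPiConnection (s : ℕ) (φ : Fin n → (Kalg p ≃ₐ[ℚ_[p]] Kalg p)) (π : PiSet p)
    (Δ : Fin n → ARing n π → ARing n π) : Prop where
  derivation : ∀ i, IsHigherDerivation p s (piA n π)
    (GLRing.C p n (Rpi π) (pOverPi π)) (Δ i)
  extends_base : ∀ i (a : Rpi π), ∃ d : Rpi π, (d : ℂ_[p]) = frobQuot s (φ i) π a ∧
    Δ i (GLRing.C p n (Rpi π) a) = GLRing.C p n (Rpi π) d

/-- The higher `π`-Frobenius lift `a ↦ a ^ (p ^ s) + π δ a` attached to a higher `π`-derivation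
`δ` on `𝒜`. -/
def frobLift (s : ℕ) (π : PiSet p) (δ : ARing n π → ARing n π) (a : ARing n π) : ARing n π :=
  a ^ p ^ s + piA n π * δ a

/-- The matrices `Γ_i = ((x^{(p^s)})⁻¹ · δ_i x)ᵗ` of Christoffel symbols of the second kind, with
`Γ_{ij}^k = (Γ_i)_{jk}`. -/
def christoffel (s : ℕ) (π : PiSet p) (Δ : Fin n → ARing n π → ARing n π) (i : Fin n) :
    Matrix (Fin n) (Fin n) (ARing n π) :=
  ((entryPow (GLRing.x p n (Rpi π)) (p ^ s))⁻¹ * (GLRing.x p n (Rpi π)).map (Δ i)).transpose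

/-- The matrices `Λ_i = (x^{(p^s)})⁻¹ · φ_i(x)`. -/
def lambda (s : ℕ) (π : PiSet p) (Δ : Fin n → ARing n π → ARing n π) (i : Fin n) :
    Matrix (Fin n) (Fin n) (ARing n π) :=
  (entryPow (GLRing.x p n (Rpi π)) (p ^ s))⁻¹ *
    (GLRing.x p n (Rpi π)).map (frobLift s π (Δ i))

/-- The connection is symmetric with respect to `L`:
`Γ_{ij}^k - Γ_{ji}^k = L_{ij}^k(Λ)`. -/
def IsSymmetricConnection (s : ℕ) (π : PiSet p) (L : SymbolTuple p n (Rpi π))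
    (Δ : Fin n → ARing n π → ARing n π) : Prop :=
  ∀ i j k, christoffel s π Δ i j k - christoffel s π Δ j i k =
    substY (GLRing.C p n (Rpi π)) (lambda s π Δ) (L k i j)

/-- A metric over `R_π`: a symmetric invertible matrix. -/
structure IsMetric (π : PiSet p) (q : Matrix (Fin n) (Fin n) (Rpi π)) : Prop where
  symm : q.IsSymm
  isUnit : IsUnit q.det

/-- The `R_π`-algebra endomorphism `ℋ_q` of `𝒜` with `ℋ_q(x) = xᵗ q x`. -/
def hMap (π : PiSet p) (q : Matrix (Fin n) (Fin n) (Rpi π)) (hq : IsMetric π q) :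
    ARing n π →+* ARing n π :=
  GLRing.lift (GLRing.C p n (Rpi π))
    ((GLRing.x p n (Rpi π)).transpose * q.map (GLRing.C p n (Rpi π)) * GLRing.x p n (Rpi π)) (by
      have hu : IsUnit (q.map (GLRing.C p n (Rpi π))).det := isUnit_det_map _ hq.isUnit
      rw [Matrix.det_mul, Matrix.det_mul, Matrix.det_transpose]
      exact ((GLRing.isUnit_det_x p n (Rpi π)).mul hu).mul (GLRing.isUnit_det_x p n (Rpi π)))

/-- The connection `Δ` is metric with respect to `q`: for every `i`, `φ_i ∘ ℋ_q = ℋ_q ∘ φ_{i,0}`,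
where the `φ_{i,0}` are the Frobenius lifts of the trivial connection `Δ₀`, `δ_{i,0} x = 0`. -/
def IsMetricConnection (s : ℕ) (φ : Fin n → (Kalg p ≃ₐ[ℚ_[p]] Kalg p)) (π : PiSet p)
    (q : Matrix (Fin n) (Fin n) (Rpi π)) (hq : IsMetric π q)
    (Δ : Fin n → ARing n π → ARing n π) : Prop :=
  ∃ Δ₀ : Fin n → ARing n π → ARing n π, IsPiConnection s φ π Δ₀ ∧
    (∀ i j k, Δ₀ i (GLRing.x p n (Rpi π) j k) = 0) ∧
    ∀ i a, frobLift s π (Δ i) (hMap π q hq a) = hMap π q hq (frobLift s π (Δ₀ i) a)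

/-- `Δ` is the arithmetic Levi-Civita connection of degree `s` attached to the metric `q` and to
the torsion symbol `L`: the `π`-connection that is metric with respect to `q` and symmetric with
respect to `L`. -/
structure IsLeviCivita (s : ℕ) (φ : Fin n → (Kalg p ≃ₐ[ℚ_[p]] Kalg p)) (π : PiSet p)
    (q : Matrix (Fin n) (Fin n) (Rpi π)) (hq : IsMetric π q) (L : SymbolTuple p n (Rpi π))
    (Δ : Fin n → ARing n π → ARing n π) : Prop where
  connection : IsPiConnection s φ π Δ
  metric : IsMetricConnection s φ π q hq Δ
  symmetric : IsSymmetricConnection s π L Δ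

/-- The torsion symbol `L_π = (p / π) L_p` over `R_π` attached to a torsion symbol `L_p` over
`R`. -/
def scaleSymbol (π : PiSet p) (L : SymbolTuple p n (R p)) : SymbolTuple p n (Rpi π) :=
  fun k => (L k).map fun f =>
    PCompl.of p _ (MvPolynomial.C (pOverPi π)) *
      PCompl.lift ((PCompl.of p (MvPolynomial (Fin n × Fin n × Fin n) (Rpi π))).comp
        (MvPolynomial.map (algebraMap (R p) (Rpi π)))) f

end Connections

/-! ## Strict `δ`-overconvergence -/

section Overconvergence

variable {p : ℕ} [Fact p.Prime]

/-- `J^1_p(S) ⊗_R R_π`. -/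
def JetTensor (n : ℕ) (π : PiSet p) : Type := Jet p n (R p) ⊗[R p] Rpi π

instance (n : ℕ) (π : PiSet p) : CommRing (JetTensor n π) :=
  inferInstanceAs (CommRing (Jet p n (R p) ⊗[R p] Rpi π))

/-- The homomorphism `J^1_p(S) → J^1_p(S) ⊗_R R_π`, `a ↦ a ⊗ 1`. -/
def JetTensor.inl (n : ℕ) (π : PiSet p) : Jet p n (R p) →+* JetTensor n π :=
  (Algebra.TensorProduct.includeLeftRingHom : Jet p n (R p) →+* Jet p n (R p) ⊗[R p] Rpi π)

/-- The homomorphism `R_π → J^1_p(S) ⊗_R R_π`, `b ↦ 1 ⊗ b`. -/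
def JetTensor.inr (n : ℕ) (π : PiSet p) : Rpi π →+* JetTensor n π :=
  (Algebra.TensorProduct.includeRight : Rpi π →ₐ[R p] Jet p n (R p) ⊗[R p] Rpi π).toRingHom

/-- The homomorphism `J^1_p(S)[x, det(x)⁻¹]^ → (J^1_p(S) ⊗_R R_π)[x, det(x)⁻¹]^`. -/
def baseChange (n : ℕ) (π : PiSet p) :
    GLRing p n (Jet p n (R p)) →+* GLRing p n (JetTensor n π) :=
  GLRing.lift ((GLRing.C p n (JetTensor n π)).comp (JetTensor.inl n π))
    (GLRing.x p n (JetTensor n π)) (GLRing.isUnit_det_x p n _)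

/-- The homomorphism from `J^1_π(S)` to `(J^1_p(S) ⊗_R R_π)[x, det(x)⁻¹]^` obtained from the
natural homomorphism `ι : J^1_π(S) → J^1_p(S) ⊗_R R_π`. The latter is the `R_π`-algebra
homomorphism which is the identity on `S` and is compatible with the Frobenius lifts,
`φ_k Q = Q^{(p^s)} + π δ_{π,k} Q = Q^{(p^s)} + p δ_{p,k} Q`; that is,
`Q ↦ Q` and `δ_{π,k} Q ↦ (p / π) δ_{p,k} Q`. -/
def iotaJet (n : ℕ) (π : PiSet p) : Jet p n (Rpi π) →+* GLRing p n (JetTensor n π) :=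
  Jet.lift
    ((GLRing.C p n (JetTensor n π)).comp (JetTensor.inr n π))
    ((Jet.Q p n (R p)).map ((GLRing.C p n (JetTensor n π)).comp (JetTensor.inl n π)))
    ((Jet.isSymm_Q p n (R p)).map _)
    (isUnit_det_map _ (Jet.isUnit_det_Q p n (R p)))
    (fun k => (Jet.dQ p n (R p) k).map fun a =>
      GLRing.C p n (JetTensor n π) (JetTensor.inr n π (pOverPi π) * JetTensor.inl n π a))
    (fun k => (Jet.isSymm_dQ p n (R p) k).map _)

/-- The homomorphism `J^1_π(S)[x, det(x)⁻¹]^ → (J^1_p(S) ⊗_R R_π)[x, det(x)⁻¹]^`. -/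
def iota (n : ℕ) (π : PiSet p) :
    GLRing p n (Jet p n (Rpi π)) →+* GLRing p n (JetTensor n π) :=
  GLRing.lift (iotaJet n π) (GLRing.x p n (JetTensor n π)) (GLRing.isUnit_det_x p n _)

/-- `Θ_π`, a matrix over `J^1_π(S)[x, det(x)⁻¹]^`, represents `Θ_p`, a matrix over
`J^1_p(S)[x, det(x)⁻¹]^`: both have the same image over `(J^1_p(S) ⊗_R R_π)[x, det(x)⁻¹]^`. -/
def Represents {n : ℕ} (π : PiSet p) (Θπ : Matrix (Fin n) (Fin n) (GLRing p n (Jet p n (Rpi π))))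
    (Θ : Matrix (Fin n) (Fin n) (GLRing p n (Jet p n (R p)))) : Prop :=
  ∀ i j, iota n π (Θπ i j) = baseChange n π (Θ i j)

/-- A matrix over `J^1_p(S)[x, det(x)⁻¹]^` is strictly `δ`-overconvergent if for all `π ∈ Π` the
images of its entries in `(J^1_p(S) ⊗_R R_π)[x, det(x)⁻¹]^` belong to the image of
`J^1_π(S)[x, det(x)⁻¹]^`. -/
def StrictlyOverconvergent {n : ℕ}
    (Θ : Matrix (Fin n) (Fin n) (GLRing p n (Jet p n (R p)))) : Prop :=
  ∀ (π : PiSet p) (i j : Fin n), baseChange n π (Θ i j) ∈ (iota n π).range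

/-- The specialization `J^1_π(S)[x, det(x)⁻¹]^ → R_π[x, det(x)⁻¹]^` at a metric `q` over `R_π`:
`Q ↦ q`, `δ_{π,k} Q ↦ δ_{π,k} q`, `x ↦ x`. -/
def evalMetric {n : ℕ} (s : ℕ) (φ : Fin n → (Kalg p ≃ₐ[ℚ_[p]] Kalg p)) (π : PiSet p)
    (q : Matrix (Fin n) (Fin n) (Rpi π)) (hq : IsMetric π q) :
    GLRing p n (Jet p n (Rpi π)) →+* ARing n π :=
  GLRing.lift
    (Jet.lift (GLRing.C p n (Rpi π)) (q.map (GLRing.C p n (Rpi π))) (hq.symm.map _)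
      (isUnit_det_map _ hq.isUnit)
      (fun k => (q.map (deltaPi s (φ k) π)).map (GLRing.C p n (Rpi π)))
      (fun k => (hq.symm.map _).map _))
    (GLRing.x p n (Rpi π)) (GLRing.isUnit_det_x p n _)

end Overconvergence

end ArithLC

end

/-!
The matrices `Λ_i = (x^(p^s))⁻¹ φ_i(x)` of the Frobenius lifts of a Levi-Civita connection
satisfy a system of equations (`IsLCSolution`): the metric condition reads `Λ_iᵗ A_i Λ_i = G` with
`A_i = (x^(p^s))ᵗ φ_i(q) x^(p^s)` and `G = (xᵗ q x)^(p^s)`, where powers of matrices are taken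
entrywise; the symmetry condition reads `(Λ_i - 1)_kj - (Λ_j - 1)_ki = p L^k_ij(Λ)`, since
`π · (p / π) = p`; and `Λ_i ≡ 1` modulo `π`. As `A_i ≡ G`, linearizing at `Λ_i = 1` gives
the linear problem which the Koszul formula of Riemannian geometry solves (`2` is a unit), and the
remaining terms are contracting. So over any ring complete with respect to a divisor `ϖ` of `p` the
system has exactly one solution (`exists_isLCSolution`, `IsLCSolution.unique`). Conversely a
solution defines Frobenius lifts, hence a connection, because the ring `𝒜` has no `π`-torsion
(`exists_isLeviCivita`).

In the system, `φ_i(q) = q^(p^s) + π δ_{π,i} q`, so it makes sense universally, over the jet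
algebras, with `π δ_{π,i} Q` in place of `π δ_{π,i} q` (`UniversalLC`). The solution over `J^1_p(S)`
is the required `Λ^LC_p`. Under `ι_π` one has `π δ_{π,i} Q ↦ p δ_{p,i} Q`, so the images of
the universal solutions over `J^1_p(S)` and over `J^1_π(S)` solve the same system over
`J^1_p(S) ⊗ R_π`; by uniqueness they agree, which is strict overconvergence
(`UniversalLC.represents`). Specializing the solution over `J^1_π(S)` at a metric `q` gives
the solution for `q`, again by uniqueness. The result does not depend on the representative over
`J^1_π(S)`: after the partial specialization `Q ↦ q`, `ι_π` becomes the substitution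
`z ↦ (p / π) z` in a completed polynomial ring, which is injective because it multiplies
coefficients by powers of `p / π` (`rescale_injective`, `evalMetric_eq_of_iota_eq`).

All of this needs that `δ_{π,i} a = (φ_i(a) - a^(p^s)) / π` is really defined on `R_π`
(`frobQuot_mem`). Let `E` be the finite Galois extension of which `π` is a prime element. The
maximal unramified extension of `ℚ_p` is generated by the Teichmüller elements, the solutions of
`ζ^(p^k) = ζ` with `k ≥ 1`. Any integral `x ∈ E` is a limit of polynomials in `π` whose
coefficients are Teichmüller elements of `E`, by a case of Krasner's lemma (`IsTeich.mem_of_near`);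
hence `E ⊆ K_π`. Adjoining Teichmüller elements does not enlarge value groups
(`exists_norm_eq_of_mem_adjoin_isTeich`), so the norms of elements of `K_π` are norms of elements
of `E`. Finally `φ_i` permutes the Teichmüller elements, so it preserves `K` by continuity, and it
maps `π` into `E`; hence it preserves `K_π`. The numerator of `δ_{π,i} a` is therefore an element of
`K_π` of norm less than one, that is, of norm at most that of `π`.
-/

noncomputable section

open scoped TensorProduct

namespace ArithLC

/-! ### Rings complete with respect to a principal ideal -/

section Complete

variable {B : Type} [CommRing B] {ϖ : B}

theorem eq_zero_of_forall_pow_dvd [IsAdicComplete (Ideal.span {ϖ}) B] {x : B}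
    (h : ∀ m : ℕ, ϖ ^ m ∣ x) : x = 0 := by
  refine IsHausdorff.haus (I := Ideal.span {ϖ}) inferInstance x fun m => ?_
  rw [SModEq.zero, smul_eq_mul, Ideal.mul_top, Ideal.span_singleton_pow,
    Ideal.mem_span_singleton]
  exact h m

theorem exists_limit [IsAdicComplete (Ideal.span {ϖ}) B] {f : ℕ → B}
    (h : ∀ m, ϖ ^ m ∣ f (m + 1) - f m) : ∃ x, ∀ m, ϖ ^ m ∣ f m - x := by
  have key : ∀ m d, ϖ ^ m ∣ f (m + d) - f m := by
    intro m d
    induction d with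
    | zero => simp
    | succ d ih =>
      have := dvd_add ((pow_dvd_pow ϖ (Nat.le_add_right m d)).trans (h (m + d))) ih
      simpa [add_assoc] using this
  obtain ⟨x, hx⟩ := IsPrecomplete.prec (I := Ideal.span {ϖ}) (M := B) inferInstance (f := f) (by
    intro m k hmk
    obtain ⟨d, rfl⟩ := Nat.exists_eq_add_of_le hmk
    rw [SModEq.sub_mem, smul_eq_mul, Ideal.mul_top, Ideal.span_singleton_pow,
      Ideal.mem_span_singleton, ← neg_sub, dvd_neg]
    exact key m d)
  refine ⟨x, fun m => ?_⟩
  have := hx m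
  rwa [SModEq.sub_mem, smul_eq_mul, Ideal.mul_top, Ideal.span_singleton_pow,
      Ideal.mem_span_singleton] at this

theorem isAdicComplete_span_singleton
    (hsep : ∀ x : B, (∀ m : ℕ, ϖ ^ m ∣ x) → x = 0)
    (hlim : ∀ f : ℕ → B, (∀ m, ϖ ^ m ∣ f (m + 1) - f m) → ∃ x, ∀ m, ϖ ^ m ∣ f m - x) :
    IsAdicComplete (Ideal.span {ϖ}) B where
  haus' x hx := hsep x fun m => by
    have := hx m
    rwa [SModEq.zero, smul_eq_mul, Ideal.mul_top, Ideal.span_singleton_pow,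
      Ideal.mem_span_singleton] at this
  prec' f hf := by
    obtain ⟨x, hx⟩ := hlim f fun m => by
      have := hf (Nat.le_succ m)
      rwa [SModEq.sub_mem, smul_eq_mul, Ideal.mul_top, Ideal.span_singleton_pow,
        Ideal.mem_span_singleton, ← neg_sub, dvd_neg] at this
    refine ⟨x, fun m => ?_⟩
    rw [SModEq.sub_mem, smul_eq_mul, Ideal.mul_top, Ideal.span_singleton_pow,
      Ideal.mem_span_singleton]
    exact hx m

/-- Completeness only depends on the topology: `ϖ` and `r` define the same one. -/
theorem IsAdicComplete.of_dvd_pow {r : B} [IsAdicComplete (Ideal.span {r}) B] {e : ℕ}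
    (h1 : ϖ ∣ r) (h2 : r ∣ ϖ ^ e) : IsAdicComplete (Ideal.span {ϖ}) B := by
  -- replacing `e` by `e + 1` ensures that `m ≤ (e + 1) * m`
  replace h2 : r ∣ ϖ ^ (e + 1) := h2.trans (pow_dvd_pow ϖ (Nat.le_succ e))
  have hr : ∀ m, r ^ m ∣ ϖ ^ ((e + 1) * m) := fun m => by
    rw [pow_mul]; exact pow_dvd_pow_of_dvd h2 m
  refine isAdicComplete_span_singleton (fun x hx => ?_) fun f hf => ?_
  · exact eq_zero_of_forall_pow_dvd (ϖ := r) fun m => (hr m).trans (hx _)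
  · have key : ∀ m d, ϖ ^ m ∣ f (m + d) - f m := by
      intro m d
      induction d with
      | zero => simp
      | succ d ih =>
        have := dvd_add ((pow_dvd_pow ϖ (Nat.le_add_right m d)).trans (hf (m + d))) ih
        simpa [add_assoc] using this
    obtain ⟨x, hx⟩ := exists_limit (ϖ := r) (f := fun m => f ((e + 1) * m)) fun m =>
      (hr m).trans (by
        have := key ((e + 1) * m) (e + 1)
        rwa [← Nat.mul_succ] at this)
    refine ⟨x, fun m => ?_⟩
    obtain ⟨d, hd⟩ : ∃ d, (e + 1) * m = m + d := ⟨e * m, by ring⟩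
    have h3 := (pow_dvd_pow_of_dvd h1 m).trans (hx m)
    have h4 := key m d
    rw [← hd] at h4
    have := dvd_sub h3 h4
    simpa using this

theorem isUnit_of_dvd_sub [IsAdicComplete (Ideal.span {ϖ}) B] {u v : B} (hu : IsUnit u)
    (h : ϖ ∣ v - u) : IsUnit v := by
  obtain ⟨u, rfl⟩ := hu
  obtain ⟨c, hc⟩ := h
  have h1 : ϖ ∈ (⊥ : Ideal B).jacobson :=
    IsAdicComplete.le_jacobson_bot (Ideal.span {ϖ}) (Ideal.mem_span_singleton_self ϖ)
  have h2 := Ideal.mem_jacobson_bot.1 h1 (c * ↑u⁻¹)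
  have h3 : v = (ϖ * (c * ↑u⁻¹) + 1) * u := by
    rw [add_mul, one_mul, mul_assoc, mul_assoc, Units.inv_mul, mul_one, ← hc, sub_add_cancel]
  rw [h3]
  exact h2.mul u.isUnit

end Complete

/-! ### Homomorphisms out of `p`-adic completions -/

section Completion

variable {p : ℕ} {A : Type} [CommRing A]

theorem PCompl.fg : (Ideal.span {(p : A)}).FG := ⟨{(p : A)}, by simp⟩

instance PCompl.isAdicComplete :
    IsAdicComplete (Ideal.span {(p : PCompl p A)}) (PCompl p A) := by
  have h : IsAdicComplete (Ideal.span {(p : A)}) (PCompl p A) :=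
    AdicCompletion.isAdicComplete PCompl.fg
  have e : Ideal.span {(p : PCompl p A)} =
      (Ideal.span {(p : A)}).map (algebraMap A (PCompl p A)) := by
    rw [Ideal.map_span, Set.image_singleton, map_natCast]
  rw [e, IsAdicComplete.map_algebraMap_iff]
  exact h

theorem PCompl.evalₐ_eq_zero_iff {m : ℕ} {x : PCompl p A} :
    AdicCompletion.evalₐ (Ideal.span {(p : A)}) m x = 0 ↔ (p : PCompl p A) ^ m ∣ x := by
  constructor
  · intro h
    have h1 : x ∈ (AdicCompletion.eval (Ideal.span {(p : A)}) A m).ker := by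
      rw [LinearMap.mem_ker, ← AdicCompletion.factor_evalₐ_eq_eval _ _ (by simp), h, map_zero]
    rw [← AdicCompletion.pow_smul_top_eq_ker_eval PCompl.fg, Ideal.span_singleton_pow,
      Submodule.ideal_span_singleton_smul] at h1
    obtain ⟨y, -, rfl⟩ := (Submodule.mem_smul_pointwise_iff_exists _ _ _).1 h1
    exact ⟨y, by rw [Algebra.smul_def, map_pow, map_natCast]⟩
  · rintro ⟨y, rfl⟩
    have h : (p : A ⧸ Ideal.span {(p : A)} ^ m) ^ m = 0 := by
      have h2 : (Ideal.Quotient.mk (Ideal.span {(p : A)} ^ m)) ((p : A) ^ m) = 0 :=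
        Ideal.Quotient.eq_zero_iff_mem.2
          (Ideal.pow_mem_pow (Ideal.mem_span_singleton_self (p : A)) m)
      simpa using h2
    rw [map_mul, map_pow, map_natCast, h, zero_mul]

theorem PCompl.exists_eq_of_add (x : PCompl p A) (m : ℕ) :
    ∃ (a : A) (y : PCompl p A), x = PCompl.of p A a + (p : PCompl p A) ^ m * y := by
  obtain ⟨a, ha⟩ := Ideal.Quotient.mk_surjective
    (AdicCompletion.evalₐ (Ideal.span {(p : A)}) m x)
  have h : AdicCompletion.evalₐ (Ideal.span {(p : A)}) m (x - PCompl.of p A a) = 0 := by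
    rw [map_sub, ← ha, sub_eq_zero]
    rfl
  obtain ⟨y, hy⟩ := PCompl.evalₐ_eq_zero_iff.1 h
  exact ⟨a, y, by rw [← hy]; ring⟩

theorem PCompl.pow_dvd_of {m : ℕ} {a : A} :
    (p : PCompl p A) ^ m ∣ PCompl.of p A a ↔ (p : A) ^ m ∣ a := by
  rw [← PCompl.evalₐ_eq_zero_iff, ← Ideal.mem_span_singleton, ← Ideal.span_singleton_pow,
    ← Ideal.Quotient.eq_zero_iff_mem]
  rfl

/-- Homomorphisms out of a `p`-adic completion into a ring where `p` is nilpotent are determined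
on the dense subring. No continuity has to be assumed since `p ↦ p`. -/
theorem PCompl.hom_ext_of_pow_eq_zero {C : Type} [CommRing C] {m : ℕ} (hC : (p : C) ^ m = 0)
    {f g : PCompl p A →+* C} (h : f.comp (PCompl.of p A) = g.comp (PCompl.of p A)) : f = g := by
  ext x
  obtain ⟨a, y, rfl⟩ := PCompl.exists_eq_of_add x m
  have := RingHom.congr_fun h a
  simp only [RingHom.comp_apply] at this
  simp only [map_add, map_mul, map_pow, map_natCast, hC, zero_mul, add_zero, this]

theorem PCompl.hom_ext {C : Type} [CommRing C] [IsAdicComplete (Ideal.span {(p : C)}) C]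
    {f g : PCompl p A →+* C} (h : f.comp (PCompl.of p A) = g.comp (PCompl.of p A)) : f = g := by
  ext x
  rw [← sub_eq_zero]
  refine eq_zero_of_forall_pow_dvd (ϖ := (p : C)) fun m => ?_
  obtain ⟨a, y, rfl⟩ := PCompl.exists_eq_of_add x m
  have := RingHom.congr_fun h a
  simp only [RingHom.comp_apply] at this
  simp only [map_add, map_mul, map_pow, map_natCast, this, add_sub_add_left_eq_sub, ← mul_sub]
  exact dvd_mul_right _ _

theorem PCompl.mul_p_injective (hA : ∀ a : A, (p : A) * a = 0 → a = 0) (x : PCompl p A)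
    (hx : (p : PCompl p A) * x = 0) : x = 0 := by
  refine eq_zero_of_forall_pow_dvd (ϖ := (p : PCompl p A)) fun m => ?_
  obtain ⟨a, y, rfl⟩ := PCompl.exists_eq_of_add x m
  refine dvd_add (PCompl.pow_dvd_of.2 ?_) (dvd_mul_right _ _)
  have h : (p : PCompl p A) ^ (m + 1) ∣ PCompl.of p A (p * a) := by
    refine ⟨-y, ?_⟩
    rw [map_mul, map_natCast]
    linear_combination hx
  rw [PCompl.pow_dvd_of] at h
  obtain ⟨b, hb⟩ := h
  refine ⟨b, sub_eq_zero.1 (hA _ ?_)⟩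
  linear_combination hb

end Completion

/-! ### The arithmetic Levi-Civita equations -/

section System

variable {n : ℕ} {B : Type} [CommRing B] {ϖ : B}

theorem entries_dvd_iff {r : B} {M : Matrix (Fin n) (Fin n) B} :
    (∀ a b, r ∣ M a b) ↔ ∃ M' : Matrix (Fin n) (Fin n) B, M = r • M' := by
  constructor
  · intro h
    choose M' hM' using h
    exact ⟨Matrix.of M', by ext a b; simp [hM']⟩
  · rintro ⟨M', rfl⟩ a b
    exact ⟨M' a b, rfl⟩

/-- A contraction of the `ϖ`-adically complete set of tuples of matrices divisible by `ϖ` has a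
fixed point. -/
theorem exists_fixedPoint [IsAdicComplete (Ideal.span {ϖ}) B]
    (T : (Fin n → Matrix (Fin n) (Fin n) B) → Fin n → Matrix (Fin n) (Fin n) B)
    (h0 : ∀ u, (∀ i a b, ϖ ∣ u i a b) → ∀ i a b, ϖ ∣ T u i a b)
    (hT : ∀ k u v, (∀ i a b, ϖ ∣ u i a b) → (∀ i a b, ϖ ∣ v i a b) →
      (∀ i a b, ϖ ^ k ∣ u i a b - v i a b) → ∀ i a b, ϖ ^ (k + 1) ∣ T u i a b - T v i a b) :
    ∃ u, (∀ i a b, ϖ ∣ u i a b) ∧ T u = u := by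
  let U : ℕ → Fin n → Matrix (Fin n) (Fin n) B := fun m => T^[m] 0
  have hU : ∀ m, U (m + 1) = T (U m) := fun m => Function.iterate_succ_apply' T m 0
  have hU0 : ∀ m i a b, ϖ ∣ U m i a b := by
    intro m
    induction m with
    | zero => intro i a b; simp [U]
    | succ m ih => rw [hU]; exact h0 _ ih
  have hUc : ∀ m i a b, ϖ ^ m ∣ U (m + 1) i a b - U m i a b := by
    intro m
    induction m with
    | zero => intro i a b; simp
    | succ m ih =>
      have := hT m _ _ (hU0 (m + 1)) (hU0 m) ih
      rwa [← hU, ← hU] at this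
  have hl : ∀ i a b, ∃ x, ∀ m, ϖ ^ m ∣ U m i a b - x := fun i a b =>
    exists_limit fun m => hUc m i a b
  choose L hL using hl
  have hL0 : ∀ i a b, ϖ ∣ L i a b := fun i a b => by
    have := dvd_sub (hU0 1 i a b) (by simpa using hL i a b 1)
    simpa using this
  refine ⟨L, hL0, ?_⟩
  ext i a b
  rw [← sub_eq_zero]
  refine eq_zero_of_forall_pow_dvd (ϖ := ϖ) fun m => ?_
  have h1 := hT m (U m) L (hU0 m) hL0 (fun i a b => hL i a b m) i a b
  rw [← hU] at h1
  have h2 := dvd_sub (hL i a b (m + 1)) h1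
  rw [sub_sub_sub_cancel_left] at h2
  exact (pow_dvd_pow ϖ (Nat.le_succ m)).trans h2

/-- The equations for the matrices `Λ_i` of a Levi-Civita connection: the metric condition
`Λ_iᵗ A_i Λ_i = G`, the symmetry condition with torsion `P · ℓ(Λ)`, and `Λ_i ≡ 1` modulo `ϖ`. -/
structure IsLCSolution (ϖ P : B) (A : Fin n → Matrix (Fin n) (Fin n) B)
    (G : Matrix (Fin n) (Fin n) B)
    (ℓ : (Fin n → Matrix (Fin n) (Fin n) B) → Fin n → Fin n → Fin n → B)
    (Λ : Fin n → Matrix (Fin n) (Fin n) B) : Prop where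
  metric : ∀ i, (Λ i).transpose * A i * Λ i = G
  symm : ∀ i j k, (Λ i - 1) k j - (Λ j - 1) k i = P * ℓ Λ k i j
  cong : ∀ i a b, ϖ ∣ (Λ i - 1) a b

/-- The hypotheses under which the Levi-Civita equations are uniquely solvable. -/
structure LCData (ϖ P : B) (A : Fin n → Matrix (Fin n) (Fin n) B)
    (G : Matrix (Fin n) (Fin n) B)
    (ℓ : (Fin n → Matrix (Fin n) (Fin n) B) → Fin n → Fin n → Fin n → B) : Prop where
  two : IsUnit (2 : B)
  dvd : ϖ ∣ P
  symmA : ∀ i, (A i).IsSymm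
  symmG : G.IsSymm
  unit : IsUnit G.det
  congr : ∀ i a b, ϖ ∣ (A i - G) a b
  antisymm : ∀ Λ k i j, ℓ Λ k i j + ℓ Λ k j i = 0
  cont : ∀ m (Λ Λ' : Fin n → Matrix (Fin n) (Fin n) B),
    (∀ i a b, ϖ ^ m ∣ Λ i a b - Λ' i a b) → ∀ k i j, ϖ ^ m ∣ ℓ Λ k i j - ℓ Λ' k i j

/-- The tensor given by the Koszul formula, up to the factor `2`. -/
def koszul (s : Fin n → Matrix (Fin n) (Fin n) B) (τ : Fin n → Fin n → Fin n → B) (i : Fin n) :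
    Matrix (Fin n) (Fin n) B :=
  Matrix.of fun k j => s i j k + s j k i - s k i j + τ i j k - τ j k i + τ k i j

/-- The linear Levi-Civita problem, in lowered form: twice the solution is `koszul s τ`. -/
theorem two_smul_eq_koszul {s w : Fin n → Matrix (Fin n) (Fin n) B}
    {τ : Fin n → Fin n → Fin n → B}
    (h1 : ∀ i, (w i).transpose + w i = s i) (h2 : ∀ i j k, w i k j - w j k i = τ i j k)
    (i : Fin n) : (2 : B) • w i = koszul s τ i := by
  ext k j
  have e : ∀ i j k, s i k j = w i j k + w i k j := fun i j k => by
    rw [← h1]; simp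
  simp only [koszul, Matrix.of_apply, Matrix.smul_apply, smul_eq_mul, e, ← h2]
  ring

theorem koszul_metric {s : Fin n → Matrix (Fin n) (Fin n) B} {τ : Fin n → Fin n → Fin n → B}
    (hs : ∀ i, (s i).IsSymm) (hτ : ∀ i j k, τ i j k + τ j i k = 0) (i : Fin n) :
    (koszul s τ i).transpose + koszul s τ i = (2 : B) • s i := by
  ext k j
  have e1 := (hs i).apply k j
  have e2 := (hs j).apply k i
  have e3 := (hs k).apply i j
  simp only [koszul, Matrix.of_apply, Matrix.smul_apply, smul_eq_mul, Matrix.add_apply,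
    Matrix.transpose_apply]
  linear_combination e1 - e2 + e3 + hτ i j k + hτ i k j - hτ j k i

theorem koszul_symm {s : Fin n → Matrix (Fin n) (Fin n) B} {τ : Fin n → Fin n → Fin n → B}
    (hs : ∀ i, (s i).IsSymm) (hτ : ∀ i j k, τ i j k + τ j i k = 0) (i j k : Fin n) :
    koszul s τ i k j - koszul s τ j k i = 2 * τ i j k := by
  have e1 := (hs i).apply k j
  have e2 := (hs j).apply k i
  have e3 := (hs k).apply i j
  simp only [koszul, Matrix.of_apply]
  linear_combination e1 - e2 + e3 - hτ i j k + hτ k i j - hτ j k i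

/-- The right-hand side of the metric condition, linearized at `1`: `Λ = 1 + u` satisfies
`Λᵗ A Λ = G` if and only if `uᵗ G + G u` equals this matrix. -/
def metricRhs (A G u : Matrix (Fin n) (Fin n) B) : Matrix (Fin n) (Fin n) B :=
  u.transpose * G + G * u + G - (1 + u).transpose * A * (1 + u)

/-- The torsion with its upper index lowered by `G`. -/
def torsionRhs (P : B) (G : Matrix (Fin n) (Fin n) B)
    (ℓ : (Fin n → Matrix (Fin n) (Fin n) B) → Fin n → Fin n → Fin n → B)
    (u : Fin n → Matrix (Fin n) (Fin n) B) (i j k : Fin n) : B :=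
  ∑ l, G k l * (P * ℓ (fun i => 1 + u i) l i j)

variable {P : B} {A : Fin n → Matrix (Fin n) (Fin n) B} {G : Matrix (Fin n) (Fin n) B}
  {ℓ : (Fin n → Matrix (Fin n) (Fin n) B) → Fin n → Fin n → Fin n → B}

/-- The map whose fixed points `u` give the solutions `1 + u` of the Levi-Civita equations. -/
def lcMap (P : B) (A : Fin n → Matrix (Fin n) (Fin n) B) (G : Matrix (Fin n) (Fin n) B)
    (ℓ : (Fin n → Matrix (Fin n) (Fin n) B) → Fin n → Fin n → Fin n → B)
    (u : Fin n → Matrix (Fin n) (Fin n) B) (i : Fin n) : Matrix (Fin n) (Fin n) B :=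
  Ring.inverse (2 : B) • (G⁻¹ * koszul (fun i => metricRhs (A i) G (u i)) (torsionRhs P G ℓ u) i)

theorem metricRhs_isSymm {A G : Matrix (Fin n) (Fin n) B} (hA : A.IsSymm) (hG : G.IsSymm)
    (u : Matrix (Fin n) (Fin n) B) : (metricRhs A G u).IsSymm := by
  unfold Matrix.IsSymm metricRhs
  simp only [Matrix.transpose_sub, Matrix.transpose_add, Matrix.transpose_mul,
    Matrix.transpose_transpose, hA.eq, hG.eq, Matrix.mul_assoc]
  abel

theorem torsionRhs_antisymm (h : LCData ϖ P A G ℓ) (u : Fin n → Matrix (Fin n) (Fin n) B)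
    (i j k : Fin n) : torsionRhs P G ℓ u i j k + torsionRhs P G ℓ u j i k = 0 := by
  unfold torsionRhs
  rw [← Finset.sum_add_distrib]
  refine Finset.sum_eq_zero fun l _ => ?_
  linear_combination G k l * P * h.antisymm (fun i => 1 + u i) l i j

theorem IsLCSolution.lcMap_eq (h : LCData ϖ P A G ℓ) {Λ : Fin n → Matrix (Fin n) (Fin n) B}
    (hΛ : IsLCSolution ϖ P A G ℓ Λ) : lcMap P A G ℓ (fun i => Λ i - 1) = fun i => Λ i - 1 := by
  funext i
  have e : ∀ i, 1 + (Λ i - 1) = Λ i := fun i => by abel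
  have key := two_smul_eq_koszul (w := fun i => G * (Λ i - 1))
    (s := fun i => metricRhs (A i) G (Λ i - 1))
    (τ := torsionRhs P G ℓ fun i => Λ i - 1) (fun i => by
      simp only [metricRhs, e, hΛ.metric, Matrix.transpose_mul, h.symmG.eq]
      abel) (fun i j k => by
      simp only [torsionRhs, e, ← hΛ.symm, Matrix.mul_apply, mul_sub, Finset.sum_sub_distrib]) i
  rw [lcMap, ← key, Matrix.mul_smul, smul_smul, Ring.inverse_mul_cancel _ h.two, one_smul,
    ← Matrix.mul_assoc, Matrix.nonsing_inv_mul _ h.unit, Matrix.one_mul]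

theorem isLCSolution_of_lcMap_eq (h : LCData ϖ P A G ℓ) {u : Fin n → Matrix (Fin n) (Fin n) B}
    (hu : lcMap P A G ℓ u = u) (hu0 : ∀ i a b, ϖ ∣ u i a b) :
    IsLCSolution ϖ P A G ℓ fun i => 1 + u i := by
  have key : ∀ i, (2 : B) • (G * u i) =
      koszul (fun i => metricRhs (A i) G (u i)) (torsionRhs P G ℓ u) i := by
    intro i
    nth_rewrite 1 [← hu]
    rw [lcMap, Matrix.mul_smul, smul_smul, Ring.mul_inverse_cancel _ h.two, one_smul,
      ← Matrix.mul_assoc, Matrix.mul_nonsing_inv _ h.unit, Matrix.one_mul]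
  have inj : ∀ M N : Matrix (Fin n) (Fin n) B, (2 : B) • M = (2 : B) • N → M = N :=
    fun M N e => by
      have := congrArg (Ring.inverse (2 : B) • ·) e
      simpa only [smul_smul, Ring.inverse_mul_cancel _ h.two, one_smul] using this
  have hs : ∀ i, (metricRhs (A i) G (u i)).IsSymm := fun i =>
    metricRhs_isSymm (h.symmA i) h.symmG _
  have hτ := torsionRhs_antisymm h u
  refine ⟨fun i => ?_, fun i j k => ?_, fun i a b => by simpa using hu0 i a b⟩
  · have e := koszul_metric hs hτ i
    rw [← key, Matrix.transpose_smul, ← smul_add] at e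
    have e := inj _ _ e
    rw [metricRhs, Matrix.transpose_mul, h.symmG.eq, eq_sub_iff_add_eq, add_assoc] at e
    simpa only [add_right_inj, ← add_assoc] using e
  · have e : ∀ k, (G * u i) k j - (G * u j) k i = torsionRhs P G ℓ u i j k := fun k => by
      have := koszul_symm hs hτ i j k
      rw [← key, ← key] at this
      simp only [Matrix.smul_apply, smul_eq_mul, ← mul_sub] at this
      exact h.two.mul_left_cancel this
    have e2 : G.mulVec (fun k => u i k j - u j k i) =
        G.mulVec (fun k => P * ℓ (fun i => 1 + u i) k i j) := by
      funext k
      have := e k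
      simp only [Matrix.mul_apply, torsionRhs, ← Finset.sum_sub_distrib, ← mul_sub] at this
      exact this
    have e3 := congrArg (G⁻¹.mulVec) e2
    simp only [Matrix.mulVec_mulVec, Matrix.nonsing_inv_mul _ h.unit, Matrix.one_mulVec] at e3
    simpa using congrFun e3 k

theorem metricRhs_dvd {A G u : Matrix (Fin n) (Fin n) B} (hA : ∀ a b, ϖ ∣ (A - G) a b)
    (hu : ∀ a b, ϖ ∣ u a b) (a b : Fin n) : ϖ ∣ metricRhs A G u a b := by
  obtain ⟨E, hE⟩ := entries_dvd_iff.1 hA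
  obtain ⟨v, rfl⟩ := entries_dvd_iff.1 hu
  obtain rfl : A = G + ϖ • E := by rw [← hE]; abel
  revert a b
  refine entries_dvd_iff.2 ⟨v.transpose * G + G * v - E * (1 + ϖ • v)
    - v.transpose * (G + ϖ • E) * (1 + ϖ • v) - G * v, ?_⟩
  simp only [metricRhs, Matrix.transpose_add, Matrix.transpose_one, Matrix.transpose_smul,
    Matrix.add_mul, Matrix.mul_add, Matrix.one_mul, Matrix.mul_one, Matrix.smul_mul,
    Matrix.mul_smul, smul_sub, smul_add, smul_smul]
  abel

theorem metricRhs_contract {A G u v : Matrix (Fin n) (Fin n) B} {k : ℕ}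
    (hA : ∀ a b, ϖ ∣ (A - G) a b)
    (hu : ∀ a b, ϖ ∣ u a b) (hv : ∀ a b, ϖ ∣ v a b) (h : ∀ a b, ϖ ^ k ∣ u a b - v a b)
    (a b : Fin n) : ϖ ^ (k + 1) ∣ metricRhs A G u a b - metricRhs A G v a b := by
  obtain ⟨E, hE⟩ := entries_dvd_iff.1 hA
  obtain ⟨u', hu'⟩ := entries_dvd_iff.1 hu
  obtain ⟨v', rfl⟩ := entries_dvd_iff.1 hv
  obtain ⟨d, hd⟩ := (entries_dvd_iff (M := u - ϖ • v')).1 h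
  obtain rfl : A = G + ϖ • E := by rw [← hE]; abel
  have key : metricRhs (G + ϖ • E) G u - metricRhs (G + ϖ • E) G (ϖ • v') =
      -((u - ϖ • v').transpose * (ϖ • E) + (ϖ • E) * (u - ϖ • v')
        + (u - ϖ • v').transpose * (G + ϖ • E) * u
        + (ϖ • v').transpose * (G + ϖ • E) * (u - ϖ • v')) := by
    simp only [metricRhs, Matrix.transpose_add, Matrix.transpose_sub, Matrix.transpose_one,
      Matrix.add_mul, Matrix.mul_add, Matrix.sub_mul, Matrix.mul_sub, Matrix.one_mul,
      Matrix.mul_one]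
    abel
  rw [hd, hu'] at key
  have key2 : ∃ M', metricRhs (G + ϖ • E) G u - metricRhs (G + ϖ • E) G (ϖ • v') =
      ϖ ^ (k + 1) • M' := by
    refine ⟨-(d.transpose * E + E * d + d.transpose * (G + ϖ • E) * u'
      + v'.transpose * (G + ϖ • E) * d), ?_⟩
    rw [hu', key]
    simp only [Matrix.transpose_smul, Matrix.smul_mul, Matrix.mul_smul, smul_smul, smul_add,
      smul_neg, pow_succ, mul_comm ϖ (ϖ ^ k)]
  exact entries_dvd_iff.2 key2 a b

theorem torsionRhs_contract (h : LCData ϖ P A G ℓ) {u v : Fin n → Matrix (Fin n) (Fin n) B}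
    {m : ℕ} (huv : ∀ i a b, ϖ ^ m ∣ u i a b - v i a b) (i j k : Fin n) :
    ϖ ^ (m + 1) ∣ torsionRhs P G ℓ u i j k - torsionRhs P G ℓ v i j k := by
  unfold torsionRhs
  rw [← Finset.sum_sub_distrib]
  refine Finset.dvd_sum fun l _ => ?_
  rw [← mul_sub, ← mul_sub, pow_succ']
  refine Dvd.dvd.mul_left (mul_dvd_mul h.dvd (h.cont m _ _ (fun i a b => ?_) l i j)) _
  simpa using huv i a b

theorem lcMap_dvd (h : LCData ϖ P A G ℓ) (u : Fin n → Matrix (Fin n) (Fin n) B)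
    (hu : ∀ i a b, ϖ ∣ u i a b) (i a b : Fin n) : ϖ ∣ lcMap P A G ℓ u i a b := by
  have hs : ∀ i a b, ϖ ∣ metricRhs (A i) G (u i) a b := fun i =>
    metricRhs_dvd (h.congr i) (hu i)
  have ht : ∀ i j k, ϖ ∣ torsionRhs P G ℓ u i j k := fun i j k =>
    Finset.dvd_sum fun l _ => Dvd.dvd.mul_left (Dvd.dvd.mul_right h.dvd _) _
  simp only [lcMap, Matrix.smul_apply, smul_eq_mul, Matrix.mul_apply, koszul, Matrix.of_apply]
  refine Dvd.dvd.mul_left (Finset.dvd_sum fun l _ => Dvd.dvd.mul_left ?_ _) _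
  exact dvd_add (dvd_sub (dvd_add (dvd_sub (dvd_add (hs _ _ _) (hs _ _ _)) (hs _ _ _)) (ht _ _ _))
    (ht _ _ _)) (ht _ _ _)

theorem lcMap_contract (h : LCData ϖ P A G ℓ) {m : ℕ} {u v : Fin n → Matrix (Fin n) (Fin n) B}
    (hu : ∀ i a b, ϖ ∣ u i a b) (hv : ∀ i a b, ϖ ∣ v i a b)
    (huv : ∀ i a b, ϖ ^ m ∣ u i a b - v i a b) (i a b : Fin n) :
    ϖ ^ (m + 1) ∣ lcMap P A G ℓ u i a b - lcMap P A G ℓ v i a b := by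
  have hs : ∀ i a b, ϖ ^ (m + 1) ∣ metricRhs (A i) G (u i) a b - metricRhs (A i) G (v i) a b :=
    fun i => metricRhs_contract (h.congr i) (hu i) (hv i) (huv i)
  have ht := torsionRhs_contract h huv
  simp only [lcMap, Matrix.smul_apply, smul_eq_mul, Matrix.mul_apply, ← mul_sub,
    ← Finset.sum_sub_distrib]
  refine Dvd.dvd.mul_left (Finset.dvd_sum fun l _ => Dvd.dvd.mul_left ?_ _) _
  have := dvd_add (dvd_sub (dvd_add (dvd_sub (dvd_add (hs i b l) (hs b l i)) (hs l i b))
    (ht i b l)) (ht b l i)) (ht l i b)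
  refine this.trans (dvd_of_eq ?_)
  simp only [koszul, Matrix.of_apply]
  ring

theorem exists_isLCSolution [IsAdicComplete (Ideal.span {ϖ}) B] (h : LCData ϖ P A G ℓ) :
    ∃ Λ, IsLCSolution ϖ P A G ℓ Λ := by
  obtain ⟨u, hu0, hu⟩ := exists_fixedPoint (lcMap P A G ℓ) (lcMap_dvd h)
    fun _ _ _ hu hv => lcMap_contract h hu hv
  exact ⟨_, isLCSolution_of_lcMap_eq h hu hu0⟩

theorem IsLCSolution.unique [IsAdicComplete (Ideal.span {ϖ}) B] (h : LCData ϖ P A G ℓ)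
    {Λ Λ' : Fin n → Matrix (Fin n) (Fin n) B} (hΛ : IsLCSolution ϖ P A G ℓ Λ)
    (hΛ' : IsLCSolution ϖ P A G ℓ Λ') : Λ = Λ' := by
  have key : ∀ m i a b, ϖ ^ m ∣ (Λ i - 1) a b - (Λ' i - 1) a b := by
    intro m
    induction m with
    | zero => intro i a b; simp
    | succ m ih =>
      intro i a b
      have := lcMap_contract h hΛ.cong hΛ'.cong ih i a b
      rwa [hΛ.lcMap_eq h, hΛ'.lcMap_eq h] at this
  ext i a b
  rw [← sub_eq_zero]
  refine eq_zero_of_forall_pow_dvd (ϖ := ϖ) fun m => ?_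
  simpa using key m i a b

end System

/-! ### The Frobenius modulo `ϖ` -/

section Frobenius

variable {p : ℕ} [Fact p.Prime] {n : ℕ} {B B' : Type} [CommRing B] [CommRing B'] {ϖ : B}

/-- The `p ^ s`-power map modulo `ϖ`, a ring homomorphism when `ϖ` divides `p`. -/
def frobMod (s : ℕ) (h : ϖ ∣ (p : B)) : B →+* B ⧸ Ideal.span {ϖ} where
  toFun a := Ideal.Quotient.mk _ (a ^ p ^ s)
  map_one' := by simp
  map_zero' := by simp [(Fact.out : p.Prime).ne_zero]
  map_mul' a b := by rw [mul_pow, map_mul]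
  map_add' a b := by
    obtain ⟨r, hr⟩ := exists_add_pow_prime_pow_eq (Fact.out : p.Prime) a b s
    have h0 : Ideal.Quotient.mk (Ideal.span {ϖ}) (p : B) = 0 :=
      Ideal.Quotient.eq_zero_iff_mem.2 (Ideal.mem_span_singleton.2 h)
    rw [hr, map_add, map_add, mul_assoc, mul_assoc, map_mul, h0, zero_mul, add_zero]

theorem frobMod_apply {s : ℕ} (h : ϖ ∣ (p : B)) (a : B) :
    frobMod s h a = Ideal.Quotient.mk _ (a ^ p ^ s) := rfl

theorem mk_eq_mk_iff_dvd {a b : B} : Ideal.Quotient.mk (Ideal.span {ϖ}) a =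
    Ideal.Quotient.mk (Ideal.span {ϖ}) b ↔ ϖ ∣ a - b := by
  rw [Ideal.Quotient.eq, Ideal.mem_span_singleton]

theorem map_mk_eq_iff {M M' : Matrix (Fin n) (Fin n) B} :
    M.map (Ideal.Quotient.mk (Ideal.span {ϖ})) = M'.map (Ideal.Quotient.mk (Ideal.span {ϖ})) ↔
      ∀ a b, ϖ ∣ (M - M') a b := by
  simp only [← Matrix.ext_iff, Matrix.map_apply, mk_eq_mk_iff_dvd, Matrix.sub_apply]

theorem entryPow_map_mk {s : ℕ} (h : ϖ ∣ (p : B)) (M : Matrix (Fin n) (Fin n) B) :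
    (entryPow M (p ^ s)).map (Ideal.Quotient.mk (Ideal.span {ϖ})) = M.map (frobMod s h) := rfl

theorem entryPow_map (F : B →+* B') (M : Matrix (Fin n) (Fin n) B) (N : ℕ) :
    (entryPow M N).map F = entryPow (M.map F) N := by
  ext a b; simp [entryPow]

theorem entryPow_transpose (M : Matrix (Fin n) (Fin n) B) (N : ℕ) :
    (entryPow M N).transpose = entryPow M.transpose N := rfl

theorem isUnit_det_entryPow [IsAdicComplete (Ideal.span {ϖ}) B] (h : ϖ ∣ (p : B)) {s : ℕ}
    {M : Matrix (Fin n) (Fin n) B} (hM : IsUnit M.det) : IsUnit (entryPow M (p ^ s)).det := by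
  refine isUnit_of_dvd_sub (ϖ := ϖ) (hM.pow (p ^ s)) (mk_eq_mk_iff_dvd.1 ?_)
  rw [← frobMod_apply h, RingHom.map_det, RingHom.map_det]
  rfl

/-- The `x`-part of the congruence `A_i ≡ G` for the Levi-Civita equations of a metric `q` whose
Frobenius transform is `Φ`. -/
theorem metric_congr (h : ϖ ∣ (p : B)) {s : ℕ} {x q Φ : Matrix (Fin n) (Fin n) B}
    (hΦ : ∀ a b, ϖ ∣ (Φ - entryPow q (p ^ s)) a b) (a b : Fin n) :
    ϖ ∣ ((entryPow x (p ^ s)).transpose * Φ * entryPow x (p ^ s)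
      - entryPow (x.transpose * q * x) (p ^ s)) a b := by
  revert a b
  rw [← map_mk_eq_iff] at hΦ ⊢
  rw [entryPow_map_mk h, Matrix.map_mul, Matrix.map_mul, Matrix.map_mul, Matrix.map_mul, hΦ,
    entryPow_map_mk h, entryPow_transpose, entryPow_map_mk h, entryPow_map_mk h]

end Frobenius

/-! ### Substitution into torsion symbols -/

section Subst

variable {p n : ℕ} {B D D' : Type} [CommRing B] [CommRing D] [CommRing D']

theorem substY_of (f : B →+* PCompl p D) (Ξ : Fin n → Matrix (Fin n) (Fin n) (PCompl p D))
    (P : MvPolynomial (Fin n × Fin n × Fin n) B) :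
    substY f Ξ (PCompl.of p _ P) = MvPolynomial.eval₂Hom f (fun ijk => Ξ ijk.1 ijk.2.1 ijk.2.2) P :=
  PCompl.lift_of _ _

theorem map_substY (F : PCompl p D →+* PCompl p D') (f : B →+* PCompl p D)
    (Ξ : Fin n → Matrix (Fin n) (Fin n) (PCompl p D))
    (l : PCompl p (MvPolynomial (Fin n × Fin n × Fin n) B)) :
    F (substY f Ξ l) = substY (F.comp f) (fun i => (Ξ i).map F) l := by
  have : F.comp (substY f Ξ) = substY (F.comp f) (fun i => (Ξ i).map F) := by
    refine PCompl.hom_ext (MvPolynomial.ringHom_ext (fun b => ?_) fun ijk => ?_)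
    · simp only [RingHom.comp_apply, substY_of, MvPolynomial.eval₂Hom_C]
    · simp only [RingHom.comp_apply, substY_of, MvPolynomial.eval₂Hom_X', Matrix.map_apply]
  exact RingHom.congr_fun this l

theorem substY_congr {ϖ : PCompl p D} (hϖ : ϖ ∣ (p : PCompl p D)) (f : B →+* PCompl p D) {m : ℕ}
    {Ξ Ξ' : Fin n → Matrix (Fin n) (Fin n) (PCompl p D)}
    (h : ∀ i a b, ϖ ^ m ∣ Ξ i a b - Ξ' i a b)
    (l : PCompl p (MvPolynomial (Fin n × Fin n × Fin n) B)) :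
    ϖ ^ m ∣ substY f Ξ l - substY f Ξ' l := by
  have h0 : (p : PCompl p D ⧸ Ideal.span {ϖ ^ m}) ^ m = 0 := by
    have h1 : Ideal.Quotient.mk (Ideal.span {ϖ ^ m}) ((p : PCompl p D) ^ m) = 0 :=
      Ideal.Quotient.eq_zero_iff_mem.2 (Ideal.mem_span_singleton.2 (pow_dvd_pow_of_dvd hϖ m))
    simpa using h1
  have : (Ideal.Quotient.mk (Ideal.span {ϖ ^ m})).comp (substY f Ξ) =
      (Ideal.Quotient.mk (Ideal.span {ϖ ^ m})).comp (substY f Ξ') := by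
    refine PCompl.hom_ext_of_pow_eq_zero h0 (MvPolynomial.ringHom_ext (fun b => ?_) fun ijk => ?_)
    · simp only [RingHom.comp_apply, substY_of, MvPolynomial.eval₂Hom_C]
    · simp only [RingHom.comp_apply, substY_of, MvPolynomial.eval₂Hom_X']
      exact mk_eq_mk_iff_dvd.2 (h _ _ _)
  exact mk_eq_mk_iff_dvd.1 (RingHom.congr_fun this l)

/-- The data of the Levi-Civita equations over a `p`-adically complete ring: `x` is the
coordinate on the group, `q` the metric and `Φ i` its `i`-th Frobenius transform. -/
theorem lcData [Fact p.Prime] {s : ℕ} {ϖ : PCompl p D} (hϖ : ϖ ∣ (p : PCompl p D))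
    (h2 : IsUnit (2 : PCompl p D)) (f : B →+* PCompl p D) {L : SymbolTuple p n B}
    (hL : IsTorsionSymbol L) {x q : Matrix (Fin n) (Fin n) (PCompl p D)}
    {Φ : Fin n → Matrix (Fin n) (Fin n) (PCompl p D)} (hx : IsUnit x.det)
    (hq : q.IsSymm) (hq' : IsUnit q.det) (hΦ : ∀ i, (Φ i).IsSymm)
    (hΦq : ∀ i a b, ϖ ∣ (Φ i - entryPow q (p ^ s)) a b) :
    LCData ϖ (p : PCompl p D)
      (fun i => (entryPow x (p ^ s)).transpose * Φ i * entryPow x (p ^ s))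
      (entryPow (x.transpose * q * x) (p ^ s)) (fun Λ k i j => substY f Λ (L k i j)) where
  two := h2
  dvd := hϖ
  symmA i := by
    unfold Matrix.IsSymm
    simp only [Matrix.transpose_mul, Matrix.transpose_transpose, (hΦ i).eq, Matrix.mul_assoc]
  symmG := by
    unfold Matrix.IsSymm
    simp only [entryPow_transpose, Matrix.transpose_mul, Matrix.transpose_transpose, hq.eq,
      Matrix.mul_assoc]
  unit := by
    refine isUnit_det_entryPow (ϖ := (p : PCompl p D)) dvd_rfl ?_
    rw [Matrix.det_mul, Matrix.det_mul, Matrix.det_transpose]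
    exact (hx.mul hq').mul hx
  congr i := metric_congr hϖ (hΦq i)
  antisymm Λ k i j := by rw [← map_add, hL, map_zero]
  cont m Λ Λ' h k i j := substY_congr hϖ f h _

/-- Solutions of the Levi-Civita equations are preserved by base change. -/
theorem IsLCSolution.map {s : ℕ} (F : PCompl p D →+* PCompl p D') {ϖ : PCompl p D}
    {f : B →+* PCompl p D} {L : SymbolTuple p n B} {x q : Matrix (Fin n) (Fin n) (PCompl p D)}
    {Φ Λ : Fin n → Matrix (Fin n) (Fin n) (PCompl p D)}
    (h : IsLCSolution ϖ (p : PCompl p D)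
      (fun i => (entryPow x (p ^ s)).transpose * Φ i * entryPow x (p ^ s))
      (entryPow (x.transpose * q * x) (p ^ s)) (fun Λ k i j => substY f Λ (L k i j)) Λ)
    {ϖ' : PCompl p D'} (hϖ : ϖ' ∣ F ϖ) {f' : B →+* PCompl p D'} (hf : F.comp f = f')
    {x' q' : Matrix (Fin n) (Fin n) (PCompl p D')}
    {Φ' : Fin n → Matrix (Fin n) (Fin n) (PCompl p D')} (hx : x.map F = x') (hq : q.map F = q')
    (hΦ : ∀ i, (Φ i).map F = Φ' i) :
    IsLCSolution ϖ' (p : PCompl p D')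
      (fun i => (entryPow x' (p ^ s)).transpose * Φ' i * entryPow x' (p ^ s))
      (entryPow (x'.transpose * q' * x') (p ^ s)) (fun Λ k i j => substY f' Λ (L k i j))
      fun i => (Λ i).map F where
  metric i := by
    have := congrArg (fun M => M.map F) (h.metric i)
    simpa only [Matrix.map_mul, Matrix.transpose_map, entryPow_map, hx, hq, hΦ] using this
  symm i j k := by
    have := congrArg F (h.symm i j k)
    rw [map_mul, map_natCast, map_substY, hf] at this
    rw [← this, map_sub]
    simp only [Matrix.sub_apply, Matrix.map_apply, map_sub, Matrix.one_apply,
      apply_ite F, map_one, map_zero]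
  cong i a b := by
    have := hϖ.trans (map_dvd F (h.cong i a b))
    simpa only [Matrix.sub_apply, Matrix.map_apply, map_sub, Matrix.one_apply,
      apply_ite F, map_one, map_zero] using this

end Subst

/-! ### Homomorphisms out of coordinate rings and jet algebras -/

section Lifts

variable {p n : ℕ} {B D : Type} [CommRing B] [CommRing D]

theorem GLRing.lift_ofPoly (f : B →+* PCompl p D) (M : Matrix (Fin n) (Fin n) (PCompl p D))
    (hM : IsUnit M.det) (P : MvPolynomial (Fin n × Fin n) B) :
    GLRing.lift f M hM (GLRing.ofPoly p n B P) =
      MvPolynomial.eval₂Hom f (fun ij => M ij.1 ij.2) P := by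
  rw [GLRing.lift, GLRing.ofPoly, RingHom.comp_apply, PCompl.lift_of]
  exact IsLocalization.Away.lift_eq _ _ _

@[simp]
theorem GLRing.lift_C (f : B →+* PCompl p D) (M : Matrix (Fin n) (Fin n) (PCompl p D))
    (hM : IsUnit M.det) (b : B) : GLRing.lift f M hM (GLRing.C p n B b) = f b := by
  rw [GLRing.C, RingHom.comp_apply, GLRing.lift_ofPoly, MvPolynomial.eval₂Hom_C]

theorem GLRing.lift_comp_C (f : B →+* PCompl p D) (M : Matrix (Fin n) (Fin n) (PCompl p D))
    (hM : IsUnit M.det) : (GLRing.lift f M hM).comp (GLRing.C p n B) = f :=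
  RingHom.ext fun b => GLRing.lift_C f M hM b

@[simp]
theorem GLRing.lift_x (f : B →+* PCompl p D) (M : Matrix (Fin n) (Fin n) (PCompl p D))
    (hM : IsUnit M.det) : (GLRing.x p n B).map (GLRing.lift f M hM) = M := by
  ext i j
  simp only [GLRing.x, Matrix.map_apply, GLRing.lift_ofPoly, Matrix.mvPolynomialX_apply,
    MvPolynomial.eval₂Hom_X']

/-- Two homomorphisms out of `B[x, det(x)⁻¹]` before completion which agree on `B` and `x`. -/
theorem localization_hom_ext {C : Type} [CommRing C]
    {f g : Localization.Away (Matrix.mvPolynomialX (Fin n) (Fin n) B).det →+* C}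
    (hC : ∀ b, f (algebraMap (MvPolynomial (Fin n × Fin n) B) _ (MvPolynomial.C b)) =
      g (algebraMap (MvPolynomial (Fin n × Fin n) B) _ (MvPolynomial.C b)))
    (hX : ∀ i j, f (algebraMap (MvPolynomial (Fin n × Fin n) B) _
        (Matrix.mvPolynomialX (Fin n) (Fin n) B i j)) =
      g (algebraMap (MvPolynomial (Fin n × Fin n) B) _
        (Matrix.mvPolynomialX (Fin n) (Fin n) B i j))) :
    f = g :=
  IsLocalization.ringHom_ext (Submonoid.powers (Matrix.mvPolynomialX (Fin n) (Fin n) B).det)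
    (MvPolynomial.ringHom_ext hC fun ij => by simpa using hX ij.1 ij.2)

theorem GLRing.hom_ext {C : Type} [CommRing C] [IsAdicComplete (Ideal.span {(p : C)}) C]
    {f g : GLRing p n B →+* C} (hC : ∀ b, f (GLRing.C p n B b) = g (GLRing.C p n B b))
    (hx : (GLRing.x p n B).map f = (GLRing.x p n B).map g) : f = g :=
  PCompl.hom_ext (localization_hom_ext hC fun i j => congrFun (congrFun hx i) j)

theorem GLRing.hom_ext_of_pow_eq_zero {C : Type} [CommRing C] {m : ℕ} (h0 : (p : C) ^ m = 0)
    {f g : GLRing p n B →+* C} (hC : ∀ b, f (GLRing.C p n B b) = g (GLRing.C p n B b))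
    (hx : (GLRing.x p n B).map f = (GLRing.x p n B).map g) : f = g :=
  PCompl.hom_ext_of_pow_eq_zero h0 (localization_hom_ext hC fun i j => congrFun (congrFun hx i) j)

section Jet

variable (f : B →+* PCompl p D) (M : Matrix (Fin n) (Fin n) (PCompl p D))
    (hs : M.IsSymm) (hM : IsUnit M.det) (N : Fin n → Matrix (Fin n) (Fin n) (PCompl p D))
    (hN : ∀ k, (N k).IsSymm)

theorem Jet.lift_of (P : MvPolynomial (Fin n × Sym2 (Fin n)) (SRing n B)) :
    Jet.lift f M hs hM N hN (Jet.of p n B P) = MvPolynomial.eval₂Hom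
    (IsLocalization.Away.lift (S := SRing n B) (symX n B).det
      (g := MvPolynomial.eval₂Hom f (symEntry M hs)) (by
        rw [RingHom.map_det]
        have e : (MvPolynomial.eval₂Hom f (symEntry M hs)).mapMatrix (symX n B) = M := by
          ext i j
          simp [symX, symEntry]
        rwa [e]))
    (fun ks => symEntry (N ks.1) (hN ks.1) ks.2) P :=
  PCompl.lift_of _ _

theorem Jet.lift_ofPoly (P : MvPolynomial (Sym2 (Fin n)) B) :
    Jet.lift f M hs hM N hN (Jet.ofPoly p n B P) = MvPolynomial.eval₂Hom f (symEntry M hs) P := by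
  rw [Jet.ofPoly, RingHom.comp_apply, Jet.lift_of, RingHom.comp_apply, MvPolynomial.eval₂Hom_C]
  exact IsLocalization.Away.lift_eq _ _ _

@[simp]
theorem Jet.lift_C (b : B) : Jet.lift f M hs hM N hN (Jet.C p n B b) = f b := by
  rw [Jet.C, RingHom.comp_apply, Jet.lift_ofPoly, MvPolynomial.eval₂Hom_C]

@[simp]
theorem Jet.lift_Q : (Jet.Q p n B).map (Jet.lift f M hs hM N hN) = M := by
  ext i j
  simp only [Jet.Q, symX, Matrix.map_apply, Matrix.of_apply, Jet.lift_ofPoly,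
    MvPolynomial.eval₂Hom_X']
  rfl

@[simp]
theorem Jet.lift_dQ (k : Fin n) : (Jet.dQ p n B k).map (Jet.lift f M hs hM N hN) = N k := by
  ext i j
  simp only [Jet.dQ, Matrix.map_apply, Matrix.of_apply, Jet.lift_of, MvPolynomial.eval₂Hom_X']
  rfl

instance Jet.isAdicComplete : IsAdicComplete (Ideal.span {(p : Jet p n B)}) (Jet p n B) :=
  PCompl.isAdicComplete

theorem Jet.hom_ext {C : Type} [CommRing C] [IsAdicComplete (Ideal.span {(p : C)}) C]
    {f g : Jet p n B →+* C} (hC : ∀ b, f (Jet.C p n B b) = g (Jet.C p n B b))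
    (hQ : (Jet.Q p n B).map f = (Jet.Q p n B).map g)
    (hdQ : ∀ k, (Jet.dQ p n B k).map f = (Jet.dQ p n B k).map g) : f = g := by
  refine PCompl.hom_ext (MvPolynomial.ringHom_ext' ?_ ?_)
  · refine IsLocalization.ringHom_ext (Submonoid.powers (symX n B).det)
      (MvPolynomial.ringHom_ext hC fun ij => ?_)
    induction ij with
    | h i j => exact congrFun (congrFun hQ i) j
  · rintro ⟨k, ij⟩
    induction ij with
    | h i j => exact congrFun (congrFun (hdQ k) i) j

end Jet

end Lifts

/-! ### Teichmüller elements of the algebraic closure of `ℚ_p` -/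

section Teichmuller

variable {p : ℕ} [Fact p.Prime]

/-- The ring of integers of the algebraic closure of `ℚ_p`. -/
def algInt (p : ℕ) [Fact p.Prime] : Subring (PadicAlgCl p) where
  carrier := {x | ‖x‖ ≤ 1}
  mul_mem' {a b} ha hb := by
    rw [Set.mem_ofPred_eq, norm_mul]; exact mul_le_one₀ ha (norm_nonneg b) hb
  one_mem' := by simp
  add_mem' {a b} ha hb := (PadicAlgCl.isNonarchimedean p a b).trans (max_le ha hb)
  zero_mem' := by simp
  neg_mem' {a} ha := by rw [Set.mem_ofPred_eq, norm_neg]; exact ha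

/-- The additive group of elements of norm less than one. -/
def algMax (p : ℕ) [Fact p.Prime] : AddSubgroup (PadicAlgCl p) where
  carrier := {x | ‖x‖ < 1}
  add_mem' {a b} ha hb := (PadicAlgCl.isNonarchimedean p a b).trans_lt (max_lt ha hb)
  zero_mem' := by simp
  neg_mem' {a} ha := by rw [Set.mem_ofPred_eq, norm_neg]; exact ha

theorem mem_algInt {x : PadicAlgCl p} : x ∈ algInt p ↔ ‖x‖ ≤ 1 := Iff.rfl

theorem mem_algMax {x : PadicAlgCl p} : x ∈ algMax p ↔ ‖x‖ < 1 := Iff.rfl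

theorem mul_mem_algMax {x y : PadicAlgCl p} (hx : x ∈ algInt p) (hy : y ∈ algMax p) :
    x * y ∈ algMax p := by
  rw [mem_algMax, norm_mul]
  exact (mul_le_of_le_one_left (norm_nonneg y) hx).trans_lt hy

theorem norm_p_lt_one : ‖(p : PadicAlgCl p)‖ < 1 := by
  have := PadicAlgCl.norm_extends p (p : ℚ_[p])
  rw [map_natCast] at this
  rw [this]; exact Padic.norm_p_lt_one

theorem p_mem_algMax : (p : PadicAlgCl p) ∈ algMax p := norm_p_lt_one

theorem eval_mem_algInt {f : Polynomial (PadicAlgCl p)} (hf : ∀ i, f.coeff i ∈ algInt p)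
    {x : PadicAlgCl p} (hx : x ∈ algInt p) : f.eval x ∈ algInt p := by
  rw [Polynomial.eval_eq_sum_range]
  exact sum_mem fun i _ => mul_mem (hf i) (pow_mem hx i)

theorem eval_mem_algMax {f : Polynomial (PadicAlgCl p)} (hf : ∀ i, f.coeff i ∈ algMax p)
    {x : PadicAlgCl p} (hx : x ∈ algInt p) : f.eval x ∈ algMax p := by
  rw [Polynomial.eval_eq_sum_range]
  exact sum_mem fun i _ => by
    rw [mul_comm]; exact mul_mem_algMax (pow_mem hx i) (hf i)

theorem eval_sub_eval_mem_algMax {f : Polynomial (PadicAlgCl p)}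
    (hf : ∀ i, f.coeff i ∈ algInt p) {x y : PadicAlgCl p} (hx : x ∈ algInt p) (hy : y ∈ algInt p)
    (hxy : x - y ∈ algMax p) : f.eval x - f.eval y ∈ algMax p := by
  rw [Polynomial.eval_eq_sum_range, Polynomial.eval_eq_sum_range, ← Finset.sum_sub_distrib]
  refine sum_mem fun i _ => ?_
  rw [← mul_sub]
  refine mul_mem_algMax (hf i) ?_
  obtain ⟨c, hc⟩ := sub_dvd_pow_sub_pow (⟨x, hx⟩ : algInt p) ⟨y, hy⟩ i
  have : x ^ i - y ^ i = (x - y) * c := congrArg Subtype.val hc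
  rw [this, mul_comm]
  exact mul_mem_algMax c.2 hxy

theorem exists_add_pow_eq (k : ℕ) {x y : PadicAlgCl p} (hx : x ∈ algInt p) (hy : y ∈ algInt p) :
    ∃ r ∈ algInt p, (x + y) ^ p ^ k = x ^ p ^ k + y ^ p ^ k + p * x * y * r := by
  obtain ⟨r, hr⟩ := exists_add_pow_prime_pow_eq (Fact.out : p.Prime) (⟨x, hx⟩ : algInt p) ⟨y, hy⟩ k
  exact ⟨r, r.2, by simpa using congrArg Subtype.val hr⟩

theorem norm_algEquiv (σ : PadicAlgCl p ≃ₐ[ℚ_[p]] PadicAlgCl p) (x : PadicAlgCl p) :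
    ‖σ x‖ = ‖x‖ :=
  (spectralNorm_eq_of_equiv σ x).symm

/-- A root of a monic polynomial at which the polynomial is small is close. -/
theorem exists_root_near {f : Polynomial (PadicAlgCl p)} (hf : f.Monic) {x : PadicAlgCl p}
    (hx : f.eval x ∈ algMax p) : ∃ a, f.IsRoot a ∧ x - a ∈ algMax p := by
  by_contra! h
  rw [(IsAlgClosed.splits f).eval_eq_prod_roots_of_monic hf, mem_algMax, ← not_le] at hx
  refine hx ?_
  have : ∀ s : Multiset (PadicAlgCl p), (∀ a ∈ s, 1 ≤ ‖x - a‖) →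
      1 ≤ ‖(s.map fun a => x - a).prod‖ := by
    intro s
    induction s using Multiset.induction_on with
    | empty => simp
    | cons a s ih =>
      intro hs
      rw [Multiset.map_cons, Multiset.prod_cons, norm_mul]
      exact one_le_mul_of_one_le_of_one_le (hs a (Multiset.mem_cons_self a s))
        (ih fun b hb => hs b (Multiset.mem_cons_of_mem hb))
  exact this _ fun a ha => not_lt.1 (h a (Polynomial.isRoot_of_mem_roots ha))

/-- The elements with `ζ ^ (p ^ k) = ζ` for some `k ≥ 1`: zero and the roots of unity of order
prime to `p`. -/
def IsTeich (ζ : PadicAlgCl p) : Prop := ∃ k, 1 ≤ k ∧ ζ ^ p ^ k = ζ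

theorem mem_algInt_of_pow_eq {k : ℕ} (hk : 1 ≤ k) {ζ : PadicAlgCl p} (h : ζ ^ p ^ k = ζ) :
    ζ ∈ algInt p := by
  have h1 : 1 < p ^ k := Nat.one_lt_pow (by omega) (Fact.out : p.Prime).one_lt
  by_contra hn
  rw [mem_algInt, not_le] at hn
  have := congrArg norm h
  rw [norm_pow] at this
  exact (lt_self_pow₀ hn h1).ne' this

theorem IsTeich.mem_algInt {ζ : PadicAlgCl p} (h : IsTeich ζ) : ζ ∈ algInt p := by
  obtain ⟨k, hk, h⟩ := h
  exact mem_algInt_of_pow_eq hk h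

/-- Distinct roots of `X ^ (p ^ k) - X` have distance one. -/
theorem eq_of_sub_mem_algMax {k : ℕ} (hk : 1 ≤ k) {ζ ξ : PadicAlgCl p} (hζ : ζ ^ p ^ k = ζ)
    (hξ : ξ ^ p ^ k = ξ) (h : ξ - ζ ∈ algMax p) : ξ = ζ := by
  have h1 : 1 < p ^ k := Nat.one_lt_pow (by omega) (Fact.out : p.Prime).one_lt
  set η := ξ - ζ with hη
  have hζi := mem_algInt_of_pow_eq hk hζ
  have hηi : η ∈ algInt p := (mem_algMax.1 h).le
  obtain ⟨r, hr, e⟩ := exists_add_pow_eq k hζi hηi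
  have e2 : ζ + η = ξ := by rw [hη]; ring
  rw [e2, hξ, hζ] at e
  have e3 : η = η * (η ^ (p ^ k - 1) + ζ * r * p) := by
    have : η ^ p ^ k = η * η ^ (p ^ k - 1) := by
      rw [← pow_succ', Nat.sub_add_cancel h1.le]
    rw [mul_add, ← this]
    linear_combination e + hη
  have h4 : η ^ (p ^ k - 1) + ζ * r * p ∈ algMax p := by
    refine add_mem ?_ (mul_mem_algMax (mul_mem hζi hr) p_mem_algMax)
    rw [mem_algMax, norm_pow]
    exact pow_lt_one₀ (norm_nonneg _) h (by omega)
  have h5 : η = 0 := by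
    by_contra h0
    have := congrArg norm e3
    rw [norm_mul] at this
    have h6 : ‖η‖ * ‖η ^ (p ^ k - 1) + ζ * r * p‖ < ‖η‖ :=
      mul_lt_of_lt_one_right (norm_pos_iff.2 h0) h4
    exact h6.ne' this
  rwa [hη, sub_eq_zero] at h5

/-- A case of Krasner's lemma, as the conjugates of a Teichmüller element have distance one: an
intermediate field contains the Teichmüller elements close to one of its elements. -/
theorem IsTeich.mem_of_near {E : IntermediateField ℚ_[p] (PadicAlgCl p)} {ζ x : PadicAlgCl p}
    (hζ : IsTeich ζ) (hx : x ∈ E) (h : x - ζ ∈ algMax p) : ζ ∈ E := by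
  obtain ⟨k, hk, hζ⟩ := hζ
  rw [← InfiniteGalois.fixedField_fixingSubgroup E, IntermediateField.mem_fixedField_iff]
  intro σ hσ
  refine eq_of_sub_mem_algMax hk hζ (by rw [← map_pow, hζ]) ?_
  have h1 : x - σ ζ ∈ algMax p := by
    rw [IntermediateField.mem_fixingSubgroup_iff] at hσ
    rw [mem_algMax, ← hσ x hx, ← map_sub, norm_algEquiv]
    exact h
  have := sub_mem h h1
  rwa [sub_sub_sub_cancel_left] at this

/-- Integral elements of the algebraic closure are roots of monic polynomials over `ℤ_p`. -/
theorem exists_monic_padicInt {x : PadicAlgCl p} (hx : x ∈ algInt p) :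
    ∃ f : Polynomial ℤ_[p], f.Monic ∧
      (f.map ((algebraMap ℚ_[p] (PadicAlgCl p)).comp PadicInt.Coe.ringHom)).eval x = 0 := by
  have hint : IsIntegral ℚ_[p] x := Algebra.IsIntegral.isIntegral x
  have h1 : ∀ n, ‖(minpoly ℚ_[p] x).coeff n‖ ≤ 1 :=
    (spectralValue_le_one_iff (minpoly.monic hint)).1 hx
  obtain ⟨f, hf, -, hm⟩ := Polynomial.lifts_and_natDegree_eq_and_monic
    (f := PadicInt.Coe.ringHom (p := p)) (p := minpoly ℚ_[p] x)
    ((Polynomial.lifts_iff_coeff_lifts _).2 fun n => ⟨⟨_, h1 n⟩, rfl⟩) (minpoly.monic hint)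
  refine ⟨f, hm, ?_⟩
  rw [← Polynomial.map_map, hf, Polynomial.eval_map_algebraMap, minpoly.aeval]

/-- Some `p ^ i`-th and `p ^ j`-th powers of an integral element are congruent, since its residue
generates a finite field. -/
theorem exists_pow_sub_pow_mem {x : PadicAlgCl p} (hx : x ∈ algInt p) :
    ∃ i j, i < j ∧ x ^ p ^ j - x ^ p ^ i ∈ algMax p := by
  obtain ⟨f, hf, hfx⟩ := exists_monic_padicInt hx
  set ι := (algebraMap ℚ_[p] (PadicAlgCl p)).comp (PadicInt.Coe.ringHom (p := p)) with hι
  have hιn : ∀ c : ℤ_[p], ‖ι c‖ = ‖c‖ := fun c => norm_algebraMap' (PadicAlgCl p) (c : ℚ_[p])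
  -- the powers of `x` are represented by polynomials of degree less than `deg f`
  let r : ℕ → Polynomial ℤ_[p] := fun k => (Polynomial.X ^ p ^ k) %ₘ f
  have hr : ∀ k, ((r k).map ι).eval x = x ^ p ^ k := fun k => by
    have := congrArg (fun g => (g.map ι).eval x) (Polynomial.modByMonic_add_div
      (Polynomial.X ^ p ^ k) f)
    simpa [hfx, r] using this
  obtain ⟨i, j, hij, h⟩ := Finite.exists_ne_map_eq_of_infinite
    fun k (a : Fin f.natDegree) => PadicInt.toZMod ((r k).coeff a)
  have hc : ∀ a, ((r j - r i).map ι).coeff a ∈ algMax p := by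
    intro a
    rw [Polynomial.coeff_map, mem_algMax, hιn, ← PadicInt.mem_nonunits,
      ← IsLocalRing.mem_maximalIdeal, ← PadicInt.ker_toZMod, RingHom.mem_ker,
      Polynomial.coeff_sub, map_sub, sub_eq_zero]
    rcases lt_or_ge a f.natDegree with ha | ha
    · exact (congrFun h ⟨a, ha⟩).symm
    · have h0 : ∀ k, (r k).coeff a = 0 := fun k =>
        Polynomial.coeff_eq_zero_of_degree_lt ((Polynomial.degree_modByMonic_lt _ hf).trans_le
          ((Polynomial.degree_eq_natDegree hf.ne_zero).trans_le (by exact_mod_cast ha)))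
      rw [h0, h0]
  have key := eval_mem_algMax hc hx
  rw [Polynomial.map_sub, Polynomial.eval_sub, hr, hr] at key
  rcases hij.lt_or_gt with hlt | hlt
  · exact ⟨i, j, hlt, key⟩
  · exact ⟨j, i, hlt, by rw [← neg_sub]; exact neg_mem key⟩

/-- Every integral element is close to a Teichmüller element: its residue is algebraic over the
prime field, hence fixed by a power of the Frobenius. -/
theorem exists_isTeich_near {x : PadicAlgCl p} (hx : x ∈ algInt p) :
    ∃ ζ, IsTeich ζ ∧ x - ζ ∈ algMax p := by
  obtain ⟨i, j, hij, h⟩ := exists_pow_sub_pow_mem hx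
  obtain ⟨k, rfl⟩ := Nat.exists_eq_add_of_lt hij
  set q := p ^ (k + 1) with hq
  have hqi : x ^ q - x ∈ algInt p := sub_mem (pow_mem hx q) hx
  obtain ⟨r, hr, e⟩ := exists_add_pow_eq i hqi hx
  have h1 : (x ^ q - x) ^ p ^ i ∈ algMax p := by
    have e2 : (x ^ q - x) ^ p ^ i = (x ^ p ^ (i + k + 1) - x ^ p ^ i) -
        (x ^ q - x) * x * r * p := by
      rw [sub_add_cancel, ← pow_mul, hq, ← pow_add] at e
      rw [show i + k + 1 = k + 1 + i by ring]
      linear_combination -e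
    rw [e2]
    exact sub_mem h (mul_mem_algMax (mul_mem (mul_mem hqi hx) hr) p_mem_algMax)
  have h2 : x ^ q - x ∈ algMax p := by
    rw [mem_algMax, norm_pow] at h1
    by_contra h3
    rw [mem_algMax, not_lt] at h3
    exact h1.not_ge (one_le_pow₀ h3)
  have hq1 : 1 < q := Nat.one_lt_pow (by omega) (Fact.out : p.Prime).one_lt
  have hm : (Polynomial.X ^ q - Polynomial.X : Polynomial (PadicAlgCl p)).Monic :=
    Polynomial.monic_X_pow_sub (by rw [Polynomial.degree_X]; exact_mod_cast hq1)
  obtain ⟨ζ, hζ, hx⟩ := exists_root_near (x := x) hm (by simpa using h2)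
  refine ⟨ζ, ⟨k + 1, by omega, ?_⟩, hx⟩
  simpa [Polynomial.IsRoot, sub_eq_zero] using hζ

end Teichmuller

/-! ### Value groups of unramified extensions -/

section ValueGroup

variable {p : ℕ} [Fact p.Prime]

open Polynomial

/-- An integral polynomial with `j`-th coefficient `1` and small coefficients above `j` is close to
a monic polynomial of degree `j`. -/
theorem exists_monic_truncation {F : Type*} [Field F] [Algebra F (PadicAlgCl p)] {h : F[X]}
    {j : ℕ} (hj : h.coeff j = 1)
    (hlt : ∀ i, j < i → algebraMap F (PadicAlgCl p) (h.coeff i) ∈ algMax p)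
    (hint : ∀ i, algebraMap F (PadicAlgCl p) (h.coeff i) ∈ algInt p) :
    ∃ t : F[X], t.Monic ∧ t.natDegree = j ∧
      (∀ i, algebraMap F (PadicAlgCl p) (t.coeff i) ∈ algInt p) ∧
      ∀ x ∈ algInt p, aeval x h - aeval x t ∈ algMax p := by
  have hc : ∀ i, (∑ k ∈ Finset.range (j + 1), monomial k (h.coeff k)).coeff i =
      if i ≤ j then h.coeff i else 0 := by
    intro i
    simp [coeff_monomial]
  set t := ∑ k ∈ Finset.range (j + 1), monomial k (h.coeff k) with ht
  have hdeg : t.natDegree ≤ j := natDegree_le_iff_coeff_eq_zero.2 fun i hi => by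
    rw [hc, if_neg (by omega)]
  have hcj : t.coeff j = 1 := by rw [hc, if_pos le_rfl, hj]
  refine ⟨t, monic_of_natDegree_le_of_coeff_eq_one j hdeg hcj,
    natDegree_eq_of_le_of_coeff_ne_zero hdeg (by rw [hcj]; exact one_ne_zero), ?_, ?_⟩
  · intro i
    rw [hc]
    split_ifs
    · exact hint i
    · rw [map_zero]; exact zero_mem _
  · intro x hx
    rw [← map_sub, ← eval_map_algebraMap]
    refine eval_mem_algMax (fun i => ?_) hx
    rw [coeff_map, coeff_sub, hc]
    split_ifs with hi
    · rw [sub_self, map_zero]; exact zero_mem _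
    · rw [sub_zero]; exact hlt i (not_le.1 hi)

/-- A nonzero polynomial has a last coefficient of maximal norm. -/
theorem exists_last_max_coeff {F : Type*} [Field F] [Algebra F (PadicAlgCl p)] {h : F[X]}
    (h0 : h ≠ 0) : ∃ j, h.coeff j ≠ 0 ∧
      (∀ i, ‖algebraMap F (PadicAlgCl p) (h.coeff i)‖ ≤
        ‖algebraMap F (PadicAlgCl p) (h.coeff j)‖) ∧
      ∀ i, j < i → ‖algebraMap F (PadicAlgCl p) (h.coeff i)‖ <
        ‖algebraMap F (PadicAlgCl p) (h.coeff j)‖ := by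
  obtain ⟨j, hj, hm⟩ := h.support.exists_max_image
    (fun i => toLex (‖algebraMap F (PadicAlgCl p) (h.coeff i)‖, i)) (nonempty_support_iff.2 h0)
  rw [mem_support_iff] at hj
  have hpos : 0 < ‖algebraMap F (PadicAlgCl p) (h.coeff j)‖ := by
    rw [norm_pos_iff, Ne, map_eq_zero]; exact hj
  have key : ∀ i, ‖algebraMap F (PadicAlgCl p) (h.coeff i)‖ <
      ‖algebraMap F (PadicAlgCl p) (h.coeff j)‖ ∨
      ‖algebraMap F (PadicAlgCl p) (h.coeff i)‖ =
        ‖algebraMap F (PadicAlgCl p) (h.coeff j)‖ ∧ i ≤ j := by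
    intro i
    by_cases hi : h.coeff i = 0
    · left; rw [hi, map_zero, norm_zero]; exact hpos
    · exact Prod.Lex.le_iff.1 (hm i (mem_support_iff.2 hi))
  refine ⟨j, hj, fun i => ?_, fun i hi => ?_⟩
  · rcases key i with h | h
    · exact h.le
    · exact h.1.le
  · rcases key i with h | h
    · exact h
    · omega

/-- Adjoining a Teichmüller element does not change the value group. Let `g` be a monic integral
polynomial over `M` of least degree that is small at `ζ`, and let `β` be a root of `g` close to `ζ`.
Then `ζ ∈ M(β)`, and in `M(β)` the norm of a polynomial in `β` of degree less than `deg g` is the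
maximum of the norms of its coefficients: otherwise it would yield, after scaling and truncation,
a monic integral polynomial of smaller degree that is small at `ζ`. -/
theorem exists_norm_eq_of_mem_adjoin_isTeich (M : IntermediateField ℚ_[p] (PadicAlgCl p))
    {ζ : PadicAlgCl p} (hζ : IsTeich ζ) {y : PadicAlgCl p}
    (hy : y ∈ IntermediateField.adjoin M {ζ}) : ∃ m ∈ M, ‖y‖ = ‖m‖ := by
  -- the least degree of a monic integral polynomial over `M` that is small at `ζ`
  let small : ℕ → Prop := fun d => ∃ g : M[X], g.Monic ∧ g.natDegree = d ∧
    (∀ i, algebraMap M (PadicAlgCl p) (g.coeff i) ∈ algInt p) ∧ aeval ζ g ∈ algMax p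
  have hex : ∃ d, small d := by
    obtain ⟨k, hk, hζ⟩ := hζ
    have h1 : 1 < p ^ k := Nat.one_lt_pow (by omega) (Fact.out : p.Prime).one_lt
    refine ⟨_, X ^ p ^ k - X, monic_X_pow_sub (by rw [degree_X]; exact_mod_cast h1), rfl,
      fun i => ?_, ?_⟩
    · rw [coeff_sub, coeff_X_pow, coeff_X, map_sub]
      refine sub_mem ?_ ?_ <;> split_ifs <;> simp
    · simp [hζ]
  classical
  obtain ⟨g, hg, hgd, hgi, hgζ⟩ := Nat.find_spec hex
  have hmin : ∀ d, small d → g.natDegree ≤ d := fun d hd => hgd ▸ Nat.find_min' hex hd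
  obtain ⟨β, hβ, hβζ⟩ := exists_root_near (hg.map (algebraMap M (PadicAlgCl p))) (x := ζ)
    (by rwa [eval_map_algebraMap])
  rw [IsRoot, eval_map_algebraMap] at hβ
  have hβi : β ∈ algInt p := by
    have := sub_mem hζ.mem_algInt (show ζ - β ∈ algInt p from (mem_algMax.1 hβζ).le)
    rwa [sub_sub_cancel] at this
  have hβζ' : β - ζ ∈ algMax p := by rw [← neg_sub]; exact neg_mem hβζ
  have hyβ : y ∈ IntermediateField.adjoin M {β} := by
    have : ζ ∈ (IntermediateField.adjoin M {β}).restrictScalars ℚ_[p] :=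
      hζ.mem_of_near (IntermediateField.mem_adjoin_simple_self M β) hβζ'
    exact (IntermediateField.adjoin_simple_le_iff (K := IntermediateField.adjoin M {β}).2 this) hy
  have halg : IsAlgebraic M β := ⟨g, hg.ne_zero, hβ⟩
  rw [← IntermediateField.mem_toSubalgebra,
    IntermediateField.adjoin_simple_toSubalgebra_of_isAlgebraic halg,
    Algebra.adjoin_singleton_eq_range_aeval] at hyβ
  obtain ⟨f, hf⟩ := hyβ
  have hy2 : aeval β (f %ₘ g) = y := by
    have := congrArg (aeval β) (modByMonic_add_div f g)
    rw [map_add, map_mul, hβ, zero_mul, add_zero] at this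
    rw [this]; exact hf
  by_cases h0 : f %ₘ g = 0
  · exact ⟨0, zero_mem _, by rw [← hy2, h0, map_zero]⟩
  obtain ⟨j, hj0, hjmax, hjlt⟩ := exists_last_max_coeff (p := p) h0
  set c := (f %ₘ g).coeff j with hc
  have hcpos : 0 < ‖algebraMap M (PadicAlgCl p) c‖ := by
    rw [norm_pos_iff, Ne, map_eq_zero]; exact hj0
  have hjd : j < g.natDegree := by
    have h1 := degree_modByMonic_lt f hg
    rw [degree_eq_natDegree h0, degree_eq_natDegree hg.ne_zero] at h1
    exact (le_natDegree_of_ne_zero hj0).trans_lt (by exact_mod_cast h1)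
  set h := C c⁻¹ * (f %ₘ g) with hh
  have hn : ∀ i, ‖algebraMap M (PadicAlgCl p) (h.coeff i)‖ =
      ‖algebraMap M (PadicAlgCl p) ((f %ₘ g).coeff i)‖ / ‖algebraMap M (PadicAlgCl p) c‖ := by
    intro i
    rw [hh, coeff_C_mul, map_mul, norm_mul, map_inv₀, norm_inv, div_eq_inv_mul]
  have hint : ∀ i, algebraMap M (PadicAlgCl p) (h.coeff i) ∈ algInt p := fun i => by
    rw [mem_algInt, hn]
    exact (div_le_one hcpos).2 (hjmax i)
  have hlt : ∀ i, j < i → algebraMap M (PadicAlgCl p) (h.coeff i) ∈ algMax p := fun i hi => by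
    rw [mem_algMax, hn]
    exact (div_lt_one hcpos).2 (hjlt i hi)
  have hhj : h.coeff j = 1 := by rw [hh, coeff_C_mul, ← hc, inv_mul_cancel₀ hj0]
  have hint' : ∀ i, (h.map (algebraMap M (PadicAlgCl p))).coeff i ∈ algInt p := fun i => by
    rw [coeff_map]; exact hint i
  have hbig : ¬ aeval β h ∈ algMax p := by
    intro hs
    have h1 : aeval ζ h ∈ algMax p := by
      rw [← eval_map_algebraMap] at hs
      have := add_mem (eval_sub_eval_mem_algMax hint' hζ.mem_algInt hβi hβζ) hs
      rwa [sub_add_cancel, eval_map_algebraMap] at this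
    obtain ⟨t, ht, htd, hti, hts⟩ := exists_monic_truncation hhj hlt hint
    have h2 : aeval ζ t ∈ algMax p := by
      have := sub_mem h1 (hts ζ hζ.mem_algInt)
      rwa [sub_sub_cancel] at this
    exact (hmin j ⟨t, ht, htd, hti, h2⟩).not_gt hjd
  have hone : ‖aeval β h‖ = 1 := by
    refine le_antisymm ?_ (not_lt.1 hbig)
    have := eval_mem_algInt hint' hβi
    rwa [eval_map_algebraMap] at this
  refine ⟨c, c.2, ?_⟩
  have hyc : y = algebraMap M (PadicAlgCl p) c * aeval β h := by
    rw [hh, map_mul, aeval_C, ← mul_assoc, ← map_mul, mul_inv_cancel₀ hj0, map_one, one_mul, hy2]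
  rw [hyc, norm_mul, hone, mul_one]
  rfl

/-- The field generated by the Teichmüller elements. -/
def teichField (p : ℕ) [Fact p.Prime] : IntermediateField ℚ_[p] (PadicAlgCl p) :=
  IntermediateField.adjoin ℚ_[p] {ζ | IsTeich ζ}

theorem exists_norm_eq_of_mem_sup_teichField (M : IntermediateField ℚ_[p] (PadicAlgCl p))
    {y : PadicAlgCl p} (hy : y ∈ M ⊔ teichField p) : ∃ m ∈ M, ‖y‖ = ‖m‖ := by
  have hy' : y ∈ IntermediateField.adjoin ℚ_[p] ((M : Set (PadicAlgCl p)) ∪ {ζ | IsTeich ζ}) := by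
    rw [IntermediateField.adjoin_union, IntermediateField.adjoin_self]
    exact hy
  obtain ⟨T, hT, hyT⟩ := IntermediateField.exists_finset_of_mem_adjoin hy'
  have key : ∀ T : Finset (PadicAlgCl p), (T : Set (PadicAlgCl p)) ⊆
      (M : Set (PadicAlgCl p)) ∪ {ζ | IsTeich ζ} →
      ∃ N : IntermediateField ℚ_[p] (PadicAlgCl p), M ≤ N ∧ (T : Set (PadicAlgCl p)) ⊆ N ∧
        ∀ y ∈ N, ∃ m ∈ M, ‖y‖ = ‖m‖ := by
    classical
    intro T
    induction T using Finset.induction_on with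
    | empty => exact fun _ => ⟨M, le_rfl, by simp, fun y hy => ⟨y, hy, rfl⟩⟩
    | insert t T ht ih =>
      intro hS
      rw [Finset.coe_insert, Set.insert_subset_iff] at hS
      obtain ⟨N, hMN, hTN, hN⟩ := ih hS.2
      rcases hS.1 with h | h
      · refine ⟨N, hMN, ?_, hN⟩
        rw [Finset.coe_insert]
        exact Set.insert_subset (hMN h) hTN
      · have hle : N ≤ (IntermediateField.adjoin N {t}).restrictScalars ℚ_[p] := fun x hx =>
          (IntermediateField.adjoin N {t}).algebraMap_mem ⟨x, hx⟩
        refine ⟨(IntermediateField.adjoin N {t}).restrictScalars ℚ_[p], hMN.trans hle, ?_, ?_⟩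
        · rw [Finset.coe_insert]
          exact Set.insert_subset (IntermediateField.mem_adjoin_simple_self N t) (hTN.trans hle)
        · intro y hy
          obtain ⟨z, hz, e⟩ := exists_norm_eq_of_mem_adjoin_isTeich N h hy
          obtain ⟨m, hm, e'⟩ := hN z hz
          exact ⟨m, hm, e.trans e'⟩
  obtain ⟨N, -, hTN, hN⟩ := key T hT
  exact hN y (IntermediateField.adjoin_le_iff.2 hTN hyT)

/-- A finite extension of `ℚ_p` is generated by its Teichmüller elements and an element `ϖ`
generating its maximal ideal: integral elements have expansions `∑ ζ_k ϖ ^ k`, and the generated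
subfield is closed, being finite-dimensional. -/
theorem le_of_isTeich_of_uniformizer {E W : IntermediateField ℚ_[p] (PadicAlgCl p)}
    [FiniteDimensional ℚ_[p] E] {ϖ : PadicAlgCl p} (hWE : W ≤ E) (hϖ : ϖ ∈ W) (hϖ0 : ϖ ≠ 0)
    (hϖ1 : ‖ϖ‖ < 1) (hmax : ∀ y ∈ E, ‖y‖ < 1 → ‖y‖ ≤ ‖ϖ‖)
    (hW : ∀ ζ ∈ E, IsTeich ζ → ζ ∈ W) : E ≤ W := by
  have hpos : 0 < ‖ϖ‖ := norm_pos_iff.2 hϖ0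
  have exp : ∀ m : ℕ, ∀ x ∈ E, ‖x‖ ≤ 1 → ∃ w ∈ W, ‖x - w‖ ≤ ‖ϖ‖ ^ m := by
    intro m
    induction m with
    | zero => exact fun x _ hx => ⟨0, zero_mem _, by simpa using hx⟩
    | succ m ih =>
      intro x hxE hx
      obtain ⟨ζ, hζ, hxζ⟩ := exists_isTeich_near hx
      have hζE : ζ ∈ E := hζ.mem_of_near hxE hxζ
      obtain ⟨w, hw, h⟩ := ih ((x - ζ) / ϖ) (div_mem (sub_mem hxE hζE) (hWE hϖ)) (by
        rw [norm_div]
        exact (div_le_one hpos).2 (hmax _ (sub_mem hxE hζE) hxζ))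
      refine ⟨ζ + ϖ * w, add_mem (hW ζ hζE hζ) (mul_mem hϖ hw), ?_⟩
      have e : x - (ζ + ϖ * w) = ϖ * ((x - ζ) / ϖ - w) := by
        field_simp
        ring
      rw [e, norm_mul, pow_succ']
      gcongr
  have : FiniteDimensional ℚ_[p] W :=
    FiniteDimensional.of_injective (IntermediateField.inclusion hWE).toLinearMap
      (IntermediateField.inclusion hWE).injective
  have hclosed : IsClosed (W : Set (PadicAlgCl p)) := by
    have : FiniteDimensional ℚ_[p] (Subalgebra.toSubmodule W.toSubalgebra) := this
    exact Submodule.closed_of_finiteDimensional (Subalgebra.toSubmodule W.toSubalgebra)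
  have hint : ∀ x ∈ E, ‖x‖ ≤ 1 → x ∈ W := by
    intro x hxE hx
    rw [← SetLike.mem_coe, ← hclosed.closure_eq, Metric.mem_closure_iff]
    intro ε hε
    obtain ⟨m, hm⟩ := exists_pow_lt_of_lt_one hε hϖ1
    obtain ⟨w, hw, h⟩ := exp m x hxE hx
    exact ⟨w, hw, by rw [dist_eq_norm]; exact h.trans_lt hm⟩
  intro x hx
  rcases le_or_gt ‖x‖ 1 with h | h
  · exact hint x hx h
  · have := hint x⁻¹ (inv_mem hx) (by rw [norm_inv]; exact inv_le_one_of_one_le₀ h.le)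
    simpa using inv_mem this

theorem norm_le_norm_p_of_lt_one {r : ℚ_[p]} (h : ‖r‖ < 1) : ‖r‖ ≤ ‖(p : ℚ_[p])‖ := by
  rw [Padic.norm_p]
  have := (Padic.norm_le_pow_iff_norm_lt_pow_add_one r (-1)).2 (by simpa using h)
  simpa using this

/-- The maximal unramified extension of `ℚ_p` is generated by the Teichmüller elements. -/
theorem Qur_eq_teichField : Qur p = teichField p := by
  refine le_antisymm (sSup_le ?_) (IntermediateField.adjoin_le_iff.2 ?_)
  · rintro F ⟨hF, hval⟩
    have hn : ‖(p : PadicAlgCl p)‖ = ‖(p : ℚ_[p])‖ := by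
      have := PadicAlgCl.norm_extends p (p : ℚ_[p])
      rwa [map_natCast] at this
    refine (le_of_isTeich_of_uniformizer (W := teichField p ⊓ F) inf_le_right
      (natCast_mem _ p) (by exact_mod_cast (Fact.out : p.Prime).ne_zero) norm_p_lt_one ?_ ?_).trans
      inf_le_left
    · intro y hy h
      obtain ⟨r, hr⟩ := hval y hy
      rw [hr] at h ⊢
      rw [hn]
      exact norm_le_norm_p_of_lt_one h
    · exact fun ζ hζE hζ => ⟨IntermediateField.subset_adjoin _ _ hζ, hζE⟩
  · intro ζ hζ
    have hle : IntermediateField.adjoin ℚ_[p] {ζ} ≤ Qur p := by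
      refine le_sSup ⟨IntermediateField.adjoin.finiteDimensional
        (Algebra.IsIntegral.isIntegral ζ), fun x hx => ?_⟩
      obtain ⟨m, hm, e⟩ := exists_norm_eq_of_mem_sup_teichField ⊥ (y := x) (by
        rw [bot_sup_eq]
        exact IntermediateField.adjoin.mono _ _ _ (Set.singleton_subset_iff.2 hζ) hx)
      obtain ⟨r, rfl⟩ := IntermediateField.mem_bot.1 hm
      exact ⟨r, by rw [e, norm_algebraMap']⟩
    exact hle (IntermediateField.mem_adjoin_simple_self _ ζ)

end ValueGroup

/-! ### Frobenius automorphisms preserve `R_π` -/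

section Frobenius

variable {p : ℕ} [Fact p.Prime]

/-- The embedding of the algebraic closure of `ℚ_p` into `ℂ_p`. -/
abbrev toComplex (p : ℕ) [Fact p.Prime] : PadicAlgCl p →ₐ[ℚ_[p]] ℂ_[p] :=
  IsScalarTower.toAlgHom ℚ_[p] (PadicAlgCl p) ℂ_[p]

theorem norm_toComplex (x : PadicAlgCl p) : ‖toComplex p x‖ = ‖x‖ :=
  PadicComplex.norm_extends p x

/-- The closure in `ℂ_p` of an algebraic extension of `ℚ_p`. -/
def closureField (M : IntermediateField ℚ_[p] (PadicAlgCl p)) : IntermediateField ℚ_[p] ℂ_[p] where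
  __ := (M.map (toComplex p)).toSubfield.topologicalClosure
  algebraMap_mem' r := Subfield.le_topologicalClosure _ ((M.map (toComplex p)).algebraMap_mem r)

theorem coe_closureField (M : IntermediateField ℚ_[p] (PadicAlgCl p)) :
    (closureField M : Set ℂ_[p]) = closure (toComplex p '' M) := rfl

theorem toComplex_mem_closureField {M : IntermediateField ℚ_[p] (PadicAlgCl p)}
    {x : PadicAlgCl p} (hx : x ∈ M) : toComplex p x ∈ closureField M :=
  subset_closure ⟨x, hx, rfl⟩

theorem closureField_mono {M N : IntermediateField ℚ_[p] (PadicAlgCl p)} (h : M ≤ N) :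
    closureField M ≤ closureField N :=
  closure_mono (Set.image_mono h)

theorem K_eq_closureField : K p = closureField (teichField p) := by
  rw [← Qur_eq_teichField]; rfl

theorem exists_norm_eq_of_mem_closureField {M : IntermediateField ℚ_[p] (PadicAlgCl p)}
    {a : ℂ_[p]} (ha : a ∈ closureField M) : ∃ m ∈ M, ‖a‖ = ‖m‖ := by
  rcases eq_or_ne a 0 with rfl | h0
  · exact ⟨0, zero_mem _, by simp⟩
  · rw [← SetLike.mem_coe, coe_closureField, Metric.mem_closure_iff] at ha
    obtain ⟨_, ⟨m, hm, rfl⟩, h⟩ := ha ‖a‖ (norm_pos_iff.2 h0)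
    refine ⟨m, hm, ?_⟩
    rw [dist_eq_norm] at h
    have := IsUltrametricDist.norm_add_eq_max_of_norm_ne_norm (x := a) (y := toComplex p m - a)
      (by rw [norm_sub_rev]; exact h.ne')
    rw [add_sub_cancel, norm_sub_rev, max_eq_left h.le, norm_toComplex] at this
    exact this.symm

theorem coe_pi_ne_zero (π : PiSet p) : ((π : PadicAlgCl p) : ℂ_[p]) ≠ 0 := by
  intro h
  have := norm_p_le π
  rw [h, norm_zero, norm_le_zero_iff] at this
  exact (Fact.out : p.Prime).ne_zero (by exact_mod_cast this)

/-- The Galois extension defining `π` is contained in `K_π`. -/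
theorem toComplex_mem_Kpi (π : PiSet p) {E : IntermediateField ℚ_[p] (PadicAlgCl p)}
    [FiniteDimensional ℚ_[p] E] (hπ : (π : PadicAlgCl p) ∈ E) (hπ1 : ‖(π : PadicAlgCl p)‖ < 1)
    (hmax : ∀ x ∈ E, ‖x‖ < 1 → ‖x‖ ≤ ‖(π : PadicAlgCl p)‖) {x : PadicAlgCl p} (hx : x ∈ E) :
    toComplex p x ∈ Kpi π := by
  have hπ0 : (π : PadicAlgCl p) ≠ 0 := fun h =>
    coe_pi_ne_zero π (by rw [h]; exact PadicComplex.coe_zero p)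
  have h : E ≤ E ⊓ (Kpi π).comap (toComplex p) := by
    refine le_of_isTeich_of_uniformizer inf_le_left ⟨hπ, pi_mem_Kpi π⟩ hπ0 hπ1 hmax ?_
    refine fun ζ hζE hζ => ⟨hζE, K_le_Kpi π ?_⟩
    rw [K_eq_closureField]
    exact toComplex_mem_closureField (IntermediateField.subset_adjoin _ _ hζ)
  exact (h hx).2

/-- `K_π` has the same value group as the Galois extension defining `π`. -/
theorem exists_norm_eq_of_mem_Kpi (π : PiSet p) {E : IntermediateField ℚ_[p] (PadicAlgCl p)}
    (hπ : (π : PadicAlgCl p) ∈ E) {a : ℂ_[p]} (ha : a ∈ Kpi π) : ∃ e ∈ E, ‖a‖ = ‖e‖ := by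
  have h : Kpi π ≤ closureField (E ⊔ teichField p) := by
    refine IntermediateField.adjoin_le_iff.2 (Set.union_subset ?_ (Set.singleton_subset_iff.2 ?_))
    · rw [K_eq_closureField]
      exact closureField_mono le_sup_right
    · exact toComplex_mem_closureField ((le_sup_left : E ≤ _) hπ)
  obtain ⟨y, hy, e⟩ := exists_norm_eq_of_mem_closureField (h ha)
  obtain ⟨m, hm, e'⟩ := exists_norm_eq_of_mem_sup_teichField E hy
  exact ⟨m, hm, e.trans e'⟩

theorem toComplex_mem_Kalg (x : PadicAlgCl p) : toComplex p x ∈ Kalg p := by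
  have h : IsAlgebraic ℚ_[p] (toComplex p x) :=
    (Algebra.IsAlgebraic.isAlgebraic (R := ℚ_[p]) x).algebraMap
  exact (mem_algebraicClosure_iff (F := K p) (E := ℂ_[p])).2 (h.tower_top (K p))

/-- The embedding of the algebraic closure of `ℚ_p` into `ℂ_p` twisted by an automorphism of
`K^alg`. -/
def twist (φ : Kalg p ≃ₐ[ℚ_[p]] Kalg p) : PadicAlgCl p →ₐ[ℚ_[p]] ℂ_[p] :=
  (Kalg p).val.comp (φ.toAlgHom.comp
    ((toComplex p).codRestrict (Kalg p).toSubalgebra toComplex_mem_Kalg))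

/-- An embedding into `ℂ_p` maps a normal extension of `ℚ_p` to itself. -/
theorem exists_eq_toComplex_of_normal (ψ : PadicAlgCl p →ₐ[ℚ_[p]] ℂ_[p])
    {E : IntermediateField ℚ_[p] (PadicAlgCl p)} [Normal ℚ_[p] E] {x : PadicAlgCl p}
    (hx : x ∈ E) : ∃ y ∈ E, ψ x = toComplex p y :=
  ⟨ψ.restrictNormal E ⟨x, hx⟩, SetLike.coe_mem _, (ψ.restrictNormal_commutes E ⟨x, hx⟩).symm⟩

theorem map_isTeich_mem_K (ψ : PadicAlgCl p →ₐ[ℚ_[p]] ℂ_[p]) {ζ : PadicAlgCl p}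
    (hζ : IsTeich ζ) : ψ ζ ∈ K p := by
  have : Normal ℚ_[p] (⊤ : IntermediateField ℚ_[p] (PadicAlgCl p)) :=
    Normal.of_algEquiv IntermediateField.topEquiv.symm
  obtain ⟨ξ, -, h⟩ := exists_eq_toComplex_of_normal ψ (E := ⊤) (x := ζ) trivial
  obtain ⟨k, hk, hζ⟩ := hζ
  have hξ : ξ ^ p ^ k = ξ := by
    have : toComplex p (ξ ^ p ^ k) = toComplex p ξ := by rw [map_pow, ← h, ← map_pow, hζ]
    exact (toComplex p).injective this
  rw [h, K_eq_closureField]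
  exact toComplex_mem_closureField (IntermediateField.subset_adjoin _ _ ⟨k, hk, hξ⟩)

theorem map_mem_K {φ : Kalg p ≃ₐ[ℚ_[p]] Kalg p} (hφ : Continuous φ) {a : Kalg p}
    (ha : (a : ℂ_[p]) ∈ K p) : (φ a : ℂ_[p]) ∈ K p := by
  have hU : teichField p ≤ (K p).comap (twist φ) :=
    IntermediateField.adjoin_le_iff.2 fun ζ hζ => map_isTeich_mem_K (twist φ) hζ
  have hc : IsClosed (K p : Set ℂ_[p]) := by
    rw [K_eq_closureField, coe_closureField]; exact isClosed_closure
  have hc' : IsClosed {b : Kalg p | (φ b : ℂ_[p]) ∈ K p} :=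
    hc.preimage (continuous_subtype_val.comp hφ)
  have hs : {b : Kalg p | (b : ℂ_[p]) ∈ toComplex p '' teichField p} ⊆
      {b : Kalg p | (φ b : ℂ_[p]) ∈ K p} := by
    rintro ⟨_, h⟩ ⟨z, hz, rfl⟩
    exact hU hz
  refine closure_minimal hs hc' (closure_subtype.2 ?_)
  rw [K_eq_closureField, ← SetLike.mem_coe, coe_closureField] at ha
  refine closure_mono ?_ ha
  rintro _ ⟨z, hz, rfl⟩
  exact ⟨⟨_, toComplex_mem_Kalg z⟩, ⟨z, hz, rfl⟩, rfl⟩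

/-- A continuous automorphism of `K^alg` preserves `K_π`: it preserves `K`, and it moves `π`
inside a Galois extension of `ℚ_p` contained in `K_π`. -/
theorem map_mem_Kpi {φ : Kalg p ≃ₐ[ℚ_[p]] Kalg p} (hφ : Continuous φ) (π : PiSet p)
    {a : Kalg p} (ha : (a : ℂ_[p]) ∈ Kpi π) : (φ a : ℂ_[p]) ∈ Kpi π := by
  obtain ⟨E, hfin, hgal, hπ, hπ1, hmax⟩ := π.2
  have h : Kpi π ≤ ((Kpi π).comap ((Kalg p).val.comp φ.toAlgHom)).map (Kalg p).val := by
    refine IntermediateField.adjoin_le_iff.2 (Set.union_subset ?_ (Set.singleton_subset_iff.2 ?_))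
    · intro x hx
      exact ⟨⟨x, Kpi_le_Kalg π (K_le_Kpi π hx)⟩, K_le_Kpi π (map_mem_K hφ hx), rfl⟩
    · refine ⟨⟨_, toComplex_mem_Kalg π⟩, ?_, rfl⟩
      obtain ⟨y, hy, e⟩ := exists_eq_toComplex_of_normal (twist φ) hπ
      have := toComplex_mem_Kpi π hπ hπ1 hmax hy
      rw [← e] at this
      exact this
  obtain ⟨b, hb, e⟩ := h ha
  obtain rfl : b = a := Subtype.ext e
  exact hb

/-- The quotient defining the higher `π`-derivation attached to a higher Frobenius automorphism
is integral: its numerator has norm less than one and lies in `K_π`, whose maximal ideal is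
generated by `π`. -/
theorem frobQuot_mem {s : ℕ} {φ : Kalg p ≃ₐ[ℚ_[p]] Kalg p} (hφ : IsHigherFrobenius s φ)
    (π : PiSet p) (a : Rpi π) : frobQuot s φ π a ∈ Rpi π := by
  obtain ⟨E, hfin, hgal, hπ, hπ1, hmax⟩ := π.2
  have hmem : (φ ⟨a, Kpi_le_Kalg π a.2.1⟩ : ℂ_[p]) - (a : ℂ_[p]) ^ p ^ s ∈ Kpi π :=
    sub_mem (map_mem_Kpi hφ.continuous π a.2.1) (pow_mem a.2.1 _)
  refine ⟨div_mem hmem (pi_mem_Kpi π), ?_⟩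
  have hlt : ‖(φ ⟨a, Kpi_le_Kalg π a.2.1⟩ : ℂ_[p]) - (a : ℂ_[p]) ^ p ^ s‖ < 1 :=
    hφ.residue ⟨a, Kpi_le_Kalg π a.2.1⟩ a.2.2
  obtain ⟨e, he, hn⟩ := exists_norm_eq_of_mem_Kpi π hπ hmem
  rw [frobQuot, norm_div, div_le_one (norm_pos_iff.2 (coe_pi_ne_zero π)), hn,
    PadicComplex.norm_extends]
  rw [hn] at hlt
  exact hmax e he hlt

end Frobenius

/-! ### The valuation rings and their Frobenius lifts -/

section Base

variable {p : ℕ} [Fact p.Prime]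

theorem norm_pi_lt_one (π : PiSet p) : ‖((π : PadicAlgCl p) : ℂ_[p])‖ < 1 := by
  obtain ⟨E, -, -, -, h, -⟩ := π.2
  rwa [PadicComplex.norm_extends]

theorem pi_mul_pOverPi (π : PiSet p) : piElt π * pOverPi π = (p : Rpi π) := by
  apply Subtype.ext
  simp only [piElt, pOverPi, Subring.coe_mul, Subring.coe_natCast]
  exact mul_div_cancel₀ _ (coe_pi_ne_zero π)

theorem pi_dvd_p (π : PiSet p) : piElt π ∣ (p : Rpi π) := ⟨_, (pi_mul_pOverPi π).symm⟩

theorem exists_p_dvd_pi_pow (π : PiSet p) : ∃ e, (p : Rpi π) ∣ piElt π ^ e := by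
  have hp : (p : ℂ_[p]) ≠ 0 := by exact_mod_cast (Fact.out : p.Prime).ne_zero
  obtain ⟨e, he⟩ := exists_pow_lt_of_lt_one (norm_pos_iff.2 hp) (norm_pi_lt_one π)
  refine ⟨e, ⟨((π : PadicAlgCl p) : ℂ_[p]) ^ e / (p : ℂ_[p]),
    (Kpi π).div_mem (pow_mem (pi_mem_Kpi π) e) (natCast_mem _ p), ?_⟩, ?_⟩
  · rw [norm_div, norm_pow]
    exact div_le_one_of_le₀ he.le (norm_nonneg _)
  · apply Subtype.ext
    simp only [piElt, Subring.coe_mul, Subring.coe_natCast, Subring.coe_pow]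
    exact (mul_div_cancel₀ _ hp).symm

instance charZero_Rpi (π : PiSet p) : CharZero (Rpi π) where
  cast_injective a b h := by
    have := congrArg (Subtype.val) h
    simpa using this

theorem isUnit_two (hp : p ≠ 2) : IsUnit (2 : R p) := by
  have h2 : (2 : ℂ_[p]) ≠ 0 := two_ne_zero
  have hn : ‖(2 : ℂ_[p])‖ = 1 := by
    have h : ‖algebraMap ℚ_[p] ℂ_[p] 2‖ = ‖(2 : ℚ_[p])‖ := norm_algebraMap' _ _
    rw [map_ofNat] at h
    rw [h]
    have h3 := Padic.norm_natCast_eq_one_iff (p := p) (n := 2)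
    rw [Nat.cast_ofNat] at h3
    exact h3.2 ((Nat.coprime_primes Fact.out Nat.prime_two).2 hp)
  refine IsUnit.of_mul_eq_one ⟨(2 : ℂ_[p])⁻¹, (K p).inv_mem (ofNat_mem (K p) 2), ?_⟩ ?_
  · rw [norm_inv, hn, inv_one]
  · apply Subtype.ext
    exact mul_inv_cancel₀ h2

variable {s : ℕ} {φ : Kalg p ≃ₐ[ℚ_[p]] Kalg p}

theorem coe_deltaPi (hφ : IsHigherFrobenius s φ) (π : PiSet p) (a : Rpi π) :
    (deltaPi s φ π a : ℂ_[p]) = frobQuot s φ π a := by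
  rw [deltaPi, dif_pos (frobQuot_mem hφ π a)]

theorem coe_frob (hφ : IsHigherFrobenius s φ) (π : PiSet p) (a : Rpi π) :
    ((a ^ p ^ s + piElt π * deltaPi s φ π a : Rpi π) : ℂ_[p]) =
      φ ⟨a, Kpi_le_Kalg π a.2.1⟩ := by
  simp only [Subring.coe_add, Subring.coe_mul, Subring.coe_pow, coe_deltaPi hφ, piElt,
    frobQuot]
  rw [mul_div_cancel₀ _ (coe_pi_ne_zero π)]
  ring

/-- The endomorphism of `R_π` induced by a higher Frobenius automorphism. -/
def frobRpi (hφ : IsHigherFrobenius s φ) (π : PiSet p) : Rpi π →+* Rpi π where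
  toFun a := a ^ p ^ s + piElt π * deltaPi s φ π a
  map_one' := Subtype.ext (by
    rw [coe_frob hφ]
    exact congrArg Subtype.val (map_one φ))
  map_zero' := Subtype.ext (by
    rw [coe_frob hφ]
    exact congrArg Subtype.val (map_zero φ))
  map_mul' a b := Subtype.ext <| (coe_frob hφ π (a * b)).trans <|
    (congrArg Subtype.val (map_mul φ ⟨a, Kpi_le_Kalg π a.2.1⟩ ⟨b, Kpi_le_Kalg π b.2.1⟩)).trans
      (congrArg₂ (· * ·) (coe_frob hφ π a) (coe_frob hφ π b)).symm
  map_add' a b := Subtype.ext <| (coe_frob hφ π (a + b)).trans <|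
    (congrArg Subtype.val (map_add φ ⟨a, Kpi_le_Kalg π a.2.1⟩ ⟨b, Kpi_le_Kalg π b.2.1⟩)).trans
      (congrArg₂ (· + ·) (coe_frob hφ π a) (coe_frob hφ π b)).symm

theorem frobRpi_apply (hφ : IsHigherFrobenius s φ) (π : PiSet p) (a : Rpi π) :
    frobRpi hφ π a = a ^ p ^ s + piElt π * deltaPi s φ π a := rfl

theorem isAdicComplete_pi {π : PiSet p} {C : Type} [CommRing C]
    [IsAdicComplete (Ideal.span {(p : C)}) C] (F : Rpi π →+* C) :
    IsAdicComplete (Ideal.span {F (piElt π)}) C := by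
  obtain ⟨e, he⟩ := exists_p_dvd_pi_pow π
  refine IsAdicComplete.of_dvd_pow (r := (p : C)) (e := e) ?_ ?_
  · simpa using map_dvd F (pi_dvd_p π)
  · simpa using map_dvd F he

instance isDomain_localization {n : ℕ} {B : Type} [CommRing B] [IsDomain B] :
    IsDomain (Localization.Away (Matrix.mvPolynomialX (Fin n) (Fin n) B).det) :=
  IsLocalization.isDomain_localization
    (powers_le_nonZeroDivisors_of_noZeroDivisors (Matrix.det_mvPolynomialX_ne_zero (Fin n) B))

theorem localization_mul_p_injective (n : ℕ) (π : PiSet p)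
    (a : Localization.Away (Matrix.mvPolynomialX (Fin n) (Fin n) (Rpi π)).det)
    (ha : (p : Localization.Away (Matrix.mvPolynomialX (Fin n) (Fin n) (Rpi π)).det) * a = 0) :
    a = 0 := by
  refine (mul_eq_zero.1 ha).resolve_left fun h => ?_
  have inj := IsLocalization.injective
    (Localization.Away (Matrix.mvPolynomialX (Fin n) (Fin n) (Rpi π)).det)
    (powers_le_nonZeroDivisors_of_noZeroDivisors
      (Matrix.det_mvPolynomialX_ne_zero (Fin n) (Rpi π)))
  have : (p : MvPolynomial (Fin n × Fin n) (Rpi π)) = 0 :=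
    inj (by rw [map_natCast, map_zero, h])
  exact (Fact.out : p.Prime).ne_zero (by exact_mod_cast this)

theorem ARing.mul_pi_injective {n : ℕ} {π : PiSet p} {a b : ARing n π}
    (h : piA n π * a = piA n π * b) : a = b := by
  rw [← sub_eq_zero]
  refine PCompl.mul_p_injective (localization_mul_p_injective n π) _ ?_
  have e : (p : ARing n π) = GLRing.C p n (Rpi π) (pOverPi π) * piA n π := by
    rw [← map_mul, mul_comm, pi_mul_pOverPi, map_natCast]
  rw [e, mul_assoc, mul_sub, h, sub_self, mul_zero]

end Base

/-! ### The universal Levi-Civita equations over jet algebras -/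

section Universal

variable (p n : ℕ) (B : Type) [CommRing B]

/-- The matrix `Q^(p^s) + b δ_k Q` over the jet algebra: the image of `Q` under the `k`-th
Frobenius lift when `b` is the prime element of `B`. -/
def jetFrob (s : ℕ) (b : B) (k : Fin n) : Matrix (Fin n) (Fin n) (Jet p n B) :=
  entryPow (Jet.Q p n B) (p ^ s) + Jet.C p n B b • Jet.dQ p n B k

theorem jetFrob_isSymm (s : ℕ) (b : B) (k : Fin n) : (jetFrob p n B s b k).IsSymm := by
  unfold Matrix.IsSymm
  rw [jetFrob, Matrix.transpose_add, Matrix.transpose_smul, entryPow_transpose,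
    (Jet.isSymm_Q p n B).eq, (Jet.isSymm_dQ p n B k).eq]

variable {B} in
theorem jetFrob_map {C : Type} [CommRing C] (F : Jet p n B →+* C) (s : ℕ) (b : B) (k : Fin n) :
    (jetFrob p n B s b k).map F =
      entryPow ((Jet.Q p n B).map F) (p ^ s) + F (Jet.C p n B b) • (Jet.dQ p n B k).map F := by
  ext i j
  simp [jetFrob, entryPow, Matrix.map_apply]

variable {B₀ D : Type} [CommRing B₀] [CommRing D]

/-- The Levi-Civita equations with coordinate `x`, metric `q`, Frobenius transforms `Φ i` of `q`,
and torsion `p L`. -/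
abbrev LCSystem {p n : ℕ} (s : ℕ) (ϖ : PCompl p D) (f : B₀ →+* PCompl p D)
    (L : SymbolTuple p n B₀) (x q : Matrix (Fin n) (Fin n) (PCompl p D))
    (Φ Λ : Fin n → Matrix (Fin n) (Fin n) (PCompl p D)) : Prop :=
  IsLCSolution ϖ (p : PCompl p D)
      (fun i => (entryPow x (p ^ s)).transpose * Φ i * entryPow x (p ^ s))
      (entryPow (x.transpose * q * x) (p ^ s)) (fun Λ k i j => substY f Λ (L k i j)) Λ

/-- The universal Levi-Civita equations, over the jet algebra of `B`. -/
abbrev UniversalLC (s : ℕ) (b : B) (g : B₀ →+* B) (L : SymbolTuple p n B₀)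
    (Λ : Fin n → Matrix (Fin n) (Fin n) (GLRing p n (Jet p n B))) : Prop :=
  LCSystem s (GLRing.C p n (Jet p n B) (Jet.C p n B b))
    ((GLRing.C p n (Jet p n B)).comp ((Jet.C p n B).comp g)) L (GLRing.x p n (Jet p n B))
    ((Jet.Q p n B).map (GLRing.C p n (Jet p n B)))
    (fun k => (jetFrob p n B s b k).map (GLRing.C p n (Jet p n B))) Λ

theorem exists_universalLC [Fact p.Prime] (s : ℕ) {b : B} (hb : b ∣ (p : B)) {e : ℕ}
    (hb' : (p : B) ∣ b ^ e) (h2 : IsUnit (2 : B)) (g : B₀ →+* B) {L : SymbolTuple p n B₀}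
    (hL : IsTorsionSymbol L) : ∃ Λ, UniversalLC p n B s b g L Λ := by
  set c := (GLRing.C p n (Jet p n B)).comp (Jet.C p n B) with hc
  have hcb : c b ∣ (p : GLRing p n (Jet p n B)) := by simpa only [map_natCast] using map_dvd c hb
  have : IsAdicComplete (Ideal.span {c b}) (GLRing p n (Jet p n B)) := by
    refine IsAdicComplete.of_dvd_pow (r := (p : GLRing p n (Jet p n B))) (e := e) hcb ?_
    simpa only [map_natCast, map_pow] using map_dvd c hb'
  refine exists_isLCSolution (lcData hcb (by simpa only [map_ofNat] using h2.map c) _ hL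
    (GLRing.isUnit_det_x p n _) ((Jet.isSymm_Q p n B).map _)
    (isUnit_det_map _ (Jet.isUnit_det_Q p n B)) (fun k => (jetFrob_isSymm p n B s b k).map _)
    fun k i j => ?_)
  rw [jetFrob_map, add_sub_cancel_left]
  exact dvd_mul_right _ _

end Universal

/-! ### Strict overconvergence of the universal solution -/

section Overconvergence

variable {p : ℕ} [Fact p.Prime] {n s : ℕ}

theorem JetTensor.inl_C (π : PiSet p) (r : R p) :
    JetTensor.inl n π (Jet.C p n (R p) r) = JetTensor.inr n π (algebraMap (R p) (Rpi π) r) :=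
  (Algebra.TensorProduct.tmul_one_eq_one_tmul (A := Jet p n (R p)) (B := Rpi π) r :)

/-- The image of `π` in `(J^1_p(S) ⊗_R R_π)[x, det(x)⁻¹]^`. -/
abbrev piT (n : ℕ) (π : PiSet p) : GLRing p n (JetTensor n π) :=
  GLRing.C p n (JetTensor n π) (JetTensor.inr n π (piElt π))

/-- The Levi-Civita equations over `(J^1_p(S) ⊗_R R_π)[x, det(x)⁻¹]^`, in which both the
universal equations over `J^1_p(S)` and those over `J^1_π(S)` become the same. -/
abbrev TensorLC (n s : ℕ) (π : PiSet p) (L : SymbolTuple p n (R p))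
    (Λ : Fin n → Matrix (Fin n) (Fin n) (GLRing p n (JetTensor n π))) : Prop :=
  LCSystem s (piT n π)
    ((GLRing.C p n (JetTensor n π)).comp ((JetTensor.inl n π).comp (Jet.C p n (R p)))) L
    (GLRing.x p n (JetTensor n π))
    ((Jet.Q p n (R p)).map ((GLRing.C p n (JetTensor n π)).comp (JetTensor.inl n π)))
    (fun k => (jetFrob p n (R p) s (p : R p) k).map
      ((GLRing.C p n (JetTensor n π)).comp (JetTensor.inl n π))) Λ

theorem piT_dvd (π : PiSet p) : piT n π ∣ (p : GLRing p n (JetTensor n π)) := by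
  have := map_dvd ((GLRing.C p n (JetTensor n π)).comp (JetTensor.inr n π)) (pi_dvd_p π)
  rwa [map_natCast] at this

/-- `π` divides `p`, so `J^1_p(S) ⊗_R R_π` carries the `π`-adic version of the system, which has at
most one solution. No torsion-freeness of the tensor product is needed. -/
theorem TensorLC.unique (hp : p ≠ 2) (π : PiSet p) {L : SymbolTuple p n (R p)}
    (hL : IsTorsionSymbol L)
    {Λ Λ' : Fin n → Matrix (Fin n) (Fin n) (GLRing p n (JetTensor n π))}
    (h : TensorLC n s π L Λ) (h' : TensorLC n s π L Λ') : Λ = Λ' := by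
  have : IsAdicComplete (Ideal.span {piT n π}) (GLRing p n (JetTensor n π)) :=
    isAdicComplete_pi ((GLRing.C p n (JetTensor n π)).comp (JetTensor.inr n π))
  refine IsLCSolution.unique (lcData (piT_dvd π) ?_ _ hL
    (GLRing.isUnit_det_x p n _) ((Jet.isSymm_Q p n (R p)).map _)
    (isUnit_det_map _ (Jet.isUnit_det_Q p n (R p)))
    (fun k => (jetFrob_isSymm p n (R p) s _ k).map _) fun k i j => ?_) h h'
  · simpa only [map_ofNat] using (isUnit_two hp).map
      ((GLRing.C p n (JetTensor n π)).comp ((JetTensor.inl n π).comp (Jet.C p n (R p))))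
  · rw [jetFrob_map, add_sub_cancel_left, map_natCast, map_natCast]
    exact (piT_dvd π).mul_right _

theorem UniversalLC.baseChange {π : PiSet p} {L : SymbolTuple p n (R p)}
    {Λ : Fin n → Matrix (Fin n) (Fin n) (GLRing p n (Jet p n (R p)))}
    (h : UniversalLC p n (R p) s (p : R p) (RingHom.id _) L Λ) :
    TensorLC n s π L fun i => (Λ i).map (ArithLC.baseChange n π) := by
  have hC := GLRing.lift_comp_C ((GLRing.C p n (JetTensor n π)).comp (JetTensor.inl n π))
    (GLRing.x p n (JetTensor n π)) (GLRing.isUnit_det_x p n _)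
  have hm : ∀ M : Matrix (Fin n) (Fin n) (Jet p n (R p)),
      (M.map (GLRing.C p n (Jet p n (R p)))).map (ArithLC.baseChange n π) =
        M.map ((GLRing.C p n (JetTensor n π)).comp (JetTensor.inl n π)) := fun M => by
    rw [← hC]; rfl
  refine IsLCSolution.map (ArithLC.baseChange n π) h ?_ ?_ (GLRing.lift_x _ _ _) (hm _)
    fun k => hm _
  · simp only [map_natCast]
    exact piT_dvd π
  · rw [RingHom.comp_id, ← RingHom.comp_assoc, ArithLC.baseChange, hC, RingHom.comp_assoc]

theorem iotaJet_C (π : PiSet p) (b : Rpi π) : iotaJet n π (Jet.C p n (Rpi π) b) =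
    GLRing.C p n (JetTensor n π) (JetTensor.inr n π b) := by
  rw [iotaJet, Jet.lift_C, RingHom.comp_apply]

theorem iotaJet_Q (π : PiSet p) : (Jet.Q p n (Rpi π)).map (iotaJet n π) =
    (Jet.Q p n (R p)).map ((GLRing.C p n (JetTensor n π)).comp (JetTensor.inl n π)) := by
  rw [iotaJet, Jet.lift_Q]

theorem iotaJet_dQ (π : PiSet p) (k : Fin n) : (Jet.dQ p n (Rpi π) k).map (iotaJet n π) =
    (Jet.dQ p n (R p) k).map fun a =>
      GLRing.C p n (JetTensor n π) (JetTensor.inr n π (pOverPi π) * JetTensor.inl n π a) := by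
  rw [iotaJet, Jet.lift_dQ]

theorem iota_C (π : PiSet p) (a : Jet p n (Rpi π)) :
    iota n π (GLRing.C p n _ a) = iotaJet n π a := by
  rw [iota, GLRing.lift_C]

theorem iota_x (π : PiSet p) : (GLRing.x p n (Jet p n (Rpi π))).map (iota n π) =
    GLRing.x p n (JetTensor n π) := by
  rw [iota, GLRing.lift_x]

theorem UniversalLC.iota {π : PiSet p} {L : SymbolTuple p n (R p)}
    {Λ : Fin n → Matrix (Fin n) (Fin n) (GLRing p n (Jet p n (Rpi π)))}
    (h : UniversalLC p n (Rpi π) s (piElt π) (algebraMap (R p) (Rpi π)) L Λ) :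
    TensorLC n s π L fun i => (Λ i).map (ArithLC.iota n π) := by
  have hm : ∀ M : Matrix (Fin n) (Fin n) (Jet p n (Rpi π)),
      (M.map (GLRing.C p n (Jet p n (Rpi π)))).map (ArithLC.iota n π) = M.map (iotaJet n π) :=
    fun M => Matrix.ext fun i j => iota_C π (M i j)
  refine IsLCSolution.map (ArithLC.iota n π) h ?_ ?_ (iota_x π) ?_ fun k => ?_
  · rw [iota_C, iotaJet_C]
  · refine RingHom.ext fun r => ?_
    exact (iota_C π _).trans ((iotaJet_C π _).trans (by rw [← JetTensor.inl_C]; rfl))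
  · rw [hm, iotaJet_Q]
  · rw [hm, jetFrob_map, jetFrob_map, iotaJet_Q, iotaJet_dQ, iotaJet_C]
    congr 1
    refine Matrix.ext fun i j => ?_
    simp only [Matrix.smul_apply, Matrix.map_apply, smul_eq_mul, map_natCast]
    rw [← map_mul, ← mul_assoc, ← map_mul, pi_mul_pOverPi, map_natCast, map_mul, map_natCast]
    rfl

/-- The universal solution over `J^1_π(S)` represents the universal solution over `J^1_p(S)`. -/
theorem UniversalLC.represents (hp : p ≠ 2) {π : PiSet p} {L : SymbolTuple p n (R p)}
    (hL : IsTorsionSymbol L) {Λ : Fin n → Matrix (Fin n) (Fin n) (GLRing p n (Jet p n (R p)))}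
    (h : UniversalLC p n (R p) s (p : R p) (RingHom.id _) L Λ)
    {Λπ : Fin n → Matrix (Fin n) (Fin n) (GLRing p n (Jet p n (Rpi π)))}
    (h' : UniversalLC p n (Rpi π) s (piElt π) (algebraMap (R p) (Rpi π)) L Λπ) (i : Fin n) :
    Represents π (Λπ i) (Λ i) := fun a b =>
  congrFun (congrFun (congrFun (TensorLC.unique hp π hL h'.iota h.baseChange) i) a) b

theorem exists_universalLC_pi (hp : p ≠ 2) (s : ℕ) (π : PiSet p) {L : SymbolTuple p n (R p)}
    (hL : IsTorsionSymbol L) :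
    ∃ Λ, UniversalLC p n (Rpi π) s (piElt π) (algebraMap (R p) (Rpi π)) L Λ := by
  obtain ⟨e, he⟩ := exists_p_dvd_pi_pow π
  exact exists_universalLC p n (Rpi π) s (pi_dvd_p π) he
    (by simpa only [map_ofNat] using (isUnit_two hp).map (algebraMap (R p) (Rpi π))) _ hL

theorem exists_universalLC_p (hp : p ≠ 2) (s : ℕ) {L : SymbolTuple p n (R p)}
    (hL : IsTorsionSymbol L) :
    ∃ Λ, UniversalLC p n (R p) s (p : R p) (RingHom.id _) L Λ :=
  exists_universalLC p n (R p) s dvd_rfl (e := 1) (by rw [pow_one]) (isUnit_two hp) _ hL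

theorem UniversalLC.strictlyOverconvergent (hp : p ≠ 2) {L : SymbolTuple p n (R p)}
    (hL : IsTorsionSymbol L) {Λ : Fin n → Matrix (Fin n) (Fin n) (GLRing p n (Jet p n (R p)))}
    (h : UniversalLC p n (R p) s (p : R p) (RingHom.id _) L Λ) (i : Fin n) :
    StrictlyOverconvergent (Λ i) := fun π a b => by
  obtain ⟨Λπ, hΛπ⟩ := exists_universalLC_pi (n := n) hp s π hL
  exact ⟨Λπ i a b, h.represents hp hL hΛπ i a b⟩

end Overconvergence

/-! ### Rescaling of variables in completed polynomial rings -/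

section Rescale

variable {p : ℕ} {ι D : Type} [CommRing D]

/-- The substitution `z ↦ c z` in a polynomial ring. -/
def rescalePoly (ι : Type) (c : D) : MvPolynomial ι D →+* MvPolynomial ι D :=
  MvPolynomial.eval₂Hom MvPolynomial.C fun i => MvPolynomial.C c * MvPolynomial.X i

theorem coeff_rescalePoly (c : D) (f : MvPolynomial ι D) (α : ι →₀ ℕ) :
    (rescalePoly ι c f).coeff α = c ^ α.degree * f.coeff α := by
  classical
  induction f using MvPolynomial.induction_on' with
  | monomial β a =>
    have : rescalePoly ι c (MvPolynomial.monomial β a) =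
        MvPolynomial.monomial β (c ^ β.degree * a) := by
      rw [rescalePoly, MvPolynomial.coe_eval₂Hom, MvPolynomial.eval₂_monomial, Finsupp.prod]
      simp only [mul_pow, Finset.prod_mul_distrib, Finset.prod_pow_eq_pow_sum]
      rw [MvPolynomial.monomial_eq, Finsupp.prod, map_mul, map_pow, Finsupp.degree_apply]
      ring
    rw [this, MvPolynomial.coeff_monomial, MvPolynomial.coeff_monomial]
    split_ifs with h
    · rw [h]
    · rw [mul_zero]
  | add f g hf hg => rw [map_add, MvPolynomial.coeff_add, MvPolynomial.coeff_add, hf, hg, mul_add]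

/-- The substitution `z ↦ c z` in the `p`-adic completion of a polynomial ring. -/
def rescale (p : ℕ) (ι : Type) (c : D) :
    PCompl p (MvPolynomial ι D) →+* PCompl p (MvPolynomial ι D) :=
  PCompl.lift ((PCompl.of p _).comp (rescalePoly ι c))

/-- The substitution `z ↦ c z` is injective when `c` divides the nonzerodivisor `p`: modulo
`p ^ (m + |α|)`, vanishing of the `α`-th coefficient `c ^ |α| a` forces `p ^ m ∣ a`. -/
theorem rescale_injective {c c' : D} (hc : c * c' = (p : D))
    (hD : ∀ a : D, (p : D) * a = 0 → a = 0) {F : PCompl p (MvPolynomial ι D)}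
    (hF : rescale p ι c F = 0) : F = 0 := by
  have hpow : ∀ (k : ℕ) (a : D), (p : D) ^ k * a = 0 → a = 0 := by
    intro k
    induction k with
    | zero => intro a h; simpa using h
    | succ k ih => intro a h; exact hD a (ih _ (by rw [← h]; ring))
  refine eq_zero_of_forall_pow_dvd (ϖ := (p : PCompl p (MvPolynomial ι D))) fun m => ?_
  obtain ⟨f, y, hf⟩ := PCompl.exists_eq_of_add F m
  rw [hf]
  refine dvd_add (PCompl.pow_dvd_of.2 ?_) (dvd_mul_right _ _)
  have hC : ∀ k : ℕ, (p : MvPolynomial ι D) ^ k = MvPolynomial.C ((p : D) ^ k) := fun k => by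
    rw [map_pow, map_natCast]
  rw [hC, MvPolynomial.C_dvd_iff_dvd_coeff]
  intro α
  obtain ⟨g, z, hg⟩ := PCompl.exists_eq_of_add F (m + α.degree)
  have h1 : (p : MvPolynomial ι D) ^ (m + α.degree) ∣ rescalePoly ι c g := by
    rw [← PCompl.pow_dvd_of]
    rw [hg, map_add, rescale, PCompl.lift_of, map_mul, map_pow, map_natCast,
      add_eq_zero_iff_eq_neg] at hF
    exact ⟨-(PCompl.lift ((PCompl.of p _).comp (rescalePoly ι c)) z), by rw [mul_neg]; exact hF⟩
  have h2 : (p : MvPolynomial ι D) ^ m ∣ f - g := by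
    rw [← PCompl.pow_dvd_of (p := p), map_sub]
    refine ⟨(p : PCompl p (MvPolynomial ι D)) ^ α.degree * z - y, ?_⟩
    rw [hf] at hg
    linear_combination hg
  rw [hC, MvPolynomial.C_dvd_iff_dvd_coeff] at h1 h2
  obtain ⟨b, hb⟩ := h1 α
  rw [coeff_rescalePoly] at hb
  have h3 : (p : D) ^ m ∣ g.coeff α := by
    refine ⟨c' ^ α.degree * b, sub_eq_zero.1 (hpow α.degree _ ?_)⟩
    rw [← hc] at hb ⊢
    linear_combination c' ^ α.degree * hb
  have := dvd_add (h2 α) h3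
  rwa [MvPolynomial.coeff_sub, sub_add_cancel] at this

end Rescale

/-! ### The specialization at a metric factors through `ι` -/

section Kernel

variable {p : ℕ} [Fact p.Prime] {n : ℕ} {π : PiSet p}

/-- The homomorphism out of `J^1_p(S) ⊗_R R_π` given by homomorphisms out of the factors. -/
def JetTensor.lift {Z : Type} [CommRing Z] (g : Jet p n (R p) →+* Z) (h : Rpi π →+* Z)
    (hgh : ∀ r, g (Jet.C p n (R p) r) = h (algebraMap (R p) (Rpi π) r)) :
    JetTensor n π →+* Z :=
  letI : Algebra (R p) Z := (g.comp (Jet.C p n (R p))).toAlgebra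
  (Algebra.TensorProduct.lift (S := R p) (A := Jet p n (R p)) (B := Rpi π)
    { g with commutes' := fun _ => rfl }
    { h with commutes' := fun r => (hgh r).symm } fun _ _ => Commute.all _ _).toRingHom

theorem JetTensor.lift_inl {Z : Type} [CommRing Z] (g : Jet p n (R p) →+* Z) (h : Rpi π →+* Z)
    (hgh : ∀ r, g (Jet.C p n (R p) r) = h (algebraMap (R p) (Rpi π) r)) (a : Jet p n (R p)) :
    JetTensor.lift g h hgh (JetTensor.inl n π a) = g a := by
  let : Algebra (R p) Z := (g.comp (Jet.C p n (R p))).toAlgebra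
  exact (Algebra.TensorProduct.lift_tmul _ _ _ _ _).trans (by
    rw [map_one, mul_one]; rfl)

theorem JetTensor.lift_inr {Z : Type} [CommRing Z] (g : Jet p n (R p) →+* Z) (h : Rpi π →+* Z)
    (hgh : ∀ r, g (Jet.C p n (R p) r) = h (algebraMap (R p) (Rpi π) r)) (b : Rpi π) :
    JetTensor.lift g h hgh (JetTensor.inr n π b) = h b := by
  let : Algebra (R p) Z := (g.comp (Jet.C p n (R p))).toAlgebra
  exact (Algebra.TensorProduct.lift_tmul _ _ _ _ _).trans (by
    rw [map_one, one_mul]; rfl)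

/-- `R_π[x, det(x)⁻¹]`. -/
abbrev GLLoc (n : ℕ) (π : PiSet p) : Type :=
  Localization.Away (Matrix.mvPolynomialX (Fin n) (Fin n) (Rpi π)).det

/-- `R_π[x, det(x)⁻¹][z]^`, with variables `z` in place of the `δ_k q_ij`. -/
abbrev GLVar (n : ℕ) (π : PiSet p) : Type :=
  PCompl p (MvPolynomial (Fin n × Sym2 (Fin n)) (GLLoc n π))

namespace GLVar

/-- The inclusion of `R_π[x, det(x)⁻¹]`. -/
abbrev ofLoc (n : ℕ) (π : PiSet p) : GLLoc n π →+* GLVar n π :=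
  (PCompl.of p _).comp MvPolynomial.C

/-- The structure homomorphism. -/
def C (n : ℕ) (π : PiSet p) : Rpi π →+* GLVar n π :=
  (ofLoc n π).comp ((algebraMap (MvPolynomial (Fin n × Fin n) (Rpi π)) (GLLoc n π)).comp
    MvPolynomial.C)

/-- The matrix `x`. -/
def x (n : ℕ) (π : PiSet p) : Matrix (Fin n) (Fin n) (GLVar n π) :=
  (Matrix.mvPolynomialX (Fin n) (Fin n) (Rpi π)).map
    ((ofLoc n π).comp (algebraMap (MvPolynomial (Fin n × Fin n) (Rpi π)) (GLLoc n π)))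

theorem isUnit_det_x (n : ℕ) (π : PiSet p) : IsUnit (x n π).det := by
  have h := (IsLocalization.Away.algebraMap_isUnit (S := GLLoc n π)
    (Matrix.mvPolynomialX (Fin n) (Fin n) (Rpi π)).det).map (ofLoc n π)
  rw [← RingHom.comp_apply, RingHom.map_det] at h
  exact h

/-- The symmetric matrices of variables `z_k`. -/
def z (n : ℕ) (π : PiSet p) (k : Fin n) : Matrix (Fin n) (Fin n) (GLVar n π) :=
  Matrix.of fun i j => PCompl.of p _ (MvPolynomial.X (k, s(i, j)))

theorem z_isSymm (n : ℕ) (π : PiSet p) (k : Fin n) : (z n π k).IsSymm := by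
  ext i j
  simp [z, Sym2.eq_swap]

variable (q : Matrix (Fin n) (Fin n) (Rpi π)) (hq : IsMetric π q)

/-- The partial specialization `Q ↦ q`, `δ_{π,k} Q ↦ z_k` of the jet algebra. -/
def jetSpecialize : Jet p n (Rpi π) →+* GLVar n π :=
  Jet.lift (C n π) (q.map (C n π)) (hq.symm.map _) (isUnit_det_map _ hq.isUnit)
    (z n π) (z_isSymm n π)

theorem jetSpecialize_C (b : Rpi π) : jetSpecialize q hq (Jet.C p n _ b) = C n π b := by
  rw [jetSpecialize, Jet.lift_C]

theorem jetSpecialize_Q : (Jet.Q p n _).map (jetSpecialize q hq) = q.map (C n π) := by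
  rw [jetSpecialize, Jet.lift_Q]

theorem jetSpecialize_dQ (k : Fin n) : (Jet.dQ p n _ k).map (jetSpecialize q hq) = z n π k := by
  rw [jetSpecialize, Jet.lift_dQ]

/-- The partial specialization `Q ↦ q`, `δ_{π,k} Q ↦ z_k`, `x ↦ x`. -/
def specialize : GLRing p n (Jet p n (Rpi π)) →+* GLVar n π :=
  GLRing.lift (jetSpecialize q hq) (x n π) (isUnit_det_x n π)

theorem specialize_C (a : Jet p n (Rpi π)) :
    specialize q hq (GLRing.C p n _ a) = jetSpecialize q hq a := by
  rw [specialize, GLRing.lift_C]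

theorem specialize_x : (GLRing.x p n _).map (specialize q hq) = x n π := by
  rw [specialize, GLRing.lift_x]

/-- The homomorphism out of `J^1_p(S)` with `Q ↦ q`, `δ_{p,k} Q ↦ z_k`. -/
def jetSpecializeR : Jet p n (R p) →+* GLVar n π :=
  Jet.lift ((C n π).comp (algebraMap (R p) (Rpi π))) (q.map (C n π))
    (hq.symm.map _) (isUnit_det_map _ hq.isUnit) (z n π) (z_isSymm n π)

theorem jetSpecializeR_C (r : R p) :
    jetSpecializeR q hq (Jet.C p n _ r) = C n π (algebraMap (R p) (Rpi π) r) := by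
  rw [jetSpecializeR, Jet.lift_C, RingHom.comp_apply]

theorem jetSpecializeR_Q : (Jet.Q p n _).map (jetSpecializeR q hq) = q.map (C n π) := by
  rw [jetSpecializeR, Jet.lift_Q]

theorem jetSpecializeR_dQ (k : Fin n) :
    (Jet.dQ p n _ k).map (jetSpecializeR q hq) = z n π k := by
  rw [jetSpecializeR, Jet.lift_dQ]

/-- The homomorphism out of `(J^1_p(S) ⊗_R R_π)[x, det(x)⁻¹]^` with `Q ↦ q`, `δ_{p,k} Q ↦ z_k`. -/
def tensorSpecialize : GLRing p n (JetTensor n π) →+* GLVar n π :=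
  GLRing.lift (JetTensor.lift (jetSpecializeR q hq) (C n π) (jetSpecializeR_C q hq)) (x n π)
    (isUnit_det_x n π)

theorem tensorSpecialize_inl (a : Jet p n (R p)) :
    tensorSpecialize q hq (GLRing.C p n _ (JetTensor.inl n π a)) = jetSpecializeR q hq a := by
  rw [tensorSpecialize, GLRing.lift_C, JetTensor.lift_inl]

theorem tensorSpecialize_inr (b : Rpi π) :
    tensorSpecialize q hq (GLRing.C p n _ (JetTensor.inr n π b)) = C n π b := by
  rw [tensorSpecialize, GLRing.lift_C, JetTensor.lift_inr]

theorem tensorSpecialize_x : (GLRing.x p n _).map (tensorSpecialize q hq) = x n π := by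
  rw [tensorSpecialize, GLRing.lift_x]

/-- Evaluation at `z_k = N k`. -/
def eval (N : Fin n → Matrix (Fin n) (Fin n) (Rpi π)) (hN : ∀ k, (N k).IsSymm) :
    GLVar n π →+* ARing n π :=
  PCompl.lift (MvPolynomial.eval₂Hom (PCompl.of p (GLLoc n π)) fun ks =>
    GLRing.C p n (Rpi π) (symEntry (N ks.1) (hN ks.1) ks.2))

theorem rescale_ofLoc (a c : GLLoc n π) : rescale p _ c (ofLoc n π a) = ofLoc n π a := by
  rw [rescale, ofLoc, RingHom.comp_apply, PCompl.lift_of, RingHom.comp_apply, rescalePoly,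
    MvPolynomial.eval₂Hom_C]

theorem rescale_z (c : GLLoc n π) (k i j : Fin n) :
    rescale p _ c (z n π k i j) = ofLoc n π c * z n π k i j := by
  rw [z, Matrix.of_apply, rescale, PCompl.lift_of, RingHom.comp_apply, rescalePoly,
    MvPolynomial.eval₂Hom_X', map_mul, RingHom.comp_apply]

theorem tensorSpecialize_iotaJet (a : Jet p n (Rpi π)) :
    tensorSpecialize q hq (iotaJet n π a) =
      rescale p _ (algebraMap (MvPolynomial (Fin n × Fin n) (Rpi π)) (GLLoc n π)
        (MvPolynomial.C (pOverPi π))) (jetSpecialize q hq a) := by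
  set c := algebraMap (MvPolynomial (Fin n × Fin n) (Rpi π)) (GLLoc n π)
    (MvPolynomial.C (pOverPi π)) with hc
  have key : (tensorSpecialize q hq).comp (iotaJet n π) =
      (rescale p _ c).comp (jetSpecialize q hq) := by
    refine Jet.hom_ext (fun b => ?_) ?_ fun k => ?_
    · change tensorSpecialize q hq (iotaJet n π (Jet.C p n _ b)) =
        rescale p _ c (jetSpecialize q hq (Jet.C p n _ b))
      rw [iotaJet_C, tensorSpecialize_inr, jetSpecialize_C]
      exact (rescale_ofLoc _ _).symm
    · rw [RingHom.coe_comp, RingHom.coe_comp, ← Matrix.map_map, ← Matrix.map_map, iotaJet_Q,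
        jetSpecialize_Q, ← jetSpecializeR_Q q hq]
      refine Matrix.ext fun i j => (tensorSpecialize_inl q hq _).trans ?_
      have h := congrFun (congrFun (jetSpecializeR_Q q hq) i) j
      rw [Matrix.map_apply, Matrix.map_apply] at h
      rw [Matrix.map_apply, Matrix.map_apply, h]
      exact (rescale_ofLoc _ _).symm
    · rw [RingHom.coe_comp, RingHom.coe_comp, ← Matrix.map_map, ← Matrix.map_map, iotaJet_dQ,
        jetSpecialize_dQ]
      refine Matrix.ext fun i j => ?_
      have h := congrFun (congrFun (jetSpecializeR_dQ q hq k) i) j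
      rw [Matrix.map_apply] at h
      rw [Matrix.map_apply, Matrix.map_apply, Matrix.map_apply, map_mul, map_mul,
        tensorSpecialize_inl, tensorSpecialize_inr, h, rescale_z]
      rfl
  exact RingHom.congr_fun key a

theorem tensorSpecialize_iota (f : GLRing p n (Jet p n (Rpi π))) :
    tensorSpecialize q hq (iota n π f) =
      rescale p _ (algebraMap (MvPolynomial (Fin n × Fin n) (Rpi π)) (GLLoc n π)
        (MvPolynomial.C (pOverPi π))) (specialize q hq f) := by
  set c := algebraMap (MvPolynomial (Fin n × Fin n) (Rpi π)) (GLLoc n π)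
    (MvPolynomial.C (pOverPi π)) with hc
  have key : (tensorSpecialize q hq).comp (iota n π) = (rescale p _ c).comp (specialize q hq) := by
    refine GLRing.hom_ext (fun a => ?_) ?_
    · change tensorSpecialize q hq (iota n π (GLRing.C p n _ a)) =
        rescale p _ c (specialize q hq (GLRing.C p n _ a))
      rw [iota_C, specialize_C]
      exact tensorSpecialize_iotaJet q hq a
    · rw [RingHom.coe_comp, RingHom.coe_comp, ← Matrix.map_map, ← Matrix.map_map, iota_x,
        tensorSpecialize_x, specialize_x]
      exact Matrix.ext fun i j => (rescale_ofLoc _ _).symm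
  exact RingHom.congr_fun key f

theorem eval_ofLoc (N : Fin n → Matrix (Fin n) (Fin n) (Rpi π)) (hN : ∀ k, (N k).IsSymm)
    (a : GLLoc n π) : eval N hN (ofLoc n π a) = PCompl.of p (GLLoc n π) a := by
  rw [eval, ofLoc, RingHom.comp_apply, PCompl.lift_of, MvPolynomial.eval₂Hom_C]

theorem eval_z (N : Fin n → Matrix (Fin n) (Fin n) (Rpi π)) (hN : ∀ k, (N k).IsSymm)
    (k : Fin n) : (z n π k).map (eval N hN) = (N k).map (GLRing.C p n (Rpi π)) := by
  refine Matrix.ext fun i j => ?_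
  rw [Matrix.map_apply, z, Matrix.of_apply, eval, PCompl.lift_of, MvPolynomial.eval₂Hom_X']
  rfl

theorem eval_C (N : Fin n → Matrix (Fin n) (Fin n) (Rpi π)) (hN : ∀ k, (N k).IsSymm)
    (b : Rpi π) : eval N hN (C n π b) = GLRing.C p n (Rpi π) b := by
  rw [C, RingHom.comp_apply, eval_ofLoc]
  rfl

theorem eval_x (N : Fin n → Matrix (Fin n) (Fin n) (Rpi π)) (hN : ∀ k, (N k).IsSymm) :
    (x n π).map (eval N hN) = GLRing.x p n (Rpi π) := by
  refine Matrix.ext fun i j => ?_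
  rw [Matrix.map_apply, x, Matrix.map_apply, RingHom.comp_apply, eval_ofLoc]
  rfl

theorem eval_specialize {s : ℕ} (φ : Fin n → (Kalg p ≃ₐ[ℚ_[p]] Kalg p))
    (f : GLRing p n (Jet p n (Rpi π))) :
    eval (fun k => q.map (deltaPi s (φ k) π)) (fun _ => hq.symm.map _) (specialize q hq f) =
      evalMetric s φ π q hq f := by
  set E := eval (n := n) (fun k => q.map (deltaPi s (φ k) π)) (fun _ => hq.symm.map _) with hE
  have hEC : ∀ b, E (C n π b) = GLRing.C p n (Rpi π) b := eval_C _ _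
  have key : E.comp (specialize q hq) = evalMetric s φ π q hq := by
    refine GLRing.hom_ext (fun a => ?_) ?_
    · change E (specialize q hq (GLRing.C p n _ a)) = _
      rw [specialize_C, evalMetric, GLRing.lift_C, ← RingHom.comp_apply]
      refine RingHom.congr_fun (Jet.hom_ext (fun b => ?_) ?_ fun k => ?_) a
      · rw [Jet.lift_C]
        change E (jetSpecialize q hq (Jet.C p n _ b)) = _
        rw [jetSpecialize_C, hEC]
      · rw [Jet.lift_Q, RingHom.coe_comp, ← Matrix.map_map, jetSpecialize_Q]
        exact Matrix.ext fun i j => by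
          rw [Matrix.map_apply, Matrix.map_apply, hEC, Matrix.map_apply]
      · rw [Jet.lift_dQ, RingHom.coe_comp, ← Matrix.map_map, jetSpecialize_dQ, hE, eval_z]
    · rw [evalMetric, GLRing.lift_x, RingHom.coe_comp, ← Matrix.map_map, specialize_x, hE,
        eval_x]
  exact RingHom.congr_fun key f

end GLVar

/-- Elements with the same image under `ι` have the same specializations: after the partial
specialization `δ_{π,k} Q ↦ z_k`, the homomorphism `ι` becomes the substitution
`z_k ↦ (p / π) z_k`, which is injective. -/
theorem evalMetric_eq_of_iota_eq {s : ℕ} {φ : Fin n → (Kalg p ≃ₐ[ℚ_[p]] Kalg p)}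
    {q : Matrix (Fin n) (Fin n) (Rpi π)} {hq : IsMetric π q}
    {f g : GLRing p n (Jet p n (Rpi π))} (h : iota n π f = iota n π g) :
    evalMetric s φ π q hq f = evalMetric s φ π q hq g := by
  rw [← GLVar.eval_specialize, ← GLVar.eval_specialize]
  congr 1
  rw [← sub_eq_zero, ← map_sub]
  refine rescale_injective (c := algebraMap (MvPolynomial (Fin n × Fin n) (Rpi π)) (GLLoc n π)
      (MvPolynomial.C (pOverPi π)))
    (c' := algebraMap (MvPolynomial (Fin n × Fin n) (Rpi π)) (GLLoc n π)
      (MvPolynomial.C (piElt π))) ?_ (localization_mul_p_injective n π) ?_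
  · rw [← map_mul, ← map_mul, mul_comm, pi_mul_pOverPi, map_natCast, map_natCast]
  · rw [← GLVar.tensorSpecialize_iota, map_sub, h, sub_self, map_zero]

end Kernel

/-! ### Higher derivations and Frobenius lifts -/

section Derivation

variable {p : ℕ} [Fact p.Prime] {s : ℕ} {A : Type} [CommRing A]

theorem p_mul_cPoly (a b : A) :
    (p : A) * cPoly p s a b = a ^ p ^ s + b ^ p ^ s - (a + b) ^ p ^ s := by
  have hN : 0 < p ^ s := pow_pos (Fact.out : p.Prime).pos s
  have e : Finset.range (p ^ s + 1) = insert 0 (insert (p ^ s) (Finset.Ioo 0 (p ^ s))) := by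
    ext m
    simp only [Finset.mem_range, Finset.mem_insert, Finset.mem_Ioo]
    omega
  rw [add_pow, e, Finset.sum_insert (by simp [hN.ne]), Finset.sum_insert (by simp), cPoly,
    mul_neg, Finset.mul_sum]
  have : ∀ m ∈ Finset.Ioo 0 (p ^ s),
      (p : A) * ((((p ^ s).choose m / p : ℕ) : A) * a ^ m * b ^ (p ^ s - m)) =
        a ^ m * b ^ (p ^ s - m) * ((p ^ s).choose m : ℕ) := by
    intro m hm
    rw [Finset.mem_Ioo] at hm
    have h := Nat.mul_div_cancel' ((Fact.out : p.Prime).dvd_choose_pow hm.1.ne' hm.2.ne)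
    have h2 : (p : A) * (((p ^ s).choose m / p : ℕ) : A) = ((p ^ s).choose m : ℕ) := by
      rw [← Nat.cast_mul, h]
    rw [← h2]
    ring
  rw [Finset.sum_congr rfl this]
  simp only [pow_zero, Nat.sub_zero, Nat.choose_zero_right, Nat.cast_one, Nat.sub_self,
    Nat.choose_self]
  ring

/-- The Frobenius lift `a ↦ a ^ (p ^ s) + ϖ δ a` of a higher derivation is a homomorphism. -/
def IsHigherDerivation.toRingHom {ϖ ϖ' : A} (h : ϖ * ϖ' = p) {δ : A → A}
    (hδ : IsHigherDerivation p s ϖ ϖ' δ) : A →+* A :=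
  RingHom.mk' (⟨⟨fun a => a ^ p ^ s + ϖ * δ a, by rw [hδ.map_one]; simp⟩, fun a b => by
    simp only [hδ.map_mul]; ring⟩ : A →* A) fun a b => by
      simp only [MonoidHom.coe_mk, OneHom.coe_mk, hδ.map_add]
      linear_combination p_mul_cPoly (p := p) (s := s) a b + cPoly p s a b * h

theorem isHigherDerivation_of_ringHom {ϖ ϖ' : A} (h : ϖ * ϖ' = p)
    (hinj : ∀ a b : A, ϖ * a = ϖ * b → a = b) {δ : A → A} (ψ : A →+* A)
    (hψ : ∀ a, a ^ p ^ s + ϖ * δ a = ψ a) : IsHigherDerivation p s ϖ ϖ' δ where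
  map_one := hinj _ _ (by
    have := hψ 1
    rw [map_one, one_pow] at this
    linear_combination this)
  map_add a b := hinj _ _ (by
    have := hψ (a + b)
    rw [map_add, ← hψ, ← hψ] at this
    linear_combination this - p_mul_cPoly (p := p) (s := s) a b - cPoly p s a b * h)
  map_mul a b := hinj _ _ (by
    have := hψ (a * b)
    rw [map_mul, ← hψ, ← hψ, mul_pow] at this
    linear_combination this)

end Derivation

/-! ### Levi-Civita connections and the Levi-Civita equations -/

section Connection

variable {p : ℕ} [Fact p.Prime] {n s : ℕ}
  {φ : Fin n → (Kalg p ≃ₐ[ℚ_[p]] Kalg p)} (hφ : ∀ i, IsHigherFrobenius s (φ i)) {π : PiSet p}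

theorem piA_mul (n : ℕ) (π : PiSet p) :
    piA n π * GLRing.C p n (Rpi π) (pOverPi π) = (p : ARing n π) := by
  rw [← map_mul, pi_mul_pOverPi, map_natCast]

theorem piA_dvd (n : ℕ) (π : PiSet p) : piA n π ∣ (p : ARing n π) := ⟨_, (piA_mul n π).symm⟩

instance isAdicComplete_piA (n : ℕ) (π : PiSet p) :
    IsAdicComplete (Ideal.span {piA n π}) (ARing n π) :=
  isAdicComplete_pi (GLRing.C p n (Rpi π))

theorem isUnit_det_entryPow_x : IsUnit (entryPow (GLRing.x p n (Rpi π)) (p ^ s)).det :=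
  isUnit_det_entryPow (piA_dvd n π) (GLRing.isUnit_det_x p n _)

variable {Δ : Fin n → ARing n π → ARing n π}

/-- The Frobenius lifts of a `π`-connection, as homomorphisms. -/
def IsPiConnection.frob (hΔ : IsPiConnection s φ π Δ) (i : Fin n) : ARing n π →+* ARing n π :=
  (hΔ.derivation i).toRingHom (piA_mul n π)

theorem IsPiConnection.frob_apply (hΔ : IsPiConnection s φ π Δ) (i : Fin n) (a : ARing n π) :
    hΔ.frob i a = frobLift s π (Δ i) a := rfl

theorem IsPiConnection.coe_frob (hΔ : IsPiConnection s φ π Δ) (i : Fin n) :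
    ⇑(hΔ.frob i) = frobLift s π (Δ i) := rfl

theorem IsPiConnection.frob_C (hΔ : IsPiConnection s φ π Δ) (i : Fin n) (b : Rpi π) :
    hΔ.frob i (GLRing.C p n _ b) = GLRing.C p n _ (frobRpi (hφ i) π b) := by
  obtain ⟨d, hd, h⟩ := hΔ.extends_base i b
  have e : d = deltaPi s (φ i) π b := Subtype.ext (by rw [hd, coe_deltaPi (hφ i)])
  rw [hΔ.frob_apply, frobLift, h, frobRpi_apply, map_add, map_mul, map_pow, e]

/-- A lift to `𝒜` of the Frobenius of `R_π` which reduces to the Frobenius on `x` reduces to the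
Frobenius on all of `𝒜`. -/
theorem pi_dvd_sub_pow {i : Fin n} {ψ : ARing n π →+* ARing n π}
    (hC : ∀ b, ψ (GLRing.C p n _ b) = GLRing.C p n _ (frobRpi (hφ i) π b))
    (hx : ∀ a b, piA n π ∣ ((GLRing.x p n (Rpi π)).map ψ
      - entryPow (GLRing.x p n (Rpi π)) (p ^ s)) a b) (a : ARing n π) :
    piA n π ∣ ψ a - a ^ p ^ s := by
  have h0 : (p : ARing n π ⧸ Ideal.span {piA n π}) ^ 1 = 0 := by
    have : Ideal.Quotient.mk (Ideal.span {piA n π}) (p : ARing n π) = 0 :=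
      Ideal.Quotient.eq_zero_iff_mem.2 (Ideal.mem_span_singleton.2 (piA_dvd n π))
    rwa [map_natCast, ← pow_one (p : ARing n π ⧸ Ideal.span {piA n π})] at this
  have key : (Ideal.Quotient.mk (Ideal.span {piA n π})).comp ψ = frobMod s (piA_dvd n π) := by
    refine GLRing.hom_ext_of_pow_eq_zero h0 (fun b => ?_) ?_
    · rw [RingHom.comp_apply, frobMod_apply, hC, mk_eq_mk_iff_dvd, frobRpi_apply, map_add, map_pow,
        map_mul, add_sub_cancel_left]
      exact dvd_mul_right _ _
    · rw [← entryPow_map_mk, RingHom.coe_comp, ← Matrix.map_map]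
      exact map_mk_eq_iff.2 hx
  have := RingHom.congr_fun key a
  rwa [RingHom.comp_apply, frobMod_apply, mk_eq_mk_iff_dvd] at this

/-- Frobenius lifts on `𝒜` come from `π`-connections. -/
theorem exists_isPiConnection {ψ : Fin n → ARing n π →+* ARing n π}
    (hC : ∀ i b, ψ i (GLRing.C p n _ b) = GLRing.C p n _ (frobRpi (hφ i) π b))
    (hx : ∀ i a b, piA n π ∣ ((GLRing.x p n (Rpi π)).map (ψ i)
      - entryPow (GLRing.x p n (Rpi π)) (p ^ s)) a b) :
    ∃ Δ, IsPiConnection s φ π Δ ∧ ∀ i, frobLift s π (Δ i) = ψ i := by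
  choose Δ hΔ using fun i => pi_dvd_sub_pow hφ (hC i) (hx i)
  have hψ : ∀ i a, a ^ p ^ s + piA n π * Δ i a = ψ i a := fun i a => by rw [← hΔ]; ring
  refine ⟨Δ, ⟨fun i => isHigherDerivation_of_ringHom (piA_mul n π)
    (fun _ _ => ARing.mul_pi_injective) (ψ i) (hψ i), fun i a => ?_⟩, fun i => funext (hψ i)⟩
  refine ⟨deltaPi s (φ i) π a, coe_deltaPi (hφ i) π a, ARing.mul_pi_injective ?_⟩
  rw [← hΔ, hC, frobRpi_apply, map_add, map_pow, map_mul, add_sub_cancel_left]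

theorem isPiConnection_ext {Δ Δ' : Fin n → ARing n π → ARing n π}
    (h : ∀ i, frobLift s π (Δ i) = frobLift s π (Δ' i)) : Δ = Δ' := by
  funext i a
  have := congrFun (h i) a
  simp only [frobLift, add_right_inj] at this
  exact ARing.mul_pi_injective this

theorem frobLift_x (Δ : Fin n → ARing n π → ARing n π) (i : Fin n) :
    (GLRing.x p n (Rpi π)).map (frobLift s π (Δ i)) =
      entryPow (GLRing.x p n (Rpi π)) (p ^ s) * lambda s π Δ i := by
  rw [lambda, ← Matrix.mul_assoc, Matrix.mul_nonsing_inv _ isUnit_det_entryPow_x, Matrix.one_mul]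

theorem lambda_sub_one (Δ : Fin n → ARing n π → ARing n π) (i : Fin n) :
    lambda s π Δ i - 1 = piA n π • (christoffel s π Δ i).transpose := by
  have e : (GLRing.x p n (Rpi π)).map (frobLift s π (Δ i)) =
      entryPow (GLRing.x p n (Rpi π)) (p ^ s) + piA n π • (GLRing.x p n (Rpi π)).map (Δ i) :=
    Matrix.ext fun a b => rfl
  rw [lambda, e, Matrix.mul_add, Matrix.nonsing_inv_mul _ isUnit_det_entryPow_x,
    add_sub_cancel_left, Matrix.mul_smul, christoffel, Matrix.transpose_transpose]

theorem substY_scaleSymbol (L : SymbolTuple p n (R p))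
    (Ξ : Fin n → Matrix (Fin n) (Fin n) (ARing n π)) (i j k : Fin n) :
    substY (GLRing.C p n (Rpi π)) Ξ (scaleSymbol π L k i j) =
      GLRing.C p n (Rpi π) (pOverPi π) *
        substY ((GLRing.C p n (Rpi π)).comp (algebraMap (R p) (Rpi π))) Ξ (L k i j) := by
  rw [scaleSymbol, Matrix.map_apply, map_mul, substY_of, MvPolynomial.eval₂Hom_C]
  congr 1
  have : (substY (GLRing.C p n (Rpi π)) Ξ).comp (PCompl.lift
      ((PCompl.of p (MvPolynomial (Fin n × Fin n × Fin n) (Rpi π))).comp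
        (MvPolynomial.map (algebraMap (R p) (Rpi π))))) =
      substY ((GLRing.C p n (Rpi π)).comp (algebraMap (R p) (Rpi π))) Ξ := by
    refine PCompl.hom_ext (MvPolynomial.ringHom_ext (fun b => ?_) fun ijk => ?_)
    · rw [RingHom.comp_apply, RingHom.comp_apply, RingHom.comp_apply, PCompl.lift_of,
        RingHom.comp_apply, substY_of, substY_of, MvPolynomial.map_C, MvPolynomial.eval₂Hom_C,
        MvPolynomial.eval₂Hom_C]
      rfl
    · rw [RingHom.comp_apply, RingHom.comp_apply, RingHom.comp_apply, PCompl.lift_of,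
        RingHom.comp_apply, substY_of, substY_of, MvPolynomial.map_X, MvPolynomial.eval₂Hom_X',
        MvPolynomial.eval₂Hom_X']
  exact RingHom.congr_fun this (L k i j)

/-- The Levi-Civita equations over `𝒜` of a metric `q`. -/
abbrev MetricLC (q : Matrix (Fin n) (Fin n) (Rpi π)) (L : SymbolTuple p n (R p))
    (Λ : Fin n → Matrix (Fin n) (Fin n) (ARing n π)) : Prop :=
  LCSystem s (piA n π) ((GLRing.C p n (Rpi π)).comp (algebraMap (R p) (Rpi π))) L
    (GLRing.x p n (Rpi π)) (q.map (GLRing.C p n (Rpi π)))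
    (fun i => (q.map (frobRpi (hφ i) π)).map (GLRing.C p n (Rpi π))) Λ

theorem metricLC_data (hp : p ≠ 2) {q : Matrix (Fin n) (Fin n) (Rpi π)} (hq : IsMetric π q)
    {L : SymbolTuple p n (R p)} (hL : IsTorsionSymbol L) :
    LCData (piA n π) (p : ARing n π)
      (fun i => (entryPow (GLRing.x p n (Rpi π)) (p ^ s)).transpose *
        (q.map (frobRpi (hφ i) π)).map (GLRing.C p n (Rpi π)) *
          entryPow (GLRing.x p n (Rpi π)) (p ^ s))
      (entryPow ((GLRing.x p n (Rpi π)).transpose * q.map (GLRing.C p n (Rpi π)) *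
        GLRing.x p n (Rpi π)) (p ^ s))
      (fun Λ k i j => substY ((GLRing.C p n (Rpi π)).comp (algebraMap (R p) (Rpi π))) Λ
        (L k i j)) := by
  refine lcData (piA_dvd n π) ?_ _ hL (GLRing.isUnit_det_x p n _) (hq.symm.map _)
    (isUnit_det_map _ hq.isUnit) (fun i => (hq.symm.map _).map _) fun i a b => ?_
  · have := (isUnit_two hp).map ((GLRing.C p n (Rpi π)).comp (algebraMap (R p) (Rpi π)))
    rwa [map_ofNat] at this
  · rw [Matrix.sub_apply, Matrix.map_apply, Matrix.map_apply, frobRpi_apply, entryPow,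
      Matrix.map_apply, Matrix.map_apply, map_add, map_mul, map_pow, add_sub_cancel_left]
    exact dvd_mul_right _ _

theorem metric_eq_iff {q : Matrix (Fin n) (Fin n) (Rpi π)} {i : Fin n}
    {ψ : ARing n π →+* ARing n π}
    (hC : ∀ b, ψ (GLRing.C p n _ b) = GLRing.C p n _ (frobRpi (hφ i) π b))
    {Λ : Matrix (Fin n) (Fin n) (ARing n π)}
    (hΛ : (GLRing.x p n (Rpi π)).map ψ = entryPow (GLRing.x p n (Rpi π)) (p ^ s) * Λ) :
    ((GLRing.x p n (Rpi π)).transpose * q.map (GLRing.C p n (Rpi π)) *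
        GLRing.x p n (Rpi π)).map ψ =
      Λ.transpose * ((entryPow (GLRing.x p n (Rpi π)) (p ^ s)).transpose *
        (q.map (frobRpi (hφ i) π)).map (GLRing.C p n (Rpi π)) *
          entryPow (GLRing.x p n (Rpi π)) (p ^ s)) * Λ := by
  have e : (q.map (GLRing.C p n (Rpi π))).map ψ =
      (q.map (frobRpi (hφ i) π)).map (GLRing.C p n (Rpi π)) :=
    Matrix.ext fun a b => hC _
  rw [Matrix.map_mul, Matrix.map_mul, Matrix.transpose_map, hΛ, e, Matrix.transpose_mul]
  simp only [Matrix.mul_assoc]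

theorem hMap_C {q : Matrix (Fin n) (Fin n) (Rpi π)} (hq : IsMetric π q) (b : Rpi π) :
    hMap π q hq (GLRing.C p n _ b) = GLRing.C p n _ b := by
  rw [hMap, GLRing.lift_C]

theorem hMap_x {q : Matrix (Fin n) (Fin n) (Rpi π)} (hq : IsMetric π q) :
    (GLRing.x p n _).map (hMap π q hq) = (GLRing.x p n (Rpi π)).transpose *
      q.map (GLRing.C p n (Rpi π)) * GLRing.x p n (Rpi π) := by
  rw [hMap, GLRing.lift_x]

theorem IsLeviCivita.metricLC {q : Matrix (Fin n) (Fin n) (Rpi π)} {hq : IsMetric π q}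
    {L : SymbolTuple p n (R p)} {Δ : Fin n → ARing n π → ARing n π}
    (h : IsLeviCivita s φ π q hq (scaleSymbol π L) Δ) :
    MetricLC hφ q L (lambda s π Δ) where
  metric i := by
    obtain ⟨Δ₀, h₀, hx₀, hH⟩ := h.metric
    rw [← metric_eq_iff hφ (h.connection.frob_C hφ i) (frobLift_x Δ i), ← hMap_x hq]
    refine Matrix.ext fun a b => ?_
    refine (hH i (GLRing.x p n (Rpi π) a b)).trans ?_
    rw [frobLift, hx₀, mul_zero, add_zero, map_pow]
    rfl
  symm i j k := by
    rw [lambda_sub_one, lambda_sub_one, Matrix.smul_apply, Matrix.smul_apply, smul_eq_mul,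
      smul_eq_mul, ← mul_sub, Matrix.transpose_apply, Matrix.transpose_apply, h.symmetric,
      substY_scaleSymbol, ← mul_assoc, piA_mul]
  cong i a b := by
    rw [lambda_sub_one]
    exact dvd_mul_right _ _

theorem exists_isLeviCivita (hφ : ∀ i, IsHigherFrobenius s (φ i))
    (hp : p ≠ 2) {q : Matrix (Fin n) (Fin n) (Rpi π)} (hq : IsMetric π q)
    {L : SymbolTuple p n (R p)} (hL : IsTorsionSymbol L) :
    ∃ Δ, IsLeviCivita s φ π q hq (scaleSymbol π L) Δ := by
  set x := GLRing.x p n (Rpi π) with hx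
  have data := metricLC_data hφ hp hq hL
  obtain ⟨Λ, hΛ⟩ := exists_isLCSolution data
  have hdet : ∀ i, IsUnit (entryPow x (p ^ s) * Λ i).det := fun i => by
    rw [Matrix.det_mul]
    refine isUnit_det_entryPow_x.mul ?_
    have := congrArg Matrix.det (hΛ.metric i)
    rw [Matrix.det_mul] at this
    exact isUnit_of_mul_isUnit_right (this ▸ data.unit)
  -- the Frobenius lifts with `φ_i(x) = x^(p^s) Λ_i`, and those with `φ_{i,0}(x) = x^(p^s)`
  let ψ : Fin n → ARing n π →+* ARing n π := fun i =>
    GLRing.lift ((GLRing.C p n (Rpi π)).comp (frobRpi (hφ i) π)) _ (hdet i)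
  let ψ₀ : Fin n → ARing n π →+* ARing n π := fun i =>
    GLRing.lift ((GLRing.C p n (Rpi π)).comp (frobRpi (hφ i) π)) (entryPow x (p ^ s))
      isUnit_det_entryPow_x
  have hC : ∀ i b, ψ i (GLRing.C p n _ b) = GLRing.C p n _ (frobRpi (hφ i) π b) :=
    fun i b => GLRing.lift_C _ _ _ b
  have hC₀ : ∀ i b, ψ₀ i (GLRing.C p n _ b) = GLRing.C p n _ (frobRpi (hφ i) π b) :=
    fun i b => GLRing.lift_C _ _ _ b
  have hψx : ∀ i, x.map (ψ i) = entryPow x (p ^ s) * Λ i := fun i => GLRing.lift_x _ _ _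
  have hψx₀ : ∀ i, x.map (ψ₀ i) = entryPow x (p ^ s) := fun i => GLRing.lift_x _ _ _
  obtain ⟨Δ, hΔ, hΔψ⟩ := exists_isPiConnection hφ hC fun i => by
    rw [hψx]
    obtain ⟨M, hM⟩ := entries_dvd_iff.1 (hΛ.cong i)
    refine entries_dvd_iff.2 ⟨entryPow x (p ^ s) * M, ?_⟩
    rw [← Matrix.mul_smul, ← hM, Matrix.mul_sub, Matrix.mul_one]
  obtain ⟨Δ₀, hΔ₀, hΔψ₀⟩ := exists_isPiConnection hφ hC₀ fun i => by
    rw [hψx₀]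
    intro a b
    rw [sub_self]
    exact dvd_zero _
  have hlam : lambda s π Δ = Λ := by
    funext i
    rw [lambda, hΔψ, hψx, ← Matrix.mul_assoc, Matrix.nonsing_inv_mul _ isUnit_det_entryPow_x,
      Matrix.one_mul]
  refine ⟨Δ, hΔ, ⟨Δ₀, hΔ₀, fun i j k => ?_, fun i a => ?_⟩, fun i j k => ?_⟩
  · have h1 : frobLift s π (Δ₀ i) (x j k) = x j k ^ p ^ s := by
      rw [hΔψ₀]
      exact congrFun (congrFun (hψx₀ i) j) k
    rw [frobLift, add_eq_left] at h1
    exact ARing.mul_pi_injective (by rw [h1, mul_zero])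
  · rw [hΔψ, hΔψ₀, ← RingHom.comp_apply, ← RingHom.comp_apply]
    refine RingHom.congr_fun (GLRing.hom_ext (fun b => ?_) ?_) a
    · change ψ i (hMap π q hq (GLRing.C p n _ b)) = hMap π q hq (ψ₀ i (GLRing.C p n _ b))
      rw [hMap_C, hC, hC₀, hMap_C]
    · rw [RingHom.coe_comp, RingHom.coe_comp, ← Matrix.map_map, ← Matrix.map_map, hψx₀,
        entryPow_map, hMap_x, metric_eq_iff hφ (hC i) (hψx i)]
      exact hΛ.metric i
  · refine ARing.mul_pi_injective ?_
    have := hΛ.symm i j k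
    rw [← hlam, lambda_sub_one, lambda_sub_one, Matrix.smul_apply, Matrix.smul_apply, smul_eq_mul,
      smul_eq_mul, ← mul_sub, Matrix.transpose_apply, Matrix.transpose_apply] at this
    rw [this, substY_scaleSymbol, ← mul_assoc, piA_mul]

theorem IsLeviCivita.unique (hφ : ∀ i, IsHigherFrobenius s (φ i))
    (hp : p ≠ 2) {q : Matrix (Fin n) (Fin n) (Rpi π)} {hq : IsMetric π q}
    {L : SymbolTuple p n (R p)} (hL : IsTorsionSymbol L) {Δ Δ' : Fin n → ARing n π → ARing n π}
    (h : IsLeviCivita s φ π q hq (scaleSymbol π L) Δ)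
    (h' : IsLeviCivita s φ π q hq (scaleSymbol π L) Δ') : Δ = Δ' := by
  have e := IsLCSolution.unique (metricLC_data hφ hp hq hL) (h.metricLC hφ)
    (h'.metricLC hφ)
  refine isPiConnection_ext (s := s) fun i => ?_
  rw [← h.connection.coe_frob, ← h'.connection.coe_frob]
  refine congrArg _ (GLRing.hom_ext (fun b => ?_) ?_)
  · rw [h.connection.frob_C hφ, h'.connection.frob_C hφ]
  · rw [h.connection.coe_frob, h'.connection.coe_frob, frobLift_x, frobLift_x, e]

theorem evalMetric_C {q : Matrix (Fin n) (Fin n) (Rpi π)} {hq : IsMetric π q}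
    (a : Jet p n (Rpi π)) : evalMetric s φ π q hq (GLRing.C p n _ a) =
      Jet.lift (GLRing.C p n (Rpi π)) (q.map (GLRing.C p n (Rpi π))) (hq.symm.map _)
      (isUnit_det_map _ hq.isUnit)
      (fun k => (q.map (deltaPi s (φ k) π)).map (GLRing.C p n (Rpi π)))
      (fun _ => (hq.symm.map _).map _) a := by
  rw [evalMetric, GLRing.lift_C]

/-- Specializing the universal solution at a metric gives the solution for that metric. -/
theorem UniversalLC.metricLC {q : Matrix (Fin n) (Fin n) (Rpi π)} (hq : IsMetric π q)
    {L : SymbolTuple p n (R p)}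
    {Λ : Fin n → Matrix (Fin n) (Fin n) (GLRing p n (Jet p n (Rpi π)))}
    (h : UniversalLC p n (Rpi π) s (piElt π) (algebraMap (R p) (Rpi π)) L Λ) :
    MetricLC hφ q L fun i => (Λ i).map (evalMetric s φ π q hq) := by
  have hm : ∀ M : Matrix (Fin n) (Fin n) (Jet p n (Rpi π)),
      (M.map (GLRing.C p n (Jet p n (Rpi π)))).map (evalMetric s φ π q hq) = M.map
        (Jet.lift (GLRing.C p n (Rpi π)) (q.map (GLRing.C p n (Rpi π))) (hq.symm.map _)
        (isUnit_det_map _ hq.isUnit)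
        (fun k => (q.map (deltaPi s (φ k) π)).map (GLRing.C p n (Rpi π)))
        (fun _ => (hq.symm.map _).map _)) :=
    fun M => Matrix.ext fun i j => evalMetric_C (hq := hq) (M i j)
  refine IsLCSolution.map (evalMetric s φ π q hq) h ?_ ?_ ?_ ?_ fun k => ?_
  · rw [evalMetric_C, Jet.lift_C]
  · refine RingHom.ext fun r => (evalMetric_C (hq := hq) _).trans ?_
    rw [RingHom.comp_apply, Jet.lift_C]
    rfl
  · rw [evalMetric, GLRing.lift_x]
  · rw [hm, Jet.lift_Q]
  · rw [hm, jetFrob_map, Jet.lift_Q, Jet.lift_dQ, Jet.lift_C]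
    refine Matrix.ext fun i j => ?_
    rw [Matrix.map_apply, Matrix.map_apply, frobRpi_apply, map_add, map_mul, map_pow]
    rfl

end Connection

end ArithLC

end

open ArithLC in
theorem theorem5 (p : ℕ) [Fact p.Prime] (hp : p ≠ 2) (n s : ℕ) (hs : 1 ≤ s)
    (φ : Fin n → (Kalg p ≃ₐ[ℚ_[p]] Kalg p)) (hφ : ∀ i, IsHigherFrobenius s (φ i))
    (L : SymbolTuple p n (R p)) (hL : IsTorsionSymbol L) :
    ∃ Λ : Fin n → Matrix (Fin n) (Fin n) (GLRing p n (Jet p n (R p))),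
      (∀ i, StrictlyOverconvergent (Λ i)) ∧
      ∀ (π : PiSet p) (q : Matrix (Fin n) (Fin n) (Rpi π)) (hq : IsMetric π q),
        (∃! Δ : Fin n → ARing n π → ARing n π,
          IsLeviCivita s φ π q hq (scaleSymbol π L) Δ) ∧
        ∀ Δ : Fin n → ARing n π → ARing n π,
          IsLeviCivita s φ π q hq (scaleSymbol π L) Δ →
          ∀ (i : Fin n) (Θ : Matrix (Fin n) (Fin n) (GLRing p n (Jet p n (Rpi π)))),
            Represents π Θ (Λ i) →
            (GLRing.x p n (Rpi π)).map (frobLift s π (Δ i)) =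
              entryPow (GLRing.x p n (Rpi π)) (p ^ s) * Θ.map (evalMetric s φ π q hq) := by
  obtain ⟨Λ, hΛ⟩ := exists_universalLC_p (n := n) hp s hL
  refine ⟨Λ, hΛ.strictlyOverconvergent hp hL, fun π q hq => ⟨?_, fun Δ hΔ i Θ hΘ => ?_⟩⟩
  · obtain ⟨Δ, hΔ⟩ := exists_isLeviCivita hφ hp hq hL
    exact ⟨Δ, hΔ, fun Δ' hΔ' => hΔ'.unique hφ hp hL hΔ⟩
  · obtain ⟨Λπ, hΛπ⟩ := exists_universalLC_pi (n := n) hp s π hL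
    have e := IsLCSolution.unique (metricLC_data hφ hp hq hL) (hΔ.metricLC hφ)
      (hΛπ.metricLC hφ hq)
    rw [frobLift_x, e]
    congr 1
    refine Matrix.ext fun a b => evalMetric_eq_of_iota_eq (hq := hq) ?_
    rw [hΘ, hΛ.represents hp hL hΛπ]
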